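/- Let $a,b\in\mathbb{R}$ with $b^2>a^2>0$, let $\theta\in[0,1]$, $m\in[1,2)$ and $s\ge 0$. Consider on $\mathbb{R}^3$ the linear Cauchy problem $$u_{tt}-a^2\Delta u-(b^2-a^2)\nabla\operatorname{div}u+(-\Delta)^{\theta}u_t=0,\quad (t,x)\in(0,\infty)\times\mathbb{R}^3,\qquad (u,u_t)(0,x)=(u_0,u_1)(x),$$ for $u=(u^{(1)},u^{(2)},u^{(3)})$, with data $(u_0^{(k)},u_1^{(k)})\in\mathcal{D}^s_{m,1}:=(H^{s+1}\cap L^m)\times(H^s\cap L^m)$ for $k=1,2,3$, where $$\|(f,g)\|_{\mathcal{D}^s_{m,1}}:=\|f\|_{H^{s+1}}+\|f\|_{L^m}+\|g\|_{H^s}+\|g\|_{L^m}.$$ Solutions are energy solutions: $u^{(k)}\in C([0,\infty),H^1)\cap C^1([0,\infty),L^2)$, the equation holds in the sense of tempered distributions for each $t>0$, and the initial conditions hold. Here $|D|^\sigma$ and $(-\Delta)^\theta$ are the Fourier multipliers with symbols $|\xi|^\sigma$ and $|\xi|^{2\theta}$. If $\theta\in[0,1/2)$, let $\rho_{s+1}$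 be any real number with $$\rho_{s+1}<\min\left\{\frac{6-3m+2sm+2m(1-2\theta)}{4m(1-\theta)};\ \frac{6-3m+2sm}{4m\theta}\right\};$$ in addition, if $m<6/5$, let $\rho_0$ be any real number with $$\rho_0<\min\left\{\frac{6-5m+2m(1-2\theta)}{4m(1-\theta)};\ \frac{6-5m}{4m\theta}\right\},$$ and if $m\ge 6/5$, let $\rho_1$ be any real number with $$\rho_1<\min\left\{\frac{6-3m+2m(1-2\theta)}{4m(1-\theta)};\ \frac{6-3m}{4m\theta}\right\}$$ (for $\theta=0$ the second entry of each minimum is read as $+\infty$). Set $$d_{0,m}(t)=\begin{cases}(1+t)^{-\rho_0}&\theta\in[0,1/2),\ m\in[1,6/5),\\(1+t)^{1-\rho_1}&\theta\in[0,1/2),\ m\in[6/5,2),\\(1+t)^{-\frac{6-5m}{4m\theta}}&\theta\in[1/2,1],\ m\in[1,6/5),\\(1+t)^{1-\frac{6-3m}{4m\theta}}&\theta\in[1/2,1],\ m\in[6/5,2),\end{cases}$$ $$d_{s+1,m}(t)=\begin{cases}(1+t)^{-\rho_{s+1}}&\theta\in[0,1/2),\\(1+t)^{-\frac{6-3m+2sm}{4m\theta}}&\theta\in[1/2,1].\end{cases}$$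 Then there is a constant $C>0$, depending only on $a,b,\theta,m,s$ and the chosen exponents $\rho_0,\rho_1,\rho_{s+1}$ (not on the data, the solution or $t$), such that for all such data, every energy solution $u$, all $t\ge0$ and $k=1,2,3$, $$\|u^{(k)}(t,\cdot)\|_{L^2}\le C\,d_{0,m}(t)\sum_{j=1}^3\|(u_0^{(j)},u_1^{(j)})\|_{\mathcal{D}^0_{m,1}},$$ $$\||D|^{s+1}u^{(k)}(t,\cdot)\|_{L^2}+\||D|^su_t^{(k)}(t,\cdot)\|_{L^2}\le C\,d_{s+1,m}(t)\sum_{j=1}^3\|(u_0^{(j)},u_1^{(j)})\|_{\mathcal{D}^s_{m,1}}.$$ -/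

import Mathlib

open MeasureTheory Filter Topology
open scoped FourierTransform LineDeriv SchwartzMap Laplacian ENNReal

noncomputable section

namespace DampedElastic

/-- Three-dimensional Euclidean space. -/
abbrev E3 : Type := EuclideanSpace ℝ (Fin 3)

/-- The space `L²(ℝ³; ℂ)`. -/
abbrev L2 : Type := Lp ℂ 2 (volume : Measure E3)

/-- The Bessel potential norm `‖f‖_{H^σ} = (∫ (1 + |ξ|²)^σ |f̂(ξ)|² dξ)^{1/2} ∈ [0, ∞]`, where the
frequency variable is `2πξ` because the Fourier transform has the kernel `exp (-2πi⟨x, ξ⟩)`. -/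
def sobolevNorm (σ : ℝ) (f : L2) : ℝ≥0∞ :=
  (∫⁻ ξ : E3, ENNReal.ofReal ((1 + (2 * Real.pi * ‖ξ‖) ^ 2) ^ σ)
    * ‖((𝓕 f : L2) : E3 → ℂ) ξ‖ₑ ^ (2 : ℕ)) ^ (1 / 2 : ℝ)

/-- The norm `‖|D|^σ f‖_{L²} ∈ [0, ∞]`, for `|D|^σ` the Fourier multiplier with symbol `|ξ|^σ`
(`|2πξ|^σ` for the Fourier transform used here). -/
def rieszNorm (σ : ℝ) (f : L2) : ℝ≥0∞ :=
  (∫⁻ ξ : E3, ENNReal.ofReal ((2 * Real.pi * ‖ξ‖) ^ (2 * σ))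
    * ‖((𝓕 f : L2) : E3 → ℂ) ξ‖ₑ ^ (2 : ℕ)) ^ (1 / 2 : ℝ)

/-- The tempered distribution `(-Δ)^θ f = 𝓕⁻¹(|ξ|^{2θ} 𝓕 f)` for `f ∈ L²` and `θ ≥ 0`, evaluated at
a Schwartz function `φ`. -/
def fracLaplacian (θ : ℝ) (f : L2) (φ : 𝓢(E3, ℂ)) : ℂ :=
  ∫ ξ : E3, (((2 * Real.pi * ‖ξ‖) ^ (2 * θ) : ℝ) : ℂ)
    * ((𝓕 f : L2) : E3 → ℂ) ξ * (𝓕⁻ φ : 𝓢(E3, ℂ)) ξ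

/-- The standard unit vector `e_k` of `ℝ³`. -/
def unitVec (k : Fin 3) : E3 := EuclideanSpace.single k (1 : ℝ)

/-- The divergence of a vector field in `L²(ℝ³)³`, as a tempered distribution. -/
def divergence (w : Fin 3 → L2) : 𝓢'(E3, ℂ) :=
  ∑ j : Fin 3, ∂_{unitVec j} ((w j : L2) : 𝓢'(E3, ℂ))

/-- `u`, with time derivative `u_t = v`, is an energy solution of
`u_tt - a² Δu - (b² - a²) ∇ div u + (-Δ)^θ u_t = 0` on `(0, ∞) × ℝ³`, `u(0) = u₀`, `u_t(0) = u₁`.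
The components of `u` lie in `C([0,∞), H¹) ∩ C¹([0,∞), L²)`, and the equation holds in the sense of
tempered distributions for every `t > 0`. The values of `u`, `v` at negative times are irrelevant.
-/
structure IsEnergySolution (a b θ : ℝ) (u₀ u₁ : Fin 3 → L2) (u v : ℝ → Fin 3 → L2) : Prop where
  hasDeriv : ∀ t : ℝ, 0 ≤ t → ∀ k : Fin 3,
    HasDerivWithinAt (fun τ => u τ k) (v t k) (Set.Ici 0) t
  continuous_deriv : ∀ k : Fin 3, ContinuousOn (fun τ => v τ k) (Set.Ici 0)
  finite_energy : ∀ t : ℝ, 0 ≤ t → ∀ k : Fin 3, rieszNorm 1 (u t k) < ⊤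
  continuous_energy : ∀ t : ℝ, 0 ≤ t → ∀ k : Fin 3,
    Tendsto (fun τ => rieszNorm 1 (u τ k - u t k)) (𝓝[Set.Ici 0] t) (𝓝 0)
  equation : ∀ t : ℝ, 0 < t → ∀ k : Fin 3, ∀ φ : 𝓢(E3, ℂ),
    HasDerivAt (fun τ => ((v τ k : L2) : 𝓢'(E3, ℂ)) φ)
      ((a ^ 2 : ℂ) * (Δ ((u t k : L2) : 𝓢'(E3, ℂ))) φ
        + ((b : ℂ) ^ 2 - (a : ℂ) ^ 2) * (∂_{unitVec k} (divergence (u t))) φ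
        - fracLaplacian θ (v t k) φ) t
  initial_position : u 0 = u₀
  initial_velocity : v 0 = u₁

/-- The norm of `(H^{s+1} ∩ L^m) × (H^s ∩ L^m)`, with values in `[0, ∞]`. -/
def dataNorm (m s : ℝ) (f g : L2) : ℝ≥0∞ :=
  sobolevNorm (s + 1) f + eLpNorm f (ENNReal.ofReal m) volume
    + sobolevNorm s g + eLpNorm g (ENNReal.ofReal m) volume

/-- `ρ < min {(6-5m+2m(1-2θ))/(4m(1-θ)), (6-5m)/(4mθ)}`. For `θ = 0` the second entry is `+∞`. -/
def AdmissibleZero (θ m ρ : ℝ) : Prop :=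
  ρ < (6 - 5 * m + 2 * m * (1 - 2 * θ)) / (4 * m * (1 - θ)) ∧
    (θ ≠ 0 → ρ < (6 - 5 * m) / (4 * m * θ))

/-- `ρ < min {(6-3m+2sm+2m(1-2θ))/(4m(1-θ)), (6-3m+2sm)/(4mθ)}`. For `θ = 0` the second entry is
`+∞`. -/
def AdmissibleHigh (θ m s ρ : ℝ) : Prop :=
  ρ < (6 - 3 * m + 2 * s * m + 2 * m * (1 - 2 * θ)) / (4 * m * (1 - θ)) ∧
    (θ ≠ 0 → ρ < (6 - 3 * m + 2 * s * m) / (4 * m * θ))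

/-- The decay function `d_{0,m}(t)`, for the choice `ρ₀`, `ρ₁` of the exponents. -/
def decayZero (θ m ρ₀ ρ₁ t : ℝ) : ℝ :=
  if θ < 1 / 2 then
    if m < 6 / 5 then (1 + t) ^ (-ρ₀) else (1 + t) ^ (1 - ρ₁)
  else
    if m < 6 / 5 then (1 + t) ^ (-((6 - 5 * m) / (4 * m * θ)))
    else (1 + t) ^ (1 - (6 - 3 * m) / (4 * m * θ))

/-- The decay function `d_{s+1,m}(t)`, for the choice `ρ` of the exponent. -/
def decayHigh (θ m s ρ t : ℝ) : ℝ :=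
  if θ < 1 / 2 then (1 + t) ^ (-ρ)
  else (1 + t) ^ (-((6 - 3 * m + 2 * s * m) / (4 * m * θ)))

end DampedElastic

end

/-!
After the Fourier transform the equation becomes a damped oscillator at each frequency, and the
estimates follow from an energy method for the oscillator and from integration over frequencies.

*Reduction to oscillators.* Write `r = 2π|ξ|` (`rad`) and `d = r^{2θ}` (`damp`). The part of `û`
parallel to `ξ` solves `x'' + d x' + b² r² x = 0` and the part orthogonal to `ξ` solves the same
equation with `a` (`IsEnergySolution.isOscillator_longPart`,
`IsEnergySolution.isOscillator_transPart`). The equation is only given against test functions, so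
the oscillator equation is first obtained for `(1 + |ξ|²)⁻¹ û_t`, strongly in `L²`
(`IsEnergySolution.hasDerivAt_bessel`), which is enough on bounded sets of frequencies.

*Decay at a frequency.* The corrected energy `lyap` satisfies a differential inequality with the
rate `d r² / (r² + d²)` (`rate`), which gives the decay of `x`. The energy itself is dissipated
with the rate `d`, up to a source which is controlled by `x`; so only the initial velocity comes
with the factor `exp (-d t)`, and the rest carries the additional factor `r²`
(`IsOscillator.exists_energy_le`). A function in `L²` has no values at single frequencies: all
inequalities are proved for integrals over arbitrary sets of frequencies on which the rate is
bounded below by a rational number, and then hold almost everywhere. The result is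
`exists_fourier_le`.

*Integration over frequencies.* For `r ≥ 1` the rate is bounded below and the Sobolev norms of the
data suffice. For `r ≤ 1` the rate is comparable to `r^p` with `p = max (2θ, 2 - 2θ)` (`lowExp`),
and `r² + d²` behaves as `r^q` with `q = min (2, 4θ)` (`lowOrder`). Bernstein's inequality
(`lintegral_fourier_low_le`) bounds the mass of the data in `r ≤ R` by `R^g`, where `g = 6/m - 3`,
and summation over dyadic shells shows that `∫ r^σ exp (-κ r^p T)` against this mass is of order
`T^{-(σ + g)/p}` as long as `σ + g > 0` (`exists_lintegral_exp_le`). With `T = 1 + t` this is the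
decay of the energy of order `s` (`exists_energy_decay`).

*The norm of `u`.* For `m < 6/5` one has `g > q` and the same argument applies with `σ = -q`
(`exists_norm_decay`). For `m ≥ 6/5` the singularity `r^{-q}` need not be integrable. If `θ < 1/2`,
the admissible exponent is less than `1` and the decay of `u_t` is integrated in time
(`exists_norm_le_of_velocity`). If `θ ≥ 1/2`, the velocity is integrated in time only on the ball
`r ≤ T^{-1/p}`, and outside this ball the dyadic sum converges for every `σ`
(`exists_norm_growth`).
-/

noncomputable section

namespace DampedElastic

/-! ### Multiplication operators on `L²` -/

/-- A bounded measurable real weight on `ℝ³`. -/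
structure BddWeight (q : E3 → ℝ) : Prop where
  measurable : Measurable q
  bounded : ∃ C : ℝ, ∀ ξ, |q ξ| ≤ C

lemma BddWeight.memLp {q : E3 → ℝ} (hq : BddWeight q) :
    MemLp (fun ξ => (q ξ : ℂ)) ⊤ (volume : Measure E3) := by
  obtain ⟨C, hC⟩ := hq.bounded
  refine memLp_top_of_bound ?_ C (Eventually.of_forall fun ξ => by simpa using hC ξ)
  exact (Complex.measurable_ofReal.comp hq.measurable).aestronglyMeasurable

lemma BddWeight.mul {p q : E3 → ℝ} (hp : BddWeight p) (hq : BddWeight q) :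
    BddWeight (fun ξ => p ξ * q ξ) := by
  obtain ⟨C, hC⟩ := hp.bounded
  obtain ⟨D, hD⟩ := hq.bounded
  refine ⟨hp.measurable.mul hq.measurable, C * D, fun ξ => ?_⟩
  rw [abs_mul]
  exact mul_le_mul (hC ξ) (hD ξ) (abs_nonneg _) ((abs_nonneg _).trans (hC ξ))

open Classical in
/-- Multiplication by the weight `q` on `L²(ℝ³)`; it is `0` by convention if `q` is not bounded and
measurable. -/
def mulOp (q : E3 → ℝ) : L2 →L[ℂ] L2 :=
  if h : BddWeight q then
    (ContinuousLinearMap.mul ℂ ℂ).holderL volume ⊤ 2 2 (h.memLp.toLp _)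
  else 0

lemma mulOp_coeFn {q : E3 → ℝ} (hq : BddWeight q) (f : L2) :
    (mulOp q f : E3 → ℂ) =ᵐ[volume] fun ξ => (q ξ : ℂ) * f ξ := by
  rw [mulOp, dif_pos hq]
  have h1 := (ContinuousLinearMap.mul ℂ ℂ).coeFn_holder (r := 2) (hq.memLp.toLp _) f
  filter_upwards [h1, hq.memLp.coeFn_toLp] with ξ h1 h2
  simp only [ContinuousLinearMap.holderL_apply_apply]
  rw [h1, h2]
  rfl

lemma inner_mulOp {q : E3 → ℝ} (hq : BddWeight q) (f g : L2) :
    inner ℂ f (mulOp q g) = ∫ ξ, (q ξ : ℂ) * (g ξ * (starRingEnd ℂ) (f ξ)) := by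
  rw [L2.inner_def]
  refine integral_congr_ae ?_
  filter_upwards [mulOp_coeFn hq g] with ξ h
  rw [h]
  simp [mul_assoc]

lemma mulOp_mulOp {p q : E3 → ℝ} (hp : BddWeight p) (hq : BddWeight q) (f : L2) :
    mulOp p (mulOp q f) = mulOp (fun ξ => p ξ * q ξ) f := by
  apply Lp.ext
  filter_upwards [mulOp_coeFn hp (mulOp q f), mulOp_coeFn hq f, mulOp_coeFn (hp.mul hq) f]
    with ξ h1 h2 h3
  rw [h1, h2, h3]
  push_cast
  ring

/-! ### From weak to strong differentiability -/

/-- A curve in a Hilbert space whose pairings with a dense set are differentiable, with derivatives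
given by pairing with a continuous curve, is differentiable in norm. -/
lemma hasDerivAt_of_dense_inner {H : Type*} [NormedAddCommGroup H] [InnerProductSpace ℂ H]
    {X G : ℝ → H} {D : Set H} (hD : Dense D) {t : ℝ}
    (h : ∀ᶠ τ in 𝓝 t, ∀ z ∈ D, HasDerivAt (fun τ => inner ℂ z (X τ)) (inner ℂ z (G τ)) τ)
    (hG : ContinuousAt G t) : HasDerivAt X (G t) t := by
  rw [hasDerivAt_iff_isLittleO, Asymptotics.isLittleO_iff]
  intro c hc
  have hG' : ∀ᶠ τ in 𝓝 t, ‖G τ - G t‖ ≤ c := by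
    have := (Metric.tendsto_nhds.1 hG) c hc
    filter_upwards [this] with τ hτ
    rw [dist_eq_norm] at hτ
    exact hτ.le
  obtain ⟨δ, hδ, hball⟩ := Metric.eventually_nhds_iff_ball.1 (h.and hG')
  filter_upwards [Metric.ball_mem_nhds t hδ] with t' ht'
  -- the remainder `w` is small because its pairings with all `z` are: the mean value inequality
  -- applies to `z` in the dense set, with a bound that passes to the closure
  set w : H := X t' - X t - (t' - t) • G t with hw
  have key : ∀ z : H, ‖inner ℂ z w‖ ≤ c * ‖t' - t‖ * ‖z‖ := by
    intro z
    refine hD.induction (P := fun z => ‖inner ℂ z w‖ ≤ c * ‖t' - t‖ * ‖z‖) ?_ ?_ z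
    · intro z hz
      have hder : ∀ τ ∈ Metric.ball t δ,
          HasDerivWithinAt (fun τ => inner ℂ z (X τ) - (τ : ℝ) • inner ℂ z (G t))
            (inner ℂ z (G τ - G t)) (Metric.ball t δ) τ := by
        intro τ hτ
        have h1 := ((hball τ hτ).1 z hz).sub
          ((hasDerivAt_id τ).smul_const (inner ℂ z (G t)))
        rw [one_smul, ← inner_sub_right] at h1
        exact h1.hasDerivWithinAt
      have hb : ∀ τ ∈ Metric.ball t δ, ‖inner ℂ z (G τ - G t)‖ ≤ c * ‖z‖ := by
        intro τ hτ
        calc ‖inner ℂ z (G τ - G t)‖ ≤ ‖z‖ * ‖G τ - G t‖ := norm_inner_le_norm _ _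
          _ ≤ ‖z‖ * c := by gcongr; exact (hball τ hτ).2
          _ = c * ‖z‖ := mul_comm _ _
      have := (convex_ball t δ).norm_image_sub_le_of_norm_hasDerivWithin_le hder hb
        (Metric.mem_ball_self hδ) ht'
      have e : inner ℂ z w = (inner ℂ z (X t') - (t' : ℝ) • inner ℂ z (G t))
          - (inner ℂ z (X t) - (t : ℝ) • inner ℂ z (G t)) := by
        rw [hw, inner_sub_right, inner_sub_right, inner_smul_right_eq_smul, sub_smul]
        abel
      rw [e]
      linarith [this]
    · exact isClosed_le (by fun_prop) (by fun_prop)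
  have h3 := key w
  rw [inner_self_eq_norm_sq_to_K] at h3
  have h4 : ‖((‖w‖ : ℝ) : ℂ) ^ 2‖ = ‖w‖ * ‖w‖ := by
    rw [norm_pow, Complex.norm_real, norm_norm, sq]
  have h5 : ‖w‖ * ‖w‖ ≤ c * ‖t' - t‖ * ‖w‖ := by
    rw [← h4]; exact h3
  rcases (norm_nonneg w).eq_or_lt with h0 | h0
  · rw [← h0]; positivity
  · exact le_of_mul_le_mul_right h5 h0

/-! ### The equation on the Fourier side -/

/-- The modulus of the frequency `2πξ`. -/
def rad (ξ : E3) : ℝ := 2 * Real.pi * ‖ξ‖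

/-- The `k`-th coordinate of the frequency `2πξ`. -/
def freq (k : Fin 3) (ξ : E3) : ℝ := 2 * Real.pi * ξ k

/-- The symbol of the damping operator `(-Δ)^θ`. -/
def damp (θ : ℝ) (ξ : E3) : ℝ := rad ξ ^ (2 * θ)

lemma rad_nonneg (ξ : E3) : 0 ≤ rad ξ := by unfold rad; positivity

lemma damp_nonneg (θ : ℝ) (ξ : E3) : 0 ≤ damp θ ξ := Real.rpow_nonneg (rad_nonneg ξ) _

@[fun_prop]
lemma measurable_rad : Measurable rad := by unfold rad; fun_prop

@[fun_prop]
lemma measurable_freq (k : Fin 3) : Measurable (freq k) := by unfold freq; fun_prop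

@[fun_prop]
lemma measurable_damp (θ : ℝ) : Measurable (damp θ) := by unfold damp; fun_prop

lemma sum_freq_sq (ξ : E3) : ∑ k, freq k ξ ^ 2 = rad ξ ^ 2 := by
  simp only [freq, rad, mul_pow, EuclideanSpace.norm_sq_eq, Finset.mul_sum, Real.norm_eq_abs,
    sq_abs]

lemma abs_freq_le (k : Fin 3) (ξ : E3) : |freq k ξ| ≤ rad ξ := by
  refine abs_le_of_sq_le_sq ?_ (rad_nonneg ξ)
  rw [← sum_freq_sq]
  exact Finset.single_le_sum (f := fun k => freq k ξ ^ 2) (fun i _ => sq_nonneg _)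
    (Finset.mem_univ k)

lemma damp_le {θ : ℝ} (h0 : 0 ≤ θ) (h1 : θ ≤ 1) (ξ : E3) : damp θ ξ ≤ 1 + rad ξ ^ 2 := by
  unfold damp
  rcases le_total (rad ξ) 1 with h | h
  · have := Real.rpow_le_one (rad_nonneg ξ) h (z := 2 * θ) (by linarith)
    nlinarith [sq_nonneg (rad ξ)]
  · have := Real.rpow_le_rpow_of_exponent_le h (show 2 * θ ≤ 2 by linarith)
    rw [Real.rpow_two] at this
    linarith

/-- Pairing a second derivative of `f ∈ L²` with the Fourier transform of a test function. -/
lemma lineDeriv_lineDeriv_apply_fourier (f : L2) (m₁ m₂ : E3) (ψ : 𝓢(E3, ℂ)) :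
    (∂_{m₁} (∂_{m₂} (f : 𝓢'(E3, ℂ)))) (𝓕 ψ)
      = ∫ ξ, ψ ξ * ((-((2 * Real.pi * inner ℝ ξ m₁) * (2 * Real.pi * inner ℝ ξ m₂)) : ℝ) : ℂ)
          * ((𝓕 f : L2) : E3 → ℂ) ξ := by
  have e : (f : 𝓢'(E3, ℂ)) = 𝓕⁻ ((𝓕 f : L2) : 𝓢'(E3, ℂ)) := by
    rw [Lp.fourierInv_toTemperedDistribution_eq]
    simp
  rw [e, TemperedDistribution.lineDerivOp_fourierInv_eq,
    TemperedDistribution.lineDerivOp_fourierInv_eq, TemperedDistribution.fourierInv_apply]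
  have h1 : (fun x : E3 => ((inner ℝ x m₁ : ℝ) : ℂ)).HasTemperateGrowth := by fun_prop
  have h2 : (fun x : E3 => ((inner ℝ x m₂ : ℝ) : ℂ)).HasTemperateGrowth := by fun_prop
  simp only [FourierTransform.fourierInv_fourier_eq]
  simp only [map_smul, smul_apply, TemperedDistribution.smulLeftCLM_apply_apply,
    Lp.toTemperedDistribution_apply]
  rw [← integral_smul, ← integral_smul]
  refine integral_congr_ae (Eventually.of_forall fun ξ => ?_)
  simp only [SchwartzMap.smulLeftCLM_apply_apply h1, SchwartzMap.smulLeftCLM_apply_apply h2,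
    smul_eq_mul]
  push_cast
  linear_combination (2 * (Real.pi : ℂ)) ^ 2 * ((inner ℝ ξ m₁ : ℝ) : ℂ) * ((inner ℝ ξ m₂ : ℝ) : ℂ)
    * ψ ξ * ((𝓕 f : L2) : E3 → ℂ) ξ * Complex.I_sq

/-- The weight `(1 + |ξ|²)⁻¹`, which makes the symbols of the equation bounded. -/
def bessel (ξ : E3) : ℝ := (1 + ‖ξ‖ ^ 2) ^ (-1 : ℝ)

lemma bessel_eq (ξ : E3) : bessel ξ = (1 + ‖ξ‖ ^ 2)⁻¹ := Real.rpow_neg_one _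

lemma bessel_pos (ξ : E3) : 0 < bessel ξ := by rw [bessel_eq]; positivity

@[fun_prop]
lemma measurable_bessel : Measurable bessel := by unfold bessel; fun_prop

lemma hasTemperateGrowth_bessel : (fun ξ : E3 => ((bessel ξ : ℝ) : ℂ)).HasTemperateGrowth := by
  have := Function.hasTemperateGrowth_one_add_norm_sq_rpow (H := E3) (-1)
  exact Function.Complex.hasTemperateGrowth_ofReal.comp this

/-- The Schwartz function `(1 + |ξ|²)⁻¹ conj h`. Testing the Fourier transform of the equation
against it amounts to pairing the weighted equation with `h` in `L²`. -/
def besselTest (h : 𝓢(E3, ℂ)) : 𝓢(E3, ℂ) :=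
  SchwartzMap.smulLeftCLM ℂ (fun ξ : E3 => ((bessel ξ : ℝ) : ℂ))
    (h.postcompCLM (Complex.conjCLE : ℂ →L[ℝ] ℂ))

lemma besselTest_apply (h : 𝓢(E3, ℂ)) (ξ : E3) :
    besselTest h ξ = (bessel ξ : ℂ) * (starRingEnd ℂ) (h ξ) := by
  rw [besselTest, SchwartzMap.smulLeftCLM_apply_apply hasTemperateGrowth_bessel]
  simp [SchwartzMap.postcompCLM_apply]

lemma integral_besselTest_mul {q : E3 → ℝ} (hq : BddWeight (fun ξ => bessel ξ * q ξ))
    (h : 𝓢(E3, ℂ)) (f : L2) :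
    ∫ ξ, besselTest h ξ * (q ξ : ℂ) * f ξ
      = inner ℂ (h.toLp 2) (mulOp (fun ξ => bessel ξ * q ξ) f) := by
  rw [inner_mulOp hq]
  refine integral_congr_ae ?_
  filter_upwards [h.coeFn_toLp 2 volume] with ξ e
  rw [e, besselTest_apply]
  push_cast
  ring

lemma BddWeight.bessel_mul {q : E3 → ℝ} (hq : Measurable q) {C : ℝ}
    (h : ∀ ξ, |q ξ| ≤ C * (1 + rad ξ ^ 2)) : BddWeight (fun ξ => bessel ξ * q ξ) := by
  refine ⟨by fun_prop, C * (2 * Real.pi) ^ 2, fun ξ => ?_⟩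
  have hC : 0 ≤ C := by
    have := (abs_nonneg _).trans (h ξ)
    by_contra hc
    have : C * (1 + rad ξ ^ 2) < 0 := mul_neg_of_neg_of_pos (not_le.1 hc) (by positivity)
    linarith
  rw [abs_mul, abs_of_pos (bessel_pos ξ), bessel_eq, inv_mul_le_iff₀ (by positivity)]
  refine (h ξ).trans ?_
  have h1 : rad ξ ^ 2 = (2 * Real.pi) ^ 2 * ‖ξ‖ ^ 2 := by unfold rad; ring
  have h2 : 1 ≤ (2 * Real.pi) ^ 2 := by nlinarith [Real.pi_gt_three]
  rw [h1]
  nlinarith [mul_le_mul_of_nonneg_left h2 hC]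

/-- The restriction of a weight to the frequencies of modulus at most `R`. -/
def cut (R : ℝ) (q : E3 → ℝ) : E3 → ℝ := {ξ | rad ξ ≤ R}.indicator q

lemma measurableSet_rad_le (R : ℝ) : MeasurableSet {ξ | rad ξ ≤ R} :=
  measurableSet_le measurable_rad measurable_const

lemma cut_of_le {R : ℝ} {ξ : E3} (h : rad ξ ≤ R) (q : E3 → ℝ) : cut R q ξ = q ξ :=
  Set.indicator_of_mem (s := {ξ | rad ξ ≤ R}) h q

lemma bddWeight_cut_one (R : ℝ) : BddWeight (cut R fun _ => 1) := by
  refine ⟨measurable_const.indicator (measurableSet_rad_le R), 1, fun ξ => ?_⟩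
  unfold cut
  by_cases h : ξ ∈ {ξ | rad ξ ≤ R} <;> simp [h]

lemma freq_eq_inner (k : Fin 3) (ξ : E3) :
    freq k ξ = 2 * Real.pi * inner ℝ ξ (unitVec k) := by
  simp [freq, unitVec, EuclideanSpace.inner_single_right]

lemma bddWeight_freq_mul_freq (j k : Fin 3) :
    BddWeight (fun ξ => bessel ξ * (-(freq j ξ * freq k ξ))) := by
  refine .bessel_mul (C := 1) (by fun_prop) fun ξ => ?_
  rw [abs_neg, abs_mul]
  nlinarith [abs_freq_le j ξ, abs_freq_le k ξ, abs_nonneg (freq j ξ), abs_nonneg (freq k ξ),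
    rad_nonneg ξ]

lemma bddWeight_bessel_one : BddWeight (fun ξ => bessel ξ * 1) :=
  .bessel_mul (C := 1) (by fun_prop) fun ξ => by simp [sq_nonneg]

lemma bddWeight_bessel_damp {θ : ℝ} (h0 : 0 ≤ θ) (h1 : θ ≤ 1) :
    BddWeight (fun ξ => bessel ξ * damp θ ξ) := by
  refine .bessel_mul (C := 1) (by fun_prop) fun ξ => ?_
  rw [abs_of_nonneg (damp_nonneg θ ξ), one_mul]
  exact damp_le h0 h1 ξ

lemma lineDeriv_lineDeriv_apply_besselTest (f : L2) (j k : Fin 3) (h : 𝓢(E3, ℂ)) :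
    (∂_{unitVec j} (∂_{unitVec k} (f : 𝓢'(E3, ℂ)))) (𝓕 (besselTest h))
      = inner ℂ (h.toLp 2) (mulOp (fun ξ => bessel ξ * (-(freq j ξ * freq k ξ))) (𝓕 f : L2)) := by
  rw [lineDeriv_lineDeriv_apply_fourier, ← integral_besselTest_mul (bddWeight_freq_mul_freq j k)]
  simp only [freq_eq_inner]

lemma fracLaplacian_besselTest {θ : ℝ} (h0 : 0 ≤ θ) (h1 : θ ≤ 1) (f : L2) (h : 𝓢(E3, ℂ)) :
    fracLaplacian θ f (𝓕 (besselTest h))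
      = inner ℂ (h.toLp 2) (mulOp (fun ξ => bessel ξ * damp θ ξ) (𝓕 f : L2)) := by
  rw [← integral_besselTest_mul (bddWeight_bessel_damp h0 h1), fracLaplacian]
  simp only [FourierTransform.fourierInv_fourier_eq]
  refine integral_congr_ae (Eventually.of_forall fun ξ => ?_)
  simp only [damp, rad]
  ring

lemma apply_fourier_besselTest (f : L2) (h : 𝓢(E3, ℂ)) :
    (f : 𝓢'(E3, ℂ)) (𝓕 (besselTest h))
      = inner ℂ (h.toLp 2) (mulOp (fun ξ => bessel ξ * 1) (𝓕 f : L2)) := by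
  rw [← integral_besselTest_mul bddWeight_bessel_one]
  have := congrArg (fun T : 𝓢'(E3, ℂ) => T (besselTest h)) (Lp.fourier_toTemperedDistribution_eq f)
  simp only [TemperedDistribution.fourier_apply, Lp.toTemperedDistribution_apply] at this
  rw [Lp.toTemperedDistribution_apply, this]
  simp

lemma laplacian_apply_besselTest (f : L2) (h : 𝓢(E3, ℂ)) :
    (Δ (f : 𝓢'(E3, ℂ))) (𝓕 (besselTest h)) = inner ℂ (h.toLp 2)
      (∑ j, mulOp (fun ξ => bessel ξ * (-(freq j ξ * freq j ξ))) (𝓕 f : L2)) := by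
  rw [TemperedDistribution.laplacian_eq_sum (EuclideanSpace.basisFun (Fin 3) ℝ), inner_sum,
    sum_apply]
  refine Finset.sum_congr rfl fun j _ => ?_
  rw [EuclideanSpace.basisFun_apply]
  exact lineDeriv_lineDeriv_apply_besselTest f j j h

lemma lineDeriv_divergence_apply_besselTest (w : Fin 3 → L2) (k : Fin 3) (h : 𝓢(E3, ℂ)) :
    (∂_{unitVec k} (divergence w)) (𝓕 (besselTest h)) = inner ℂ (h.toLp 2)
      (∑ j, mulOp (fun ξ => bessel ξ * (-(freq k ξ * freq j ξ))) (𝓕 (w j) : L2)) := by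
  rw [divergence, LineDeriv.lineDerivOp_sum, inner_sum, sum_apply]
  exact Finset.sum_congr rfl fun j _ => lineDeriv_lineDeriv_apply_besselTest (w j) k j h

lemma hasDerivAt_fourier {x : ℝ → L2} {x' : L2} {t : ℝ} (h : HasDerivAt x x' t) :
    HasDerivAt (fun τ => (𝓕 (x τ) : L2)) (𝓕 x' : L2) t :=
  ((Lp.fourierTransformₗᵢ E3 ℂ).toContinuousLinearEquiv.toContinuousLinearMap.restrictScalars
    ℝ).hasFDerivAt.comp_hasDerivAt t h

lemma hasDerivAt_mulOp (q : E3 → ℝ) {x : ℝ → L2} {x' : L2} {t : ℝ} (h : HasDerivAt x x' t) :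
    HasDerivAt (fun τ => mulOp q (x τ)) (mulOp q x') t :=
  ((mulOp q).restrictScalars ℝ).hasFDerivAt.comp_hasDerivAt t h

lemma continuous_fourier : Continuous (fun f : L2 => (𝓕 f : L2)) :=
  (Lp.fourierTransformₗᵢ E3 ℂ).continuous

section Strong

variable {a b θ : ℝ} {u₀ u₁ : Fin 3 → L2} {u v : ℝ → Fin 3 → L2}

lemma IsEnergySolution.continuousOn_position (h : IsEnergySolution a b θ u₀ u₁ u v) (k : Fin 3) :
    ContinuousOn (fun τ => u τ k) (Set.Ici 0) :=
  fun t ht => (h.hasDeriv t ht k).continuousWithinAt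

lemma IsEnergySolution.hasDerivAt_position (h : IsEnergySolution a b θ u₀ u₁ u v) {t : ℝ}
    (ht : 0 < t) (k : Fin 3) : HasDerivAt (fun τ => u τ k) (v t k) t :=
  (h.hasDeriv t ht.le k).hasDerivAt (Ici_mem_nhds ht)

/-- Although the equation only holds against test functions, `(1 + |ξ|²)⁻¹ 𝓕 (u_t)` is strongly
differentiable in `L²`: the weight makes all symbols of the equation bounded. -/
lemma IsEnergySolution.hasDerivAt_bessel (h : IsEnergySolution a b θ u₀ u₁ u v) (h0 : 0 ≤ θ)
    (h1 : θ ≤ 1) {t : ℝ} (ht : 0 < t) (k : Fin 3) :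
    HasDerivAt (fun τ => mulOp (fun ξ => bessel ξ * 1) (𝓕 (v τ k) : L2))
      ((a ^ 2 : ℂ) • (∑ j, mulOp (fun ξ => bessel ξ * (-(freq j ξ * freq j ξ))) (𝓕 (u t k) : L2))
        + ((b : ℂ) ^ 2 - (a : ℂ) ^ 2) •
          (∑ j, mulOp (fun ξ => bessel ξ * (-(freq k ξ * freq j ξ))) (𝓕 (u t j) : L2))
        - mulOp (fun ξ => bessel ξ * damp θ ξ) (𝓕 (v t k) : L2)) t := by
  have hu : ∀ j, ContinuousAt (fun τ => (𝓕 (u τ j) : L2)) t := fun j =>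
    continuous_fourier.continuousAt.comp (h.hasDerivAt_position ht j).continuousAt
  have hv : ContinuousAt (fun τ => (𝓕 (v τ k) : L2)) t :=
    continuous_fourier.continuousAt.comp ((h.continuous_deriv k).continuousAt (Ici_mem_nhds ht))
  refine hasDerivAt_of_dense_inner
    (D := Set.range (SchwartzMap.toLpCLM ℂ (E := E3) ℂ 2 volume))
    (G := fun t => (a ^ 2 : ℂ) •
          (∑ j, mulOp (fun ξ => bessel ξ * (-(freq j ξ * freq j ξ))) (𝓕 (u t k) : L2))
        + ((b : ℂ) ^ 2 - (a : ℂ) ^ 2) •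
          (∑ j, mulOp (fun ξ => bessel ξ * (-(freq k ξ * freq j ξ))) (𝓕 (u t j) : L2))
        - mulOp (fun ξ => bessel ξ * damp θ ξ) (𝓕 (v t k) : L2))
    (SchwartzMap.denseRange_toLpCLM ENNReal.ofNat_ne_top) ?_ ?_
  · filter_upwards [Ioi_mem_nhds ht] with τ hτ
    rintro _ ⟨z, rfl⟩
    have := h.equation τ hτ k (𝓕 (besselTest z))
    simp only [apply_fourier_besselTest, laplacian_apply_besselTest,
      lineDeriv_divergence_apply_besselTest, fracLaplacian_besselTest h0 h1] at this
    rw [inner_sub_right, inner_add_right, inner_smul_right, inner_smul_right]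
    exact this
  · have hq : ∀ (q : E3 → ℝ) (j : Fin 3), ContinuousAt (fun τ => mulOp q (𝓕 (u τ j) : L2)) t :=
      fun q j => (mulOp q).continuous.continuousAt.comp (hu j)
    have hs1 : ContinuousAt (fun τ => ∑ j,
        mulOp (fun ξ => bessel ξ * (-(freq j ξ * freq j ξ))) (𝓕 (u τ k) : L2)) t :=
      tendsto_finsetSum _ fun j _ => hq _ k
    have hs2 : ContinuousAt (fun τ => ∑ j,
        mulOp (fun ξ => bessel ξ * (-(freq k ξ * freq j ξ))) (𝓕 (u τ j) : L2)) t :=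
      tendsto_finsetSum _ fun j _ => hq _ j
    have hs3 : ContinuousAt (fun τ => mulOp (fun ξ => bessel ξ * damp θ ξ) (𝓕 (v τ k) : L2)) t :=
      (mulOp _).continuous.continuousAt.comp hv
    exact ((hs1.const_smul (a ^ 2 : ℂ)).add (hs2.const_smul ((b : ℂ) ^ 2 - (a : ℂ) ^ 2))).sub hs3

lemma bddWeight_cut {q : E3 → ℝ} (hq : Measurable q) {R C : ℝ}
    (h : ∀ ξ, rad ξ ≤ R → |q ξ| ≤ C) : BddWeight (cut R q) := by
  refine ⟨hq.indicator (measurableSet_rad_le R), max C 0, fun ξ => ?_⟩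
  unfold cut
  by_cases hξ : ξ ∈ {ξ | rad ξ ≤ R}
  · rw [Set.indicator_of_mem hξ]; exact (h ξ hξ).trans (le_max_left _ _)
  · rw [Set.indicator_of_notMem hξ]; simp

lemma bddWeight_cut_bessel_inv (R : ℝ) : BddWeight (cut R fun ξ => (bessel ξ)⁻¹) := by
  refine bddWeight_cut (C := 1 + R ^ 2) (by fun_prop) fun ξ hξ => ?_
  rw [abs_of_pos (inv_pos.2 (bessel_pos ξ)), bessel_eq, inv_inv]
  have h1 : ‖ξ‖ ≤ rad ξ := by
    unfold rad
    nlinarith [Real.pi_gt_three, norm_nonneg ξ]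
  have := norm_nonneg ξ
  gcongr
  linarith

/-- On bounded frequencies, `𝓕 (u_t)` is strongly differentiable and solves the Fourier transform of
the equation almost everywhere. -/
lemma IsEnergySolution.hasDerivAt_cut (h : IsEnergySolution a b θ u₀ u₁ u v) (h0 : 0 ≤ θ)
    (h1 : θ ≤ 1) (R : ℝ) {t : ℝ} (ht : 0 < t) (k : Fin 3) :
    ∃ G : L2, HasDerivAt (fun τ => mulOp (cut R fun _ => 1) (𝓕 (v τ k) : L2)) G t ∧
      ∀ᵐ ξ, rad ξ ≤ R → G ξ = -((a ^ 2 * rad ξ ^ 2 : ℝ) * (𝓕 (u t k) : L2) ξ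
        + ((b ^ 2 - a ^ 2) * freq k ξ : ℝ) * ∑ j, (freq j ξ : ℂ) * (𝓕 (u t j) : L2) ξ
        + (damp θ ξ : ℂ) * (𝓕 (v t k) : L2) ξ) := by
  have key := hasDerivAt_mulOp (cut R fun ξ => (bessel ξ)⁻¹) (h.hasDerivAt_bessel h0 h1 ht k)
  obtain ⟨G, hG⟩ : ∃ G, G = mulOp (cut R fun ξ => (bessel ξ)⁻¹) ((a ^ 2 : ℂ) •
        (∑ j, mulOp (fun ξ => bessel ξ * (-(freq j ξ * freq j ξ))) (𝓕 (u t k) : L2))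
      + ((b : ℂ) ^ 2 - (a : ℂ) ^ 2) •
        (∑ j, mulOp (fun ξ => bessel ξ * (-(freq k ξ * freq j ξ))) (𝓕 (u t j) : L2))
      - mulOp (fun ξ => bessel ξ * damp θ ξ) (𝓕 (v t k) : L2)) := ⟨_, rfl⟩
  rw [← hG] at key
  refine ⟨G, ?_, ?_⟩
  · convert key using 2 with τ
    rw [mulOp_mulOp (bddWeight_cut_bessel_inv R) bddWeight_bessel_one]
    congr 2
    ext1 ξ
    unfold cut
    by_cases hξ : ξ ∈ {ξ | rad ξ ≤ R}
    · simp [Set.indicator_of_mem hξ, (bessel_pos ξ).ne']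
    · simp [Set.indicator_of_notMem hξ]
  · rw [hG]
    simp only [Fin.sum_univ_three]
    set M := fun (i j l : Fin 3) =>
      mulOp (fun ξ => bessel ξ * (-(freq i ξ * freq j ξ))) (𝓕 (u t l) : L2) with hM
    set A := M 0 0 k + M 1 1 k + M 2 2 k with hA
    set B := M k 0 0 + M k 1 1 + M k 2 2 with hB
    have eM : ∀ i j l, _ := fun i j l =>
      mulOp_coeFn (bddWeight_freq_mul_freq i j) (𝓕 (u t l) : L2)
    set Dm := mulOp (fun ξ => bessel ξ * damp θ ξ) (𝓕 (v t k) : L2)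
    filter_upwards [mulOp_coeFn (bddWeight_cut_bessel_inv R)
        ((a ^ 2 : ℂ) • A + ((b : ℂ) ^ 2 - (a : ℂ) ^ 2) • B - Dm),
      Lp.coeFn_sub ((a ^ 2 : ℂ) • A + ((b : ℂ) ^ 2 - (a : ℂ) ^ 2) • B) Dm,
      Lp.coeFn_add ((a ^ 2 : ℂ) • A) (((b : ℂ) ^ 2 - (a : ℂ) ^ 2) • B),
      Lp.coeFn_smul (a ^ 2 : ℂ) A, Lp.coeFn_smul ((b : ℂ) ^ 2 - (a : ℂ) ^ 2) B,
      Lp.coeFn_add (M 0 0 k + M 1 1 k) (M 2 2 k), Lp.coeFn_add (M 0 0 k) (M 1 1 k),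
      Lp.coeFn_add (M k 0 0 + M k 1 1) (M k 2 2), Lp.coeFn_add (M k 0 0) (M k 1 1),
      mulOp_coeFn (bddWeight_bessel_damp h0 h1) (𝓕 (v t k) : L2),
      eM 0 0 k, eM 1 1 k, eM 2 2 k, eM k 0 0, eM k 1 1, eM k 2 2] with ξ e1 e2 e3 e4 e5 e6 e7 e8
      e9 e10 e11 e12 e13 e14 e15 e16 hξ
    rw [e1, e2, Pi.sub_apply, e3, Pi.add_apply, e4, e5, Pi.smul_apply, Pi.smul_apply, hA, hB, e6,
      Pi.add_apply, e7, Pi.add_apply, e8, Pi.add_apply, e9, Pi.add_apply, e10, cut_of_le hξ]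
    simp only [hM]
    rw [e11, e12, e13, e14, e15, e16, ← sum_freq_sq, Fin.sum_univ_three]
    have hb : (bessel ξ : ℂ) ≠ 0 := by exact_mod_cast (bessel_pos ξ).ne'
    push_cast
    simp only [smul_eq_mul]
    field_simp
    ring

end Strong

/-! ### Longitudinal and transverse components -/

/-- A curve `x` in `L²`, with derivative `y`, each frequency of which solves the damped oscillator
equation `x'' + |ξ|^{2θ} x' + c² |ξ|² x = 0`. The equation is required in `L²` on every ball of
frequencies. -/
structure IsOscillator (c θ : ℝ) (x y : ℝ → L2) : Prop where
  continuousOn_position : ContinuousOn x (Set.Ici 0)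
  continuousOn_velocity : ContinuousOn y (Set.Ici 0)
  hasDerivAt_position : ∀ t, 0 < t → HasDerivAt x (y t) t
  hasDerivAt_velocity : ∀ R t, 0 < t → ∃ G : L2,
    HasDerivAt (fun τ => mulOp (cut R fun _ => 1) (y τ)) G t ∧
      ∀ᵐ ξ, rad ξ ≤ R → G ξ = -((c ^ 2 * rad ξ ^ 2 : ℝ) * x t ξ + (damp θ ξ : ℂ) * y t ξ)

/-- The `k`-th coordinate of the direction `ξ / |ξ|`; it is `0` at the origin. -/
def dir (k : Fin 3) (ξ : E3) : ℝ := freq k ξ / rad ξ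

lemma abs_dir_le (k : Fin 3) (ξ : E3) : |dir k ξ| ≤ 1 := by
  rw [dir, abs_div, abs_of_nonneg (rad_nonneg ξ)]
  exact div_le_one_of_le₀ (abs_freq_le k ξ) (rad_nonneg ξ)

lemma bddWeight_dir (k : Fin 3) : BddWeight (dir k) :=
  ⟨by unfold dir; fun_prop, 1, abs_dir_le k⟩

lemma rad_mul_dir (k : Fin 3) (ξ : E3) : rad ξ * dir k ξ = freq k ξ := by
  by_cases h : rad ξ = 0
  · have := abs_freq_le k ξ
    rw [h] at this
    rw [h, zero_mul, abs_nonpos_iff.1 this]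
  · rw [dir, mul_div_cancel₀ _ h]

lemma sum_dir_mul_freq (ξ : E3) : ∑ k, dir k ξ * freq k ξ = rad ξ := by
  by_cases h : rad ξ = 0
  · simp [dir, h]
  · have := sum_freq_sq ξ
    simp only [dir, div_mul_eq_mul_div, ← sq, ← Finset.sum_div, this]
    field_simp

/-- The longitudinal component `(ξ / |ξ|) · f` of a vector field. -/
def longPart (f : Fin 3 → L2) : L2 := ∑ k, mulOp (dir k) (f k)

/-- The `k`-th coordinate of the transverse component of a vector field. -/
def transPart (k : Fin 3) (f : Fin 3 → L2) : L2 := f k - mulOp (dir k) (longPart f)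

lemma longPart_coeFn (f : Fin 3 → L2) :
    (longPart f : E3 → ℂ) =ᵐ[volume] fun ξ => ∑ k, (dir k ξ : ℂ) * f k ξ := by
  simp only [longPart, Fin.sum_univ_three]
  filter_upwards [Lp.coeFn_add (mulOp (dir 0) (f 0) + mulOp (dir 1) (f 1)) (mulOp (dir 2) (f 2)),
    Lp.coeFn_add (mulOp (dir 0) (f 0)) (mulOp (dir 1) (f 1)), mulOp_coeFn (bddWeight_dir 0) (f 0),
    mulOp_coeFn (bddWeight_dir 1) (f 1), mulOp_coeFn (bddWeight_dir 2) (f 2)] with ξ e1 e2 e3 e4 e5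
  rw [e1, Pi.add_apply, e2, Pi.add_apply, e3, e4, e5]

lemma transPart_coeFn (k : Fin 3) (f : Fin 3 → L2) :
    (transPart k f : E3 → ℂ) =ᵐ[volume] fun ξ => f k ξ - (dir k ξ : ℂ) * longPart f ξ := by
  filter_upwards [Lp.coeFn_sub (f k) (mulOp (dir k) (longPart f)),
    mulOp_coeFn (bddWeight_dir k) (longPart f)] with ξ e1 e2
  rw [transPart, e1, Pi.sub_apply, e2]

lemma hasDerivAt_longPart {f : ℝ → Fin 3 → L2} {f' : Fin 3 → L2} {t : ℝ}
    (h : ∀ k, HasDerivAt (fun τ => f τ k) (f' k) t) :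
    HasDerivAt (fun τ => longPart (f τ)) (longPart f') t :=
  HasDerivAt.fun_sum fun k _ => hasDerivAt_mulOp (dir k) (h k)

lemma hasDerivAt_transPart {f : ℝ → Fin 3 → L2} {f' : Fin 3 → L2} {t : ℝ} (k : Fin 3)
    (h : ∀ k, HasDerivAt (fun τ => f τ k) (f' k) t) :
    HasDerivAt (fun τ => transPart k (f τ)) (transPart k f') t :=
  (h k).sub (hasDerivAt_mulOp (dir k) (hasDerivAt_longPart h))

lemma continuousOn_longPart {f : ℝ → Fin 3 → L2} {S : Set ℝ}
    (h : ∀ k, ContinuousOn (fun τ => f τ k) S) : ContinuousOn (fun τ => longPart (f τ)) S :=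
  continuousOn_finsetSum _ fun k _ => (mulOp (dir k)).continuous.comp_continuousOn (h k)

lemma continuousOn_transPart {f : ℝ → Fin 3 → L2} {S : Set ℝ} (k : Fin 3)
    (h : ∀ k, ContinuousOn (fun τ => f τ k) S) : ContinuousOn (fun τ => transPart k (f τ)) S :=
  (h k).sub ((mulOp (dir k)).continuous.comp_continuousOn (continuousOn_longPart h))

lemma mulOp_comm {p q : E3 → ℝ} (hp : BddWeight p) (hq : BddWeight q) (f : L2) :
    mulOp p (mulOp q f) = mulOp q (mulOp p f) := by
  rw [mulOp_mulOp hp hq, mulOp_mulOp hq hp]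
  simp only [mul_comm]

lemma mulOp_longPart {q : E3 → ℝ} (hq : BddWeight q) (f : Fin 3 → L2) :
    mulOp q (longPart f) = longPart fun k => mulOp q (f k) := by
  simp only [longPart, map_sum, mulOp_comm hq (bddWeight_dir _)]

lemma mulOp_transPart {q : E3 → ℝ} (hq : BddWeight q) (k : Fin 3) (f : Fin 3 → L2) :
    mulOp q (transPart k f) = transPart k fun k => mulOp q (f k) := by
  simp only [transPart, map_sub, mulOp_comm hq (bddWeight_dir _), mulOp_longPart hq]

section Decomposition

variable {a b θ : ℝ} {u₀ u₁ : Fin 3 → L2} {u v : ℝ → Fin 3 → L2}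

/-- The longitudinal component propagates with speed `b`. -/
lemma IsEnergySolution.isOscillator_longPart (h : IsEnergySolution a b θ u₀ u₁ u v) (h0 : 0 ≤ θ)
    (h1 : θ ≤ 1) :
    IsOscillator b θ (fun t => longPart fun k => 𝓕 (u t k)) (fun t => longPart fun k => 𝓕 (v t k))
      where
  continuousOn_position := continuousOn_longPart fun k =>
    continuous_fourier.comp_continuousOn (h.continuousOn_position k)
  continuousOn_velocity := continuousOn_longPart fun k =>
    continuous_fourier.comp_continuousOn (h.continuous_deriv k)
  hasDerivAt_position t ht :=
    hasDerivAt_longPart fun k => hasDerivAt_fourier (h.hasDerivAt_position ht k)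
  hasDerivAt_velocity R t ht := by
    choose G hG hG' using h.hasDerivAt_cut h0 h1 R ht
    refine ⟨longPart G, ?_, ?_⟩
    · simp only [mulOp_longPart (bddWeight_cut_one R)]
      exact hasDerivAt_longPart hG
    · filter_upwards [longPart_coeFn G, longPart_coeFn fun k => 𝓕 (u t k),
        longPart_coeFn fun k => 𝓕 (v t k), ae_all_iff.2 hG'] with ξ e1 e2 e3 e4 hξ
      rw [e1, e2, e3]
      have e5 : (rad ξ : ℂ) = ∑ k, (dir k ξ : ℂ) * freq k ξ := by
        exact_mod_cast (sum_dir_mul_freq ξ).symm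
      have e6 : ∀ k, (freq k ξ : ℂ) = rad ξ * dir k ξ := fun k => by
        exact_mod_cast (rad_mul_dir k ξ).symm
      have e7 : (rad ξ : ℂ) * (∑ k, (dir k ξ : ℂ) ^ 2) = rad ξ := by
        conv_rhs => rw [e5]
        rw [Finset.mul_sum]
        exact Finset.sum_congr rfl fun k _ => by rw [e6]; ring
      simp only [e4 _ hξ, Fin.sum_univ_three] at e7 ⊢
      push_cast
      rw [e6 0, e6 1, e6 2]
      linear_combination (-(((b : ℂ) ^ 2 - (a : ℂ) ^ 2) * rad ξ *
        ((dir 0 ξ : ℂ) * (𝓕 (u t 0) : L2) ξ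
        + (dir 1 ξ : ℂ) * (𝓕 (u t 1) : L2) ξ + (dir 2 ξ : ℂ) * (𝓕 (u t 2) : L2) ξ))) * e7

/-- The transverse components propagate with speed `a`. -/
lemma IsEnergySolution.isOscillator_transPart (h : IsEnergySolution a b θ u₀ u₁ u v) (h0 : 0 ≤ θ)
    (h1 : θ ≤ 1) (k : Fin 3) :
    IsOscillator a θ (fun t => transPart k fun k => 𝓕 (u t k))
      (fun t => transPart k fun k => 𝓕 (v t k)) where
  continuousOn_position := continuousOn_transPart k fun k =>
    continuous_fourier.comp_continuousOn (h.continuousOn_position k)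
  continuousOn_velocity := continuousOn_transPart k fun k =>
    continuous_fourier.comp_continuousOn (h.continuous_deriv k)
  hasDerivAt_position t ht :=
    hasDerivAt_transPart k fun k => hasDerivAt_fourier (h.hasDerivAt_position ht k)
  hasDerivAt_velocity R t ht := by
    choose G hG hG' using h.hasDerivAt_cut h0 h1 R ht
    refine ⟨transPart k G, ?_, ?_⟩
    · simp only [mulOp_transPart (bddWeight_cut_one R)]
      exact hasDerivAt_transPart k hG
    · filter_upwards [transPart_coeFn k G, transPart_coeFn k fun k => 𝓕 (u t k),
        transPart_coeFn k fun k => 𝓕 (v t k), longPart_coeFn G, longPart_coeFn fun k => 𝓕 (u t k),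
        longPart_coeFn fun k => 𝓕 (v t k), ae_all_iff.2 hG'] with ξ e1 e2 e3 f1 f2 f3 e4 hξ
      rw [e1, e2, e3, f1, f2, f3]
      have e5 : (rad ξ : ℂ) = ∑ k, (dir k ξ : ℂ) * freq k ξ := by
        exact_mod_cast (sum_dir_mul_freq ξ).symm
      have e6 : ∀ k, (freq k ξ : ℂ) = rad ξ * dir k ξ := fun k => by
        exact_mod_cast (rad_mul_dir k ξ).symm
      have e7 : (rad ξ : ℂ) * (∑ k, (dir k ξ : ℂ) ^ 2) = rad ξ := by
        conv_rhs => rw [e5]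
        rw [Finset.mul_sum]
        exact Finset.sum_congr rfl fun k _ => by rw [e6]; ring
      simp only [e4 _ hξ, Fin.sum_univ_three] at e7 ⊢
      push_cast
      rw [e6 k, e6 0, e6 1, e6 2]
      linear_combination ((dir k ξ : ℂ) * ((b : ℂ) ^ 2 - (a : ℂ) ^ 2) * rad ξ *
        ((dir 0 ξ : ℂ) * (𝓕 (u t 0) : L2) ξ
        + (dir 1 ξ : ℂ) * (𝓕 (u t 1) : L2) ξ + (dir 2 ξ : ℂ) * (𝓕 (u t 2) : L2) ξ)) * e7

end Decomposition

/-! ### Localized quadratic forms of an oscillator -/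

/-- The real inner product of two complex numbers. -/
def rdot (z w : ℂ) : ℝ := z.re * w.re + z.im * w.im

lemma rdot_self (z : ℂ) : rdot z z = ‖z‖ ^ 2 := by
  rw [Complex.sq_norm, Complex.normSq_apply, rdot]

/-- The bilinear form `∫_S w Re (conj f g)`, for `S` a measurable set on which `w` is bounded. -/
def wform (S : Set E3) (w : E3 → ℝ) (f g : L2) : ℝ := (inner ℂ f (mulOp (S.indicator w) g)).re

lemma integrable_weight_rdot {q : E3 → ℝ} (hq : BddWeight q) (f g : L2) :
    Integrable (fun ξ => q ξ * rdot (f ξ) (g ξ)) := by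
  have h := (L2.integrable_inner (𝕜 := ℂ) f (mulOp q g)).re
  refine h.congr ?_
  filter_upwards [mulOp_coeFn hq g] with ξ e
  rw [e]
  simp [rdot]
  ring

lemma wform_eq {S : Set E3} (hS : MeasurableSet S) {w : E3 → ℝ} (hw : BddWeight (S.indicator w))
    (f g : L2) : wform S w f g = ∫ ξ in S, w ξ * rdot (f ξ) (g ξ) := by
  rw [wform, L2.inner_def, ← integral_indicator hS]
  have h := integral_re (L2.integrable_inner (𝕜 := ℂ) f (mulOp (S.indicator w) g))
  change (∫ ξ, inner ℂ (f ξ) (mulOp (S.indicator w) g ξ)).re = _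
  refine h.symm.trans (integral_congr_ae ?_)
  filter_upwards [mulOp_coeFn hw g] with ξ e
  rw [e]
  by_cases hξ : ξ ∈ S
  · simp [hξ, rdot]
    ring
  · simp [hξ]

lemma integrableOn_weight_rdot {S : Set E3} (hS : MeasurableSet S) {w : E3 → ℝ}
    (hw : BddWeight (S.indicator w)) (f g : L2) :
    IntegrableOn (fun ξ => w ξ * rdot (f ξ) (g ξ)) S := by
  rw [← integrable_indicator_iff hS]
  refine (integrable_weight_rdot hw f g).congr (Eventually.of_forall fun ξ => ?_)
  by_cases hξ : ξ ∈ S <;> simp [hξ]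

lemma hasDerivAt_wform (S : Set E3) (w : E3 → ℝ) {f g : ℝ → L2} {f' g' : L2} {t : ℝ}
    (hf : HasDerivAt f f' t) (hg : HasDerivAt g g' t) :
    HasDerivAt (fun τ => wform S w (f τ) (g τ)) (wform S w (f t) g' + wform S w f' (g t)) t := by
  have h := HasDerivAt.inner ℂ hf (hasDerivAt_mulOp (S.indicator w) hg)
  have := Complex.reCLM.hasFDerivAt.comp_hasDerivAt t h
  simpa [wform, Function.comp_def] using this

lemma continuousOn_wform (S : Set E3) (w : E3 → ℝ) {f g : ℝ → L2} {I : Set ℝ}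
    (hf : ContinuousOn f I) (hg : ContinuousOn g I) :
    ContinuousOn (fun τ => wform S w (f τ) (g τ)) I :=
  Complex.continuous_re.comp_continuousOn
    (hf.inner ((mulOp (S.indicator w)).continuous.comp_continuousOn hg))

/-- A measurable weight which is bounded on every ball. -/
structure LocBdd (w : E3 → ℝ) : Prop where
  measurable : Measurable w
  bounded : ∀ R : ℝ, ∃ C : ℝ, ∀ ξ, rad ξ ≤ R → |w ξ| ≤ C

lemma LocBdd.indicator {w : E3 → ℝ} (hw : LocBdd w) {S : Set E3} (hS : MeasurableSet S) {R : ℝ}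
    (hR : ∀ ξ ∈ S, rad ξ ≤ R) : BddWeight (S.indicator w) := by
  obtain ⟨C, hC⟩ := hw.bounded R
  refine ⟨hw.measurable.indicator hS, max C 0, fun ξ => ?_⟩
  by_cases hξ : ξ ∈ S
  · rw [Set.indicator_of_mem hξ]; exact (hC ξ (hR ξ hξ)).trans (le_max_left _ _)
  · rw [Set.indicator_of_notMem hξ]; simp

lemma LocBdd.const (c : ℝ) : LocBdd fun _ => c :=
  ⟨measurable_const, fun _ => ⟨|c|, fun _ _ => le_rfl⟩⟩

lemma LocBdd.mul {p q : E3 → ℝ} (hp : LocBdd p) (hq : LocBdd q) :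
    LocBdd fun ξ => p ξ * q ξ := by
  refine ⟨hp.measurable.mul hq.measurable, fun R => ?_⟩
  obtain ⟨C, hC⟩ := hp.bounded R
  obtain ⟨D, hD⟩ := hq.bounded R
  refine ⟨C * D, fun ξ hξ => ?_⟩
  rw [abs_mul]
  exact mul_le_mul (hC ξ hξ) (hD ξ hξ) (abs_nonneg _) ((abs_nonneg _).trans (hC ξ hξ))

lemma LocBdd.add {p q : E3 → ℝ} (hp : LocBdd p) (hq : LocBdd q) :
    LocBdd fun ξ => p ξ + q ξ := by
  refine ⟨hp.measurable.add hq.measurable, fun R => ?_⟩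
  obtain ⟨C, hC⟩ := hp.bounded R
  obtain ⟨D, hD⟩ := hq.bounded R
  exact ⟨C + D, fun ξ hξ => (abs_add_le _ _).trans (add_le_add (hC ξ hξ) (hD ξ hξ))⟩

lemma locBdd_rad : LocBdd rad :=
  ⟨measurable_rad, fun R => ⟨R, fun ξ hξ => by rwa [abs_of_nonneg (rad_nonneg ξ)]⟩⟩

lemma locBdd_damp {θ : ℝ} (h0 : 0 ≤ θ) : LocBdd (damp θ) := by
  refine ⟨measurable_damp θ, fun R => ⟨R ^ (2 * θ), fun ξ hξ => ?_⟩⟩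
  rw [abs_of_nonneg (damp_nonneg θ ξ)]
  exact Real.rpow_le_rpow (rad_nonneg ξ) hξ (by linarith)

lemma LocBdd.sub {p q : E3 → ℝ} (hp : LocBdd p) (hq : LocBdd q) :
    LocBdd fun ξ => p ξ - q ξ := by
  simpa [sub_eq_add_neg] using hp.add ((LocBdd.const (-1)).mul hq)

lemma LocBdd.neg {p : E3 → ℝ} (hp : LocBdd p) : LocBdd fun ξ => -p ξ := by
  simpa using (LocBdd.const (-1)).mul hp

lemma locBdd_rad_sq : LocBdd fun ξ => rad ξ ^ 2 := by
  simpa [sq] using locBdd_rad.mul locBdd_rad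

lemma locBdd_damp_sq {θ : ℝ} (h0 : 0 ≤ θ) : LocBdd fun ξ => damp θ ξ ^ 2 := by
  simpa [sq] using (locBdd_damp h0).mul (locBdd_damp h0)

/-- The density `w₁ |y|² + w₂ |x|² + w₃ Re (conj x y)` of a quadratic form in the phase space of
an oscillator. -/
def quad (w₁ w₂ w₃ : E3 → ℝ) (x y : L2) (ξ : E3) : ℝ :=
  w₁ ξ * rdot (y ξ) (y ξ) + w₂ ξ * rdot (x ξ) (x ξ) + w₃ ξ * rdot (x ξ) (y ξ)

section Quad

variable {w₁ w₂ w₃ : E3 → ℝ} {S : Set E3} {R : ℝ}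

lemma integrableOn_quad (h₁ : LocBdd w₁) (h₂ : LocBdd w₂) (h₃ : LocBdd w₃)
    (hS : MeasurableSet S) (hR : ∀ ξ ∈ S, rad ξ ≤ R) (x y : L2) :
    IntegrableOn (quad w₁ w₂ w₃ x y) S :=
  ((integrableOn_weight_rdot hS (h₁.indicator hS hR) y y).add
    (integrableOn_weight_rdot hS (h₂.indicator hS hR) x x)).add
    (integrableOn_weight_rdot hS (h₃.indicator hS hR) x y)

lemma setIntegral_quad (h₁ : LocBdd w₁) (h₂ : LocBdd w₂) (h₃ : LocBdd w₃)
    (hS : MeasurableSet S) (hR : ∀ ξ ∈ S, rad ξ ≤ R) (x y : L2) :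
    ∫ ξ in S, quad w₁ w₂ w₃ x y ξ = wform S w₁ y y + wform S w₂ x x + wform S w₃ x y := by
  have i₁ := integrableOn_weight_rdot hS (h₁.indicator hS hR) y y
  have i₂ := integrableOn_weight_rdot hS (h₂.indicator hS hR) x x
  have i₃ := integrableOn_weight_rdot hS (h₃.indicator hS hR) x y
  rw [wform_eq hS (h₁.indicator hS hR), wform_eq hS (h₂.indicator hS hR),
    wform_eq hS (h₃.indicator hS hR)]
  exact (integral_add (i₁.add i₂) i₃).trans (congrArg (· + _) (integral_add i₁ i₂))

variable {c θ : ℝ} {x y : ℝ → L2}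

lemma IsOscillator.continuousOn_quad (h : IsOscillator c θ x y) (h₁ : LocBdd w₁)
    (h₂ : LocBdd w₂) (h₃ : LocBdd w₃) (hS : MeasurableSet S) (hR : ∀ ξ ∈ S, rad ξ ≤ R) :
    ContinuousOn (fun τ => ∫ ξ in S, quad w₁ w₂ w₃ (x τ) (y τ) ξ) (Set.Ici 0) := by
  simp only [setIntegral_quad h₁ h₂ h₃ hS hR]
  exact ((continuousOn_wform S w₁ h.continuousOn_velocity h.continuousOn_velocity).add
    (continuousOn_wform S w₂ h.continuousOn_position h.continuousOn_position)).add
    (continuousOn_wform S w₃ h.continuousOn_position h.continuousOn_velocity)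

/-- Time derivative of a quadratic form along an oscillator. -/
lemma IsOscillator.hasDerivAt_quad (h : IsOscillator c θ x y) (h₁ : LocBdd w₁)
    (h₂ : LocBdd w₂) (h₃ : LocBdd w₃) (hS : MeasurableSet S) (hR : ∀ ξ ∈ S, rad ξ ≤ R) {t : ℝ}
    (ht : 0 < t) :
    HasDerivAt (fun τ => ∫ ξ in S, quad w₁ w₂ w₃ (x τ) (y τ) ξ)
      (∫ ξ in S, quad (fun ξ => w₃ ξ - 2 * w₁ ξ * damp θ ξ) (fun ξ => -(w₃ ξ * c ^ 2 * rad ξ ^ 2))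
        (fun ξ => 2 * w₂ ξ - 2 * w₁ ξ * c ^ 2 * rad ξ ^ 2 - w₃ ξ * damp θ ξ) (x t) (y t) ξ) t := by
  obtain ⟨G, hG, hG'⟩ := h.hasDerivAt_velocity R t ht
  have hx := h.hasDerivAt_position t ht
  set Y : ℝ → L2 := fun τ => mulOp (cut R fun _ => 1) (y τ) with hY
  have b₁ := h₁.indicator hS hR
  have b₂ := h₂.indicator hS hR
  have b₃ := h₃.indicator hS hR
  have eY : ∀ τ, ∀ᵐ ξ, ξ ∈ S → Y τ ξ = y τ ξ := fun τ => by
    filter_upwards [mulOp_coeFn (bddWeight_cut_one R) (y τ)] with ξ e hξ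
    rw [hY, e, cut_of_le (hR ξ hξ)]
    simp
  have hd := ((hasDerivAt_wform S w₁ hG hG).add (hasDerivAt_wform S w₂ hx hx)).add
    (hasDerivAt_wform S w₃ hx hG)
  have e₁ : (fun τ => ∫ ξ in S, quad w₁ w₂ w₃ (x τ) (y τ) ξ) = fun τ =>
      wform S w₁ (Y τ) (Y τ) + wform S w₂ (x τ) (x τ) + wform S w₃ (x τ) (Y τ) := by
    ext τ
    have p₁ : wform S w₁ (y τ) (y τ) = wform S w₁ (Y τ) (Y τ) := by
      rw [wform_eq hS b₁, wform_eq hS b₁]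
      refine setIntegral_congr_ae hS ?_
      filter_upwards [eY τ] with ξ e hξ
      rw [e hξ]
    have p₃ : wform S w₃ (x τ) (y τ) = wform S w₃ (x τ) (Y τ) := by
      rw [wform_eq hS b₃, wform_eq hS b₃]
      refine setIntegral_congr_ae hS ?_
      filter_upwards [eY τ] with ξ e hξ
      rw [e hξ]
    rw [setIntegral_quad h₁ h₂ h₃ hS hR, p₁, p₃]
  rw [e₁]
  refine hd.congr_deriv ?_
  · simp only [wform_eq hS b₁, wform_eq hS b₂, wform_eq hS b₃]
    have i := fun f g => integrableOn_weight_rdot hS b₁ f g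
    have j := fun f g => integrableOn_weight_rdot hS b₂ f g
    have k := fun f g => integrableOn_weight_rdot hS b₃ f g
    have hadd : ∀ {f g : E3 → ℝ}, IntegrableOn f S → IntegrableOn g S →
        (∫ ξ in S, f ξ) + (∫ ξ in S, g ξ) = ∫ ξ in S, (f + g) ξ :=
      fun hf hg => (integral_add' hf hg).symm
    rw [hadd (i _ _) (i _ _), hadd (j _ _) (j _ _), hadd (k _ _) (k _ _),
      hadd ((i _ _).add (i _ _)) ((j _ _).add (j _ _)),
      hadd (((i _ _).add (i _ _)).add ((j _ _).add (j _ _))) ((k _ _).add (k _ _))]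
    refine setIntegral_congr_ae hS ?_
    filter_upwards [eY t, hG'] with ξ e e' hξ
    simp only [Pi.add_apply]
    rw [e hξ, e' (hR ξ hξ)]
    simp only [quad, rdot, Complex.neg_re, Complex.neg_im, Complex.add_re, Complex.add_im,
      Complex.re_ofReal_mul, Complex.im_ofReal_mul]
    ring

end Quad

/-! ### Pointwise decay at each frequency -/

/-- Grönwall's inequality with a constant rate. -/
lemma le_exp_mul_of_deriv_le {f f' : ℝ → ℝ} {k : ℝ} (hc : ContinuousOn f (Set.Ici 0))
    (hd : ∀ t, 0 < t → HasDerivAt f (f' t) t) (h : ∀ t, 0 < t → f' t ≤ -k * f t) {t : ℝ}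
    (ht : 0 ≤ t) : f t ≤ Real.exp (-k * t) * f 0 := by
  have hanti : AntitoneOn (fun τ => Real.exp (k * τ) * f τ) (Set.Ici 0) := by
    refine antitoneOn_of_hasDerivWithinAt_nonpos (convex_Ici 0)
      (f' := fun τ => Real.exp (k * τ) * k * f τ + Real.exp (k * τ) * f' τ) ?_ ?_ ?_
    · exact (by fun_prop : Continuous fun τ : ℝ => Real.exp (k * τ)).continuousOn.mul hc
    · intro τ hτ
      rw [interior_Ici] at hτ
      have h1 : HasDerivAt (fun τ : ℝ => Real.exp (k * τ)) (Real.exp (k * τ) * k) τ := by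
        simpa using ((hasDerivAt_id τ).const_mul k).exp
      exact (h1.mul (hd τ hτ)).hasDerivWithinAt
    · intro τ hτ
      rw [interior_Ici] at hτ
      have := mul_le_mul_of_nonneg_left (h τ hτ) (Real.exp_pos (k * τ)).le
      linarith
  have := hanti Set.self_mem_Ici (show t ∈ Set.Ici (0 : ℝ) from ht) ht
  simp only [mul_zero, Real.exp_zero, one_mul] at this
  rw [neg_mul, Real.exp_neg, ← div_eq_inv_mul, le_div_iff₀ (Real.exp_pos _)]
  linarith

/-- The integrand of the time derivative of a quadratic form along an oscillator is integrable. -/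
lemma integrableOn_quad_deriv {w₁ w₂ w₃ : E3 → ℝ} {S : Set E3} {R θ : ℝ} (h0 : 0 ≤ θ)
    (h₁ : LocBdd w₁) (h₂ : LocBdd w₂) (h₃ : LocBdd w₃)
    (hS : MeasurableSet S) (hR : ∀ ξ ∈ S, rad ξ ≤ R) (c : ℝ) (x y : L2) :
    IntegrableOn (quad (fun ξ => w₃ ξ - 2 * w₁ ξ * damp θ ξ)
      (fun ξ => -(w₃ ξ * c ^ 2 * rad ξ ^ 2))
      (fun ξ => 2 * w₂ ξ - 2 * w₁ ξ * c ^ 2 * rad ξ ^ 2 - w₃ ξ * damp θ ξ) x y) S := by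
  have hd := locBdd_damp h0
  have hr := locBdd_rad_sq
  have h2 := LocBdd.const 2
  have hc := LocBdd.const (c ^ 2)
  exact integrableOn_quad (h₃.sub ((h2.mul h₁).mul hd)) ((h₃.mul hc).mul hr).neg
    (((h2.mul h₂).sub (((h2.mul h₁).mul hc).mul hr)).sub (h₃.mul hd)) hS hR x y

/-- Passage from inequalities between integrals to a pointwise inequality. -/
lemma ae_le_on_of_forall_setIntegral_le {T : Set E3} (hT : MeasurableSet T) {f g : E3 → ℝ}
    (hf : IntegrableOn f T) (hg : IntegrableOn g T)
    (h : ∀ S ⊆ T, MeasurableSet S → ∫ ξ in S, f ξ ≤ ∫ ξ in S, g ξ) :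
    ∀ᵐ ξ, ξ ∈ T → f ξ ≤ g ξ := by
  rw [← ae_restrict_iff' hT]
  refine ae_le_of_forall_setIntegral_le hf hg fun s hs _ => ?_
  rw [Measure.restrict_restrict hs]
  exact h _ Set.inter_subset_right (hs.inter hT)

/-- The decay rate `d r² / (r² + d²)`, comparable to `min (d, r² / d)`, of the oscillator with
damping `d = r^{2θ}` at frequency `r`. -/
def rate (θ : ℝ) (ξ : E3) : ℝ := damp θ ξ * rad ξ ^ 2 / (rad ξ ^ 2 + damp θ ξ ^ 2)

@[fun_prop]
lemma measurable_rate (θ : ℝ) : Measurable (rate θ) := by unfold rate; fun_prop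

lemma rate_nonneg (θ : ℝ) (ξ : E3) : 0 ≤ rate θ ξ := by
  have := damp_nonneg θ ξ
  unfold rate; positivity

lemma rate_le_damp (θ : ℝ) (ξ : E3) : rate θ ξ ≤ damp θ ξ := by
  have := damp_nonneg θ ξ
  rcases (rad_nonneg ξ).eq_or_lt with h | h
  · simp [rate, ← h, this]
  · rw [rate, div_le_iff₀ (by positivity)]
    nlinarith [pow_nonneg this 3]

lemma damp_pos (θ : ℝ) {ξ : E3} (h : 0 < rad ξ) : 0 < damp θ ξ := Real.rpow_pos_of_pos h _

lemma rate_pos (θ : ℝ) {ξ : E3} (h : 0 < rad ξ) : 0 < rate θ ξ := by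
  have := damp_pos θ h
  unfold rate; positivity

lemma ae_rad_pos : ∀ᵐ ξ : E3, 0 < rad ξ := by
  filter_upwards [Measure.ae_ne volume (0 : E3)] with ξ hξ
  have := norm_pos_iff.2 hξ
  unfold rad; positivity

/-- The density `|y|²/2 + c² r² |x|²/2 + (d/2) Re (conj x y) + (d²/4) |x|²`: the energy, corrected
so that it also dissipates `|x|²`. -/
def lyap (c θ : ℝ) (x y : L2) : E3 → ℝ :=
  quad (fun _ => 1 / 2) (fun ξ => c ^ 2 / 2 * rad ξ ^ 2 + 1 / 4 * damp θ ξ ^ 2)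
    (fun ξ => 1 / 2 * damp θ ξ) x y

lemma lyap_lower (c θ : ℝ) (x y : L2) (ξ : E3) :
    1 / 8 * ‖y ξ‖ ^ 2 + (c ^ 2 / 2 * rad ξ ^ 2 + 1 / 12 * damp θ ξ ^ 2) * ‖x ξ‖ ^ 2
      ≤ lyap c θ x y ξ := by
  simp only [lyap, quad, ← rdot_self, rdot]
  nlinarith [sq_nonneg (3 * (y ξ).re + 2 * damp θ ξ * (x ξ).re),
    sq_nonneg (3 * (y ξ).im + 2 * damp θ ξ * (x ξ).im)]

lemma lyap_upper (c θ : ℝ) (x y : L2) (ξ : E3) :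
    lyap c θ x y ξ ≤ ‖y ξ‖ ^ 2 + (c ^ 2 / 2 * rad ξ ^ 2 + 1 / 2 * damp θ ξ ^ 2) * ‖x ξ‖ ^ 2 := by
  simp only [lyap, quad, ← rdot_self, rdot]
  nlinarith [sq_nonneg (3 * (y ξ).re - 2 * damp θ ξ * (x ξ).re),
    sq_nonneg (3 * (y ξ).im - 2 * damp θ ξ * (x ξ).im), sq_nonneg (y ξ).re, sq_nonneg (y ξ).im,
    sq_nonneg (damp θ ξ * (x ξ).re), sq_nonneg (damp θ ξ * (x ξ).im)]

lemma lyap_nonneg (c θ : ℝ) (x y : L2) (ξ : E3) : 0 ≤ lyap c θ x y ξ :=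
  le_trans (by positivity) (lyap_lower c θ x y ξ)

/-- The dissipation controls the modified energy with the rate `d r² / (r² + d²)`. -/
lemma rate_mul_lyap_le (c θ : ℝ) (x y : L2) {ξ : E3} (hξ : 0 < rad ξ) :
    min (1 / 2) (c ^ 2) * rate θ ξ * lyap c θ x y ξ
      ≤ 1 / 2 * damp θ ξ * (‖y ξ‖ ^ 2 + c ^ 2 * rad ξ ^ 2 * ‖x ξ‖ ^ 2) := by
  set κ := min (1 / 2) (c ^ 2) with hκ
  have k1 : κ ≤ 1 / 2 := min_le_left _ _
  have k2 : κ ≤ c ^ 2 := min_le_right _ _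
  have k0 : 0 ≤ κ := le_min (by norm_num) (sq_nonneg c)
  have hd := damp_pos θ hξ
  have hr := rate_pos θ hξ
  refine (mul_le_mul_of_nonneg_left (lyap_upper c θ x y ξ) (by positivity)).trans ?_
  rw [rate]
  set r := rad ξ
  set d := damp θ ξ
  have e : κ * (d * r ^ 2 / (r ^ 2 + d ^ 2)) *
      (‖y ξ‖ ^ 2 + (c ^ 2 / 2 * r ^ 2 + 1 / 2 * d ^ 2) * ‖x ξ‖ ^ 2)
      = d * (κ * r ^ 2 * ‖y ξ‖ ^ 2
        + κ * (c ^ 2 / 2 * r ^ 2 + 1 / 2 * d ^ 2) * (r ^ 2 * ‖x ξ‖ ^ 2)) / (r ^ 2 + d ^ 2) := by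
    field_simp
  rw [e, div_le_iff₀ (by positivity)]
  have f1 : κ * r ^ 2 * ‖y ξ‖ ^ 2 ≤ 1 / 2 * (r ^ 2 + d ^ 2) * ‖y ξ‖ ^ 2 := by
    gcongr ?_ * _
    nlinarith [sq_nonneg r, sq_nonneg d]
  have f2 : κ * (c ^ 2 / 2 * r ^ 2 + 1 / 2 * d ^ 2) * (r ^ 2 * ‖x ξ‖ ^ 2)
      ≤ 1 / 2 * c ^ 2 * (r ^ 2 + d ^ 2) * (r ^ 2 * ‖x ξ‖ ^ 2) := by
    gcongr ?_ * _
    have g1 := mul_nonneg (sq_nonneg c) (sq_nonneg r)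
    have g2 := sq_nonneg d
    nlinarith
  have := mul_le_mul_of_nonneg_left (add_le_add f1 f2) hd.le
  calc _ ≤ _ := this
    _ = _ := by ring

section Decay

variable {c θ : ℝ} {x y : ℝ → L2}

lemma locBdd_lyap (c : ℝ) (h0 : 0 ≤ θ) :
    LocBdd fun ξ => c ^ 2 / 2 * rad ξ ^ 2 + 1 / 4 * damp θ ξ ^ 2 :=
  ((LocBdd.const _).mul locBdd_rad_sq).add ((LocBdd.const _).mul (locBdd_damp_sq h0))

/-- Decay of the corrected energy on a set of frequencies on which the rate is bounded below. -/
lemma IsOscillator.setIntegral_lyap_le (h : IsOscillator c θ x y) (h0 : 0 ≤ θ) {S : Set E3}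
    (hS : MeasurableSet S) {R ε : ℝ} (hR : ∀ ξ ∈ S, rad ξ ≤ R) (hpos : ∀ ξ ∈ S, 0 < rad ξ)
    (hε : ∀ ξ ∈ S, ε ≤ rate θ ξ) {t : ℝ} (ht : 0 ≤ t) :
    ∫ ξ in S, lyap c θ (x t) (y t) ξ
      ≤ Real.exp (-(min (1 / 2) (c ^ 2) * ε) * t) * ∫ ξ in S, lyap c θ (x 0) (y 0) ξ := by
  have h₁ := LocBdd.const (1 / 2)
  have h₂ := locBdd_lyap c h0
  have h₃ := (LocBdd.const (1 / 2)).mul (locBdd_damp h0)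
  refine le_exp_mul_of_deriv_le (h.continuousOn_quad h₁ h₂ h₃ hS hR)
    (fun t ht => h.hasDerivAt_quad h₁ h₂ h₃ hS hR ht) (fun τ hτ => ?_) ht
  rw [← integral_const_mul]
  refine setIntegral_mono_on (integrableOn_quad_deriv h0 h₁ h₂ h₃ hS hR c _ _)
    ((integrableOn_quad h₁ h₂ h₃ hS hR _ _).const_mul _) hS fun ξ hξ => ?_
  have k0 : 0 ≤ min (1 / 2) (c ^ 2) := le_min (by norm_num) (sq_nonneg c)
  have e1 := rate_mul_lyap_le c θ (x τ) (y τ) (hpos ξ hξ)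
  have e2 : min (1 / 2) (c ^ 2) * ε * lyap c θ (x τ) (y τ) ξ
      ≤ min (1 / 2) (c ^ 2) * rate θ ξ * lyap c θ (x τ) (y τ) ξ :=
    mul_le_mul_of_nonneg_right (mul_le_mul_of_nonneg_left (hε ξ hξ) k0) (lyap_nonneg _ _ _ _ _)
  have e3 := e2.trans e1
  rw [neg_mul]
  refine le_trans (le_of_eq ?_) (neg_le_neg e3)
  simp only [quad, ← rdot_self]
  ring

lemma IsOscillator.lyap_le (h : IsOscillator c θ x y) (h0 : 0 ≤ θ) {t : ℝ} (ht : 0 ≤ t) :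
    ∀ᵐ ξ, lyap c θ (x t) (y t) ξ
      ≤ Real.exp (-(min (1 / 2) (c ^ 2) / 2) * rate θ ξ * t) * lyap c θ (x 0) (y 0) ξ := by
  have h₁ := LocBdd.const (1 / 2)
  have h₂ := locBdd_lyap c h0
  have h₃ := (LocBdd.const (1 / 2)).mul (locBdd_damp h0)
  -- countably many sets, so that the exceptional null sets can be discarded at once
  have key : ∀ (R : ℕ) (ε : ℚ), ∀ᵐ ξ, ξ ∈ {ξ | (ε : ℝ) ≤ rate θ ξ ∧ 0 < rad ξ ∧ rad ξ ≤ R} →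
      lyap c θ (x t) (y t) ξ ≤ Real.exp (-(min (1 / 2) (c ^ 2) * ε) * t)
        * lyap c θ (x 0) (y 0) ξ := by
    intro R ε
    have hT : MeasurableSet {ξ | (ε : ℝ) ≤ rate θ ξ ∧ 0 < rad ξ ∧ rad ξ ≤ R} :=
      (measurableSet_le measurable_const (measurable_rate θ)).inter
        ((measurableSet_lt measurable_const measurable_rad).inter
          (measurableSet_le measurable_rad measurable_const))
    refine ae_le_on_of_forall_setIntegral_le hT
      (integrableOn_quad h₁ h₂ h₃ hT (fun ξ hξ => hξ.2.2) _ _)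
      ((integrableOn_quad h₁ h₂ h₃ hT (fun ξ hξ => hξ.2.2) _ _).const_mul _)
      fun S hST hS => ?_
    rw [integral_const_mul]
    exact h.setIntegral_lyap_le h0 hS (fun ξ hξ => (hST hξ).2.2) (fun ξ hξ => (hST hξ).2.1)
      (fun ξ hξ => (hST hξ).1) ht
  filter_upwards [ae_all_iff.2 fun R => ae_all_iff.2 (key R), ae_rad_pos] with ξ hξ hpos
  have hr := rate_pos θ hpos
  obtain ⟨ε, hε1, hε2⟩ := exists_rat_btwn (half_lt_self hr)
  obtain ⟨R, hR⟩ := exists_nat_ge (rad ξ)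
  refine (hξ R ε ⟨hε2.le, hpos, hR⟩).trans ?_
  have k0 : 0 ≤ min (1 / 2) (c ^ 2) := le_min (by norm_num) (sq_nonneg c)
  gcongr
  · exact lyap_nonneg _ _ _ _ _
  · nlinarith

/-- Decay of the position of an oscillator, at almost every frequency. -/
lemma IsOscillator.exists_position_le (hc : c ≠ 0) (h0 : 0 ≤ θ) :
    ∃ C κ : ℝ, 0 < C ∧ 0 < κ ∧ κ ≤ 1 / 4 ∧ ∀ x y : ℝ → L2, IsOscillator c θ x y → ∀ t, 0 ≤ t →
      ∀ᵐ ξ, ‖x t ξ‖ ^ 2 ≤ C * Real.exp (-κ * rate θ ξ * t)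
        * (‖x 0 ξ‖ ^ 2 + ‖y 0 ξ‖ ^ 2 / (rad ξ ^ 2 + damp θ ξ ^ 2)) := by
  have hc2 : 0 < c ^ 2 := by positivity
  set m := min (c ^ 2 / 2) (1 / 12) with hm
  have m0 : 0 < m := lt_min (by positivity) (by norm_num)
  refine ⟨(1 + c ^ 2) / m, min (1 / 2) (c ^ 2) / 2, by positivity,
    half_pos (lt_min (by norm_num) hc2), ?_, fun x y h t ht => ?_⟩
  · linarith [min_le_left (1 / 2) (c ^ 2)]
  filter_upwards [h.lyap_le h0 ht, ae_rad_pos] with ξ hξ hpos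
  have hd := damp_pos θ hpos
  have lo := lyap_lower c θ (x t) (y t) ξ
  have up := lyap_upper c θ (x 0) (y 0) ξ
  set e := Real.exp (-(min (1 / 2) (c ^ 2) / 2) * rate θ ξ * t)
  have he : 0 < e := Real.exp_pos _
  set r := rad ξ
  set d := damp θ ξ
  have m1 : m ≤ c ^ 2 / 2 := min_le_left _ _
  have m2 : m ≤ 1 / 12 := min_le_right _ _
  have hD : 0 < r ^ 2 + d ^ 2 := by positivity
  have A1 : m * (r ^ 2 + d ^ 2) * ‖x t ξ‖ ^ 2
      ≤ (c ^ 2 / 2 * r ^ 2 + 1 / 12 * d ^ 2) * ‖x t ξ‖ ^ 2 := by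
    gcongr
    nlinarith [sq_nonneg r, sq_nonneg d]
  have A2 : ‖y 0 ξ‖ ^ 2 + (c ^ 2 / 2 * r ^ 2 + 1 / 2 * d ^ 2) * ‖x 0 ξ‖ ^ 2
      ≤ (1 + c ^ 2) * (‖y 0 ξ‖ ^ 2 + (r ^ 2 + d ^ 2) * ‖x 0 ξ‖ ^ 2) := by
    have : (c ^ 2 / 2 * r ^ 2 + 1 / 2 * d ^ 2) * ‖x 0 ξ‖ ^ 2
        ≤ ((1 + c ^ 2) * (r ^ 2 + d ^ 2)) * ‖x 0 ξ‖ ^ 2 := by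
      gcongr
      nlinarith [sq_nonneg r, sq_nonneg d, mul_pos hc2 (sq_pos_of_pos hd),
        mul_pos hc2 (sq_pos_of_pos hpos)]
    nlinarith [mul_nonneg hc2.le (sq_nonneg ‖y 0 ξ‖)]
  have A3 : m * (r ^ 2 + d ^ 2) * ‖x t ξ‖ ^ 2
      ≤ e * ((1 + c ^ 2) * (‖y 0 ξ‖ ^ 2 + (r ^ 2 + d ^ 2) * ‖x 0 ξ‖ ^ 2)) := by
    have := mul_le_mul_of_nonneg_left (up.trans A2) he.le
    nlinarith [sq_nonneg ‖y t ξ‖]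
  have A4 : (1 + c ^ 2) / m * e * (‖x 0 ξ‖ ^ 2 + ‖y 0 ξ‖ ^ 2 / (r ^ 2 + d ^ 2))
      = e * ((1 + c ^ 2) * (‖y 0 ξ‖ ^ 2 + (r ^ 2 + d ^ 2) * ‖x 0 ξ‖ ^ 2))
        / (m * (r ^ 2 + d ^ 2)) := by
    field_simp
    ring
  rw [A4, le_div_iff₀ (by positivity)]
  linarith

end Decay

section Velocity

variable {c θ : ℝ} {x y : ℝ → L2}

/-- The density of the energy `|y|² + c² r² |x|²` of an oscillator. -/
def energy (c : ℝ) (x y : L2) : E3 → ℝ :=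
  quad (fun _ => 1) (fun ξ => c ^ 2 * rad ξ ^ 2) (fun _ => 0) x y

lemma energy_eq (c : ℝ) (x y : L2) (ξ : E3) :
    energy c x y ξ = ‖y ξ‖ ^ 2 + c ^ 2 * rad ξ ^ 2 * ‖x ξ‖ ^ 2 := by
  simp [energy, quad, rdot_self]

/-- The quantity `r² (|x|² + |y|² / (r² + d²))`, which controls the slowly decaying part of the
energy. -/
def slowEnergy (θ : ℝ) (x y : L2) : E3 → ℝ :=
  quad (fun ξ => rad ξ ^ 2 / (rad ξ ^ 2 + damp θ ξ ^ 2)) (fun ξ => rad ξ ^ 2) (fun _ => 0) x y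

lemma slowEnergy_eq (θ : ℝ) (x y : L2) (ξ : E3) :
    slowEnergy θ x y ξ
      = rad ξ ^ 2 * (‖x ξ‖ ^ 2 + ‖y ξ‖ ^ 2 / (rad ξ ^ 2 + damp θ ξ ^ 2)) := by
  simp only [slowEnergy, quad, rdot_self]
  ring

lemma slowEnergy_nonneg (θ : ℝ) (x y : L2) (ξ : E3) : 0 ≤ slowEnergy θ x y ξ := by
  rw [slowEnergy_eq]; positivity

lemma locBdd_slow (θ : ℝ) : LocBdd fun ξ => rad ξ ^ 2 / (rad ξ ^ 2 + damp θ ξ ^ 2) := by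
  refine ⟨by fun_prop, fun R => ⟨1, fun ξ _ => ?_⟩⟩
  rw [abs_of_nonneg (by positivity)]
  exact div_le_one_of_le₀ (by nlinarith [sq_nonneg (damp θ ξ)]) (by positivity)

/-- The energy is dissipated at the rate `2 d |y|²`, which differs from `2 d` times the energy by
`2 d c² r² |x|²`; the decay of `x` turns this into a source which decays slowly. -/
lemma IsOscillator.setIntegral_energy_le (h : IsOscillator c θ x y) (h0 : 0 ≤ θ) {C κ : ℝ}
    (hC : 0 < C) (hκ1 : κ ≤ 1 / 4) (hκ : 0 < κ)
    (hpos : ∀ t, 0 ≤ t → ∀ᵐ ξ, ‖x t ξ‖ ^ 2 ≤ C * Real.exp (-κ * rate θ ξ * t)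
        * (‖x 0 ξ‖ ^ 2 + ‖y 0 ξ‖ ^ 2 / (rad ξ ^ 2 + damp θ ξ ^ 2)))
    {S : Set E3} (hS : MeasurableSet S) {R ε δ : ℝ} (hR : ∀ ξ ∈ S, rad ξ ≤ R)
    (hε : ∀ ξ ∈ S, ε ≤ rate θ ξ) (hδ : ∀ ξ ∈ S, δ ≤ damp θ ξ) (hεδ : ε ≤ δ) (hδ0 : 0 ≤ δ)
    {t : ℝ} (ht : 0 ≤ t) :
    ∫ ξ in S, energy c (x t) (y t) ξ ≤ ∫ ξ in S, (Real.exp (-(2 * δ) * t) * energy c (x 0) (y 0) ξ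
      + 2 * Real.exp (-(κ * ε) * t) * (c ^ 2 * C * slowEnergy θ (x 0) (y 0) ξ)) := by
  have h₁ := LocBdd.const 1
  have h₂ : LocBdd fun ξ => c ^ 2 * rad ξ ^ 2 := (LocBdd.const _).mul locBdd_rad_sq
  have h₃ := LocBdd.const 0
  have iE : ∀ t, IntegrableOn (energy c (x t) (y t)) S := fun t =>
    integrableOn_quad h₁ h₂ h₃ hS hR _ _
  have iG : IntegrableOn (fun ξ => c ^ 2 * C * slowEnergy θ (x 0) (y 0) ξ) S :=
    (integrableOn_quad (locBdd_slow θ) locBdd_rad_sq h₃ hS hR _ _).const_mul _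
  set G := ∫ ξ in S, c ^ 2 * C * slowEnergy θ (x 0) (y 0) ξ with hG
  have hG0 : 0 ≤ G := setIntegral_nonneg hS fun ξ _ => by
    have := slowEnergy_nonneg θ (x 0) (y 0) ξ
    positivity
  have hexp : ∀ t : ℝ, HasDerivAt (fun t => 2 * Real.exp (-(κ * ε) * t) * G)
      (2 * (Real.exp (-(κ * ε) * t) * (-(κ * ε))) * G) t := fun t => by
    have h1 : HasDerivAt (fun τ : ℝ => Real.exp (-(κ * ε) * τ))
        (Real.exp (-(κ * ε) * t) * (-(κ * ε))) t := by
      simpa using ((hasDerivAt_id t).const_mul (-(κ * ε))).exp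
    exact (h1.const_mul 2).mul_const G
  have main := le_exp_mul_of_deriv_le (k := 2 * δ)
    (f := fun t => (∫ ξ in S, energy c (x t) (y t) ξ) - 2 * Real.exp (-(κ * ε) * t) * G)
    ((h.continuousOn_quad h₁ h₂ h₃ hS hR).sub
      (by fun_prop : Continuous fun t : ℝ => 2 * Real.exp (-(κ * ε) * t) * G).continuousOn)
    (fun t ht => (h.hasDerivAt_quad h₁ h₂ h₃ hS hR ht).sub (hexp t)) (fun τ hτ => ?_) ht
  · rw [integral_add ((iE 0).const_mul _) (iG.const_mul _), integral_const_mul, integral_const_mul,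
      ← hG]
    have e1 : Real.exp (-(κ * ε) * 0) = 1 := by simp
    rw [e1] at main
    nlinarith [mul_nonneg (Real.exp_pos (-(2 * δ) * t)).le hG0]
  · have hle : ∫ ξ in S, quad (fun ξ => 0 - 2 * 1 * damp θ ξ) (fun ξ => -(0 * c ^ 2 * rad ξ ^ 2))
        (fun ξ => 2 * (c ^ 2 * rad ξ ^ 2) - 2 * 1 * c ^ 2 * rad ξ ^ 2 - 0 * damp θ ξ) (x τ) (y τ) ξ
        ≤ ∫ ξ in S, (-(2 * δ) * energy c (x τ) (y τ) ξ
          + 2 * δ * Real.exp (-(κ * ε) * τ) * (c ^ 2 * C * slowEnergy θ (x 0) (y 0) ξ)) := by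
      refine setIntegral_mono_on_ae (integrableOn_quad_deriv h0 h₁ h₂ h₃ hS hR c _ _)
        (((iE τ).const_mul _).add (iG.const_mul _)) hS ?_
      filter_upwards [hpos τ hτ.le] with ξ e hξ
      rw [energy_eq, slowEnergy_eq]
      simp only [quad, rdot_self]
      have e1 : Real.exp (-κ * rate θ ξ * τ) ≤ Real.exp (-(κ * ε) * τ) := by
        gcongr
        nlinarith [mul_le_mul_of_nonneg_left (hε ξ hξ) hκ.le]
      set n := ‖x 0 ξ‖ ^ 2 + ‖y 0 ξ‖ ^ 2 / (rad ξ ^ 2 + damp θ ξ ^ 2) with hn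
      have hn0 : 0 ≤ n := by positivity
      have e2 : ‖x τ ξ‖ ^ 2 ≤ C * Real.exp (-(κ * ε) * τ) * n :=
        e.trans (by gcongr)
      have e3 : 2 * δ * (c ^ 2 * rad ξ ^ 2) * ‖x τ ξ‖ ^ 2
          ≤ 2 * δ * (c ^ 2 * rad ξ ^ 2) * (C * Real.exp (-(κ * ε) * τ) * n) := by gcongr
      have e4 : δ * ‖y τ ξ‖ ^ 2 ≤ damp θ ξ * ‖y τ ξ‖ ^ 2 := by
        gcongr
        exact hδ ξ hξ
      linarith
    rw [integral_add ((iE τ).const_mul _) (iG.const_mul _), integral_const_mul, integral_const_mul,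
      ← hG] at hle
    have e5 : κ * ε ≤ δ := by nlinarith
    have e6 : 0 ≤ Real.exp (-(κ * ε) * τ) * G := by positivity
    have e7 := mul_le_mul_of_nonneg_right e5 e6
    linarith

/-- Decay of the energy of an oscillator, at almost every frequency. Only the initial velocity
appears with the fast rate `|ξ|^{2θ}`. -/
lemma IsOscillator.exists_energy_le (hc : c ≠ 0) (h0 : 0 ≤ θ) :
    ∃ C κ : ℝ, 0 < C ∧ 0 < κ ∧ ∀ x y : ℝ → L2, IsOscillator c θ x y → ∀ t, 0 ≤ t → ∀ᵐ ξ,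
      ‖x t ξ‖ ^ 2 ≤ C * Real.exp (-κ * rate θ ξ * t)
        * (‖x 0 ξ‖ ^ 2 + ‖y 0 ξ‖ ^ 2 / (rad ξ ^ 2 + damp θ ξ ^ 2)) ∧
      ‖y t ξ‖ ^ 2 + rad ξ ^ 2 * ‖x t ξ‖ ^ 2 ≤ C * (Real.exp (-damp θ ξ * t) * ‖y 0 ξ‖ ^ 2
        + Real.exp (-κ * rate θ ξ * t)
          * (rad ξ ^ 2 * (‖x 0 ξ‖ ^ 2 + ‖y 0 ξ‖ ^ 2 / (rad ξ ^ 2 + damp θ ξ ^ 2)))) := by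
  obtain ⟨C, κ, hC, hκ, hκ1, H⟩ := IsOscillator.exists_position_le hc h0
  have hc2 : 0 < c ^ 2 := by positivity
  set m := min 1 (c ^ 2) with hm
  have m0 : 0 < m := lt_min one_pos hc2
  have m1 : m ≤ 1 := min_le_left _ _
  have m2 : m ≤ c ^ 2 := min_le_right _ _
  set K := (1 + c ^ 2 + 2 * c ^ 2 * C) / m with hK
  have hK0 : 0 < K := by positivity
  refine ⟨C + K, κ / 2, by positivity, by positivity, fun x y h t ht => ?_⟩
  have h₁ := LocBdd.const 1
  have h₂ : LocBdd fun ξ => c ^ 2 * rad ξ ^ 2 := (LocBdd.const _).mul locBdd_rad_sq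
  have h₃ := LocBdd.const 0
  have key : ∀ (R : ℕ) (ε δ : ℚ), ε ≤ δ → 0 ≤ δ → ∀ᵐ ξ,
      ξ ∈ {ξ | (ε : ℝ) ≤ rate θ ξ ∧ (δ : ℝ) ≤ damp θ ξ ∧ rad ξ ≤ R} →
      energy c (x t) (y t) ξ ≤ Real.exp (-(2 * δ) * t) * energy c (x 0) (y 0) ξ
      + 2 * Real.exp (-(κ * ε) * t) * (c ^ 2 * C * slowEnergy θ (x 0) (y 0) ξ) := by
    intro R ε δ hεδ hδ
    have hT : MeasurableSet {ξ | (ε : ℝ) ≤ rate θ ξ ∧ (δ : ℝ) ≤ damp θ ξ ∧ rad ξ ≤ R} :=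
      (measurableSet_le measurable_const (measurable_rate θ)).inter
        ((measurableSet_le measurable_const (measurable_damp θ)).inter
          (measurableSet_le measurable_rad measurable_const))
    have hTR : ∀ ξ ∈ {ξ | (ε : ℝ) ≤ rate θ ξ ∧ (δ : ℝ) ≤ damp θ ξ ∧ rad ξ ≤ R}, rad ξ ≤ R :=
      fun ξ hξ => hξ.2.2
    refine ae_le_on_of_forall_setIntegral_le hT (integrableOn_quad h₁ h₂ h₃ hT hTR _ _)
      (((integrableOn_quad h₁ h₂ h₃ hT hTR _ _).const_mul _).add
        (((integrableOn_quad (locBdd_slow θ) locBdd_rad_sq h₃ hT hTR _ _).const_mul _).const_mul _))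
      fun S hST hS => ?_
    exact h.setIntegral_energy_le h0 hC hκ1 hκ (H x y h) hS (fun ξ hξ => (hST hξ).2.2)
      (fun ξ hξ => (hST hξ).1) (fun ξ hξ => (hST hξ).2.1) (by exact_mod_cast hεδ)
      (by exact_mod_cast hδ) ht
  have key' : ∀ᵐ ξ, ∀ (R : ℕ) (ε δ : ℚ), ε ≤ δ → 0 ≤ δ →
      ξ ∈ {ξ | (ε : ℝ) ≤ rate θ ξ ∧ (δ : ℝ) ≤ damp θ ξ ∧ rad ξ ≤ R} →
      energy c (x t) (y t) ξ ≤ Real.exp (-(2 * δ) * t) * energy c (x 0) (y 0) ξ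
      + 2 * Real.exp (-(κ * ε) * t) * (c ^ 2 * C * slowEnergy θ (x 0) (y 0) ξ) := by
    simp only [ae_all_iff]
    exact key
  filter_upwards [key', ae_rad_pos, H x y h t ht] with ξ hξ hpos hx
  have hd := damp_pos θ hpos
  have hr := rate_pos θ hpos
  have hrd := rate_le_damp θ ξ
  set n := ‖x 0 ξ‖ ^ 2 + ‖y 0 ξ‖ ^ 2 / (rad ξ ^ 2 + damp θ ξ ^ 2) with hn
  have hn0 : 0 ≤ n := by positivity
  have hrt : 0 ≤ rate θ ξ * t := by positivity
  set e := Real.exp (-(κ / 2) * rate θ ξ * t)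
  have he : 0 < e := Real.exp_pos _
  set f := Real.exp (-damp θ ξ * t)
  have hf : 0 < f := Real.exp_pos _
  have hfe : f ≤ e := by
    refine Real.exp_le_exp.2 ?_
    nlinarith [mul_le_mul_of_nonneg_right hrd ht]
  refine ⟨hx.trans ?_, ?_⟩
  · have : Real.exp (-κ * rate θ ξ * t) ≤ e := Real.exp_le_exp.2 (by nlinarith)
    gcongr
    linarith
  -- the rational bounds `δ` and `ε` lose at most a factor `2` in the rates, up to `ε ≤ δ`, which
  -- follows from `rate θ ξ ≤ damp θ ξ`
  · obtain ⟨δ, hδ1, hδ2⟩ := exists_rat_btwn (half_lt_self hd)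
    obtain ⟨ε, hε1, hε2⟩ := exists_rat_btwn
      (lt_min (half_lt_self hr) (show rate θ ξ / 2 < δ by linarith))
    obtain ⟨R, hR⟩ := exists_nat_ge (rad ξ)
    have hδ0 : (0 : ℝ) < δ := by linarith
    have b := hξ R ε δ (by exact_mod_cast (hε2.trans_le (min_le_right _ _)).le)
      (by exact_mod_cast hδ0.le) ⟨(hε2.trans_le (min_le_left _ _)).le, hδ2.le, hR⟩
    rw [energy_eq, energy_eq, slowEnergy_eq, ← hn] at b
    have b1 : Real.exp (-(2 * δ) * t) ≤ f := Real.exp_le_exp.2 (by nlinarith)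
    have b2 : Real.exp (-(κ * ε) * t) ≤ e := by
      refine Real.exp_le_exp.2 ?_
      have := mul_le_mul_of_nonneg_right (mul_le_mul_of_nonneg_left hε1.le hκ.le) ht
      linarith
    have hr2 : 0 < rad ξ ^ 2 := by positivity
    have B1 : ‖y t ξ‖ ^ 2 + c ^ 2 * rad ξ ^ 2 * ‖x t ξ‖ ^ 2
        ≤ f * (‖y 0 ξ‖ ^ 2 + c ^ 2 * rad ξ ^ 2 * ‖x 0 ξ‖ ^ 2)
          + 2 * e * (c ^ 2 * C * (rad ξ ^ 2 * n)) := b.trans (by gcongr)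
    have B2 : f * (c ^ 2 * rad ξ ^ 2 * ‖x 0 ξ‖ ^ 2) ≤ e * (c ^ 2 * rad ξ ^ 2 * n) := by
      have : ‖x 0 ξ‖ ^ 2 ≤ n := by rw [hn]; exact le_add_of_nonneg_right (by positivity)
      gcongr
    have B3 : m * (‖y t ξ‖ ^ 2 + rad ξ ^ 2 * ‖x t ξ‖ ^ 2)
        ≤ ‖y t ξ‖ ^ 2 + c ^ 2 * rad ξ ^ 2 * ‖x t ξ‖ ^ 2 := by
      have := mul_le_mul_of_nonneg_right m1 (sq_nonneg ‖y t ξ‖)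
      have := mul_le_mul_of_nonneg_right m2
        (show 0 ≤ rad ξ ^ 2 * ‖x t ξ‖ ^ 2 by positivity)
      linarith
    set P := f * ‖y 0 ξ‖ ^ 2 with hP
    set Q := e * (rad ξ ^ 2 * n) with hQ
    have hP0 : 0 ≤ P := by positivity
    have hQ0 : 0 ≤ Q := by positivity
    have B4 : m * (‖y t ξ‖ ^ 2 + rad ξ ^ 2 * ‖x t ξ‖ ^ 2)
        ≤ (1 + c ^ 2 + 2 * c ^ 2 * C) * (P + Q) := by
      have g1 : 0 ≤ (c ^ 2 + 2 * c ^ 2 * C) * P := by positivity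
      have g2 : f * (‖y 0 ξ‖ ^ 2 + c ^ 2 * rad ξ ^ 2 * ‖x 0 ξ‖ ^ 2)
          = P + f * (c ^ 2 * rad ξ ^ 2 * ‖x 0 ξ‖ ^ 2) := by rw [hP]; ring
      have g3 : e * (c ^ 2 * rad ξ ^ 2 * n) = c ^ 2 * Q := by rw [hQ]; ring
      have g4 : 2 * e * (c ^ 2 * C * (rad ξ ^ 2 * n)) = 2 * c ^ 2 * C * Q := by rw [hQ]; ring
      have g5 : (1 + c ^ 2 + 2 * c ^ 2 * C) * (P + Q)
          = P + c ^ 2 * Q + 2 * c ^ 2 * C * Q + (c ^ 2 + 2 * c ^ 2 * C) * P + Q := by ring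
      linarith
    have B5 : ‖y t ξ‖ ^ 2 + rad ξ ^ 2 * ‖x t ξ‖ ^ 2 ≤ K * (P + Q) := by
      rw [hK, div_mul_eq_mul_div, le_div_iff₀ m0]
      linarith
    have : 0 ≤ C * (P + Q) := by positivity
    linarith

end Velocity

/-! ### Decay of the Fourier transform of an energy solution -/

/-- The density `∑ⱼ |𝓕 fⱼ|²`. -/
def specDensity (f : Fin 3 → L2) (ξ : E3) : ℝ := ∑ j, ‖(𝓕 (f j) : L2) ξ‖ ^ 2

lemma specDensity_nonneg (f : Fin 3 → L2) (ξ : E3) : 0 ≤ specDensity f ξ :=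
  Finset.sum_nonneg fun _ _ => by positivity

lemma norm_dir_mul_le (k : Fin 3) (ξ : E3) (z : ℂ) : ‖(dir k ξ : ℂ) * z‖ ≤ ‖z‖ := by
  rw [norm_mul, Complex.norm_real, Real.norm_eq_abs]
  exact mul_le_of_le_one_left (norm_nonneg z) (abs_dir_le k ξ)

lemma norm_longPart_sq_le (f : Fin 3 → L2) :
    ∀ᵐ ξ, ‖longPart (fun j => 𝓕 (f j)) ξ‖ ^ 2 ≤ 3 * specDensity f ξ := by
  filter_upwards [longPart_coeFn fun j => 𝓕 (f j)] with ξ e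
  rw [e, specDensity]
  have h1 : ‖∑ k, (dir k ξ : ℂ) * (𝓕 (f k) : L2) ξ‖ ≤ ∑ k, ‖(𝓕 (f k) : L2) ξ‖ :=
    (norm_sum_le _ _).trans (Finset.sum_le_sum fun k _ => norm_dir_mul_le k ξ _)
  calc _ ≤ (∑ k, ‖(𝓕 (f k) : L2) ξ‖) ^ 2 := by gcongr
    _ ≤ _ := (sq_sum_le_card_mul_sum_sq (s := Finset.univ)
      (f := fun k => ‖(𝓕 (f k) : L2) ξ‖)).trans_eq (by simp)

lemma norm_transPart_sq_le (k : Fin 3) (f : Fin 3 → L2) :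
    ∀ᵐ ξ, ‖transPart k (fun j => 𝓕 (f j)) ξ‖ ^ 2 ≤ 8 * specDensity f ξ := by
  filter_upwards [transPart_coeFn k fun j => 𝓕 (f j), norm_longPart_sq_le f] with ξ e h
  rw [e]
  set p := longPart (fun j => 𝓕 (f j)) ξ
  have h1 := norm_sub_le ((𝓕 (f k) : L2) ξ) ((dir k ξ : ℂ) * p)
  have h2 := norm_dir_mul_le k ξ p
  have h3 : ‖(𝓕 (f k) : L2) ξ‖ ^ 2 ≤ specDensity f ξ :=
    Finset.single_le_sum (f := fun j => ‖(𝓕 (f j) : L2) ξ‖ ^ 2) (fun _ _ => by positivity)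
      (Finset.mem_univ k)
  have h4 : ‖(𝓕 (f k) : L2) ξ - (dir k ξ : ℂ) * p‖ ^ 2 ≤ (‖(𝓕 (f k) : L2) ξ‖ + ‖p‖) ^ 2 := by
    gcongr
    linarith
  nlinarith [sq_nonneg (‖(𝓕 (f k) : L2) ξ‖ - ‖p‖)]

/-- A vector field is recovered from its longitudinal and transverse components. -/
lemma norm_fourier_sq_le (k : Fin 3) (f : Fin 3 → L2) :
    ∀ᵐ ξ, ‖(𝓕 (f k) : L2) ξ‖ ^ 2 ≤ 2 * ‖transPart k (fun j => 𝓕 (f j)) ξ‖ ^ 2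
      + 2 * ‖longPart (fun j => 𝓕 (f j)) ξ‖ ^ 2 := by
  filter_upwards [transPart_coeFn k fun j => 𝓕 (f j)] with ξ e
  set p := longPart (fun j => 𝓕 (f j)) ξ
  set q := transPart k (fun j => 𝓕 (f j)) ξ
  have h0 : (𝓕 (f k) : L2) ξ = q + (dir k ξ : ℂ) * p := by rw [e]; ring
  have h1 := norm_add_le q ((dir k ξ : ℂ) * p)
  have h2 := norm_dir_mul_le k ξ p
  have h4 : ‖(𝓕 (f k) : L2) ξ‖ ^ 2 ≤ (‖q‖ + ‖p‖) ^ 2 := by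
    rw [h0]
    gcongr
    linarith
  nlinarith [sq_nonneg (‖q‖ - ‖p‖)]

/-- Decay of the Fourier transform of an energy solution at almost every frequency. The fast factor
`exp (-|ξ|^{2θ} t)` only multiplies the initial velocity; all other terms of the energy carry the
additional factor `|ξ|²`. -/
theorem exists_fourier_le {a b θ : ℝ} (ha : a ≠ 0) (hb : b ≠ 0) (h0 : 0 ≤ θ) (h1 : θ ≤ 1) :
    ∃ C κ : ℝ, 0 < C ∧ 0 < κ ∧ ∀ (u₀ u₁ : Fin 3 → L2) (u v : ℝ → Fin 3 → L2),
      IsEnergySolution a b θ u₀ u₁ u v → ∀ t, 0 ≤ t → ∀ k, ∀ᵐ ξ,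
      ‖(𝓕 (u t k) : L2) ξ‖ ^ 2 ≤ C * (Real.exp (-κ * rate θ ξ * t)
        * (specDensity u₀ ξ + specDensity u₁ ξ / (rad ξ ^ 2 + damp θ ξ ^ 2))) ∧
      ‖(𝓕 (v t k) : L2) ξ‖ ^ 2 + rad ξ ^ 2 * ‖(𝓕 (u t k) : L2) ξ‖ ^ 2
        ≤ C * (Real.exp (-damp θ ξ * t) * specDensity u₁ ξ
        + Real.exp (-κ * rate θ ξ * t) * (rad ξ ^ 2 *
          (specDensity u₀ ξ + specDensity u₁ ξ / (rad ξ ^ 2 + damp θ ξ ^ 2)))) := by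
  obtain ⟨C₁, κ₁, hC₁, hκ₁, H₁⟩ := IsOscillator.exists_energy_le ha h0
  obtain ⟨C₂, κ₂, hC₂, hκ₂, H₂⟩ := IsOscillator.exists_energy_le hb h0
  refine ⟨16 * C₁ + 6 * C₂, min κ₁ κ₂, by positivity, lt_min hκ₁ hκ₂,
    fun u₀ u₁ u v h t ht k => ?_⟩
  have O₁ := H₁ _ _ (h.isOscillator_transPart h0 h1 k) t ht
  have O₂ := H₂ _ _ (h.isOscillator_longPart h0 h1) t ht
  simp only [h.initial_position, h.initial_velocity] at O₁ O₂
  filter_upwards [O₁, O₂, norm_fourier_sq_le k (u t), norm_fourier_sq_le k (v t),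
    norm_longPart_sq_le u₀, norm_longPart_sq_le u₁, norm_transPart_sq_le k u₀,
    norm_transPart_sq_le k u₁, ae_rad_pos] with ξ o₁ o₂ eu ev p₀ p₁ q₀ q₁ hpos
  obtain ⟨o₁, o₁'⟩ := o₁
  obtain ⟨o₂, o₂'⟩ := o₂
  have hD : 0 < rad ξ ^ 2 + damp θ ξ ^ 2 := by positivity
  set D := rad ξ ^ 2 + damp θ ξ ^ 2
  have hrt : 0 ≤ rate θ ξ * t := mul_nonneg (rate_nonneg θ ξ) ht
  set e := Real.exp (-(min κ₁ κ₂) * rate θ ξ * t)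
  have he : 0 < e := Real.exp_pos _
  have he₁ : Real.exp (-κ₁ * rate θ ξ * t) ≤ e := Real.exp_le_exp.2 (by
    have := mul_le_mul_of_nonneg_right (min_le_left κ₁ κ₂) hrt
    linarith)
  have he₂ : Real.exp (-κ₂ * rate θ ξ * t) ≤ e := Real.exp_le_exp.2 (by
    have := mul_le_mul_of_nonneg_right (min_le_right κ₁ κ₂) hrt
    linarith)
  have hA := specDensity_nonneg u₀ ξ
  have hB := specDensity_nonneg u₁ ξ
  set A := specDensity u₀ ξ
  set B := specDensity u₁ ξ
  set f := Real.exp (-damp θ ξ * t)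
  have hf : 0 < f := Real.exp_pos _
  have hN : 0 ≤ A + B / D := by positivity
  have d₁ : ‖transPart k (fun j => 𝓕 (u₀ j)) ξ‖ ^ 2 + ‖transPart k (fun j => 𝓕 (u₁ j)) ξ‖ ^ 2 / D
      ≤ 8 * (A + B / D) := by
    have := div_le_div_of_nonneg_right q₁ hD.le
    rw [mul_div_assoc] at this
    linarith
  have d₂ : ‖longPart (fun j => 𝓕 (u₀ j)) ξ‖ ^ 2 + ‖longPart (fun j => 𝓕 (u₁ j)) ξ‖ ^ 2 / D
      ≤ 3 * (A + B / D) := by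
    have := div_le_div_of_nonneg_right p₁ hD.le
    rw [mul_div_assoc] at this
    linarith
  constructor
  · have s₁ : ‖transPart k (fun j => 𝓕 (u t j)) ξ‖ ^ 2 ≤ C₁ * e * (8 * (A + B / D)) :=
      o₁.trans (by gcongr)
    have s₂ : ‖longPart (fun j => 𝓕 (u t j)) ξ‖ ^ 2 ≤ C₂ * e * (3 * (A + B / D)) :=
      o₂.trans (by gcongr)
    linarith
  · have s₁ := o₁'.trans (show _ ≤ C₁ * (f * (8 * B) + e * (rad ξ ^ 2 * (8 * (A + B / D)))) by
      gcongr)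
    have s₂ := o₂'.trans (show _ ≤ C₂ * (f * (3 * B) + e * (rad ξ ^ 2 * (3 * (A + B / D)))) by
      gcongr)
    have := mul_le_mul_of_nonneg_left eu (sq_nonneg (rad ξ))
    linarith

/-! ### Low-frequency mass of an `L^m` function -/

/-- The `L²` Fourier transform of an integrable function is given by the Fourier integral. -/
lemma fourier_ae_eq_of_integrable {f : L2} (hf : Integrable f) :
    ((𝓕 f : L2) : E3 → ℂ) =ᵐ[volume] 𝓕 (f : E3 → ℂ) := by
  have hcont : Continuous (𝓕 (f : E3 → ℂ)) :=
    VectorFourier.fourierIntegral_continuous Real.continuous_fourierChar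
      (by exact continuous_inner) hf
  refine ae_eq_of_integral_contDiff_smul_eq
    ((Lp.memLp (𝓕 f : L2)).locallyIntegrable (by norm_num)) hcont.locallyIntegrable
    fun g g_smooth g_cpt => ?_
  have hg₁ : HasCompactSupport (Complex.ofRealCLM ∘ g) := g_cpt.comp_left rfl
  have hg₂ := Complex.ofRealCLM.contDiff.comp g_smooth
  set G : 𝓢(E3, ℂ) := hg₁.toSchwartzMap hg₂ with hG
  have hGg : ∀ ξ, G ξ = (g ξ : ℂ) := fun ξ => rfl
  have h1 := congrArg (fun T : 𝓢'(E3, ℂ) => T G) (Lp.fourier_toTemperedDistribution_eq f)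
  simp only [TemperedDistribution.fourier_apply, Lp.toTemperedDistribution_apply] at h1
  have h2 : ∫ ξ, (𝓕 G : 𝓢(E3, ℂ)) ξ • f ξ = ∫ x, G x • 𝓕 (f : E3 → ℂ) x := by
    simpa using! VectorFourier.integral_fourierIntegral_smul_eq_flip (L := innerₗ E3)
      Real.continuous_fourierChar continuous_inner G.integrable hf
  calc ∫ x, g x • (𝓕 f : L2) x = ∫ x, G x • (𝓕 f : L2) x := by simp [hGg]
    _ = ∫ x, G x • 𝓕 (f : E3 → ℂ) x := by rw [← h1, h2]
    _ = _ := by simp [hGg]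

lemma enorm_fourier_le_of_integrable {f : L2} (hf : Integrable f) :
    ∀ᵐ ξ, ‖(𝓕 f : L2) ξ‖ₑ ≤ ∫⁻ x, ‖f x‖ₑ := by
  filter_upwards [fourier_ae_eq_of_integrable hf] with ξ e
  rw [e]
  have h := VectorFourier.norm_fourierIntegral_le_integral_norm Real.fourierChar volume
    (innerₗ E3) (f : E3 → ℂ) ξ
  rw [← ofReal_norm, ← ofReal_integral_norm_eq_lintegral_enorm hf]
  exact ENNReal.ofReal_le_ofReal h

lemma enorm_sq_eq_lintegral (f : L2) : ‖f‖ₑ ^ 2 = ∫⁻ ξ, ‖f ξ‖ₑ ^ 2 := by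
  rw [Lp.enorm_def, eLpNorm_eq_lintegral_rpow_enorm_toReal (by norm_num) (by norm_num)]
  simp only [ENNReal.toReal_ofNat, ENNReal.rpow_ofNat]
  rw [← ENNReal.rpow_natCast, ← ENNReal.rpow_mul]
  norm_num

/-- Plancherel's theorem with `∫⁻`. -/
lemma lintegral_fourier_sq (f : L2) :
    ∫⁻ ξ, ‖(𝓕 f : L2) ξ‖ₑ ^ 2 = ∫⁻ x, ‖f x‖ₑ ^ 2 := by
  rw [← enorm_sq_eq_lintegral, ← enorm_sq_eq_lintegral]
  congr 1
  rw [← ofReal_norm, ← ofReal_norm, Lp.norm_fourier_eq]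

lemma volume_rad_le {R : ℝ} (hR : 0 ≤ R) :
    volume {ξ : E3 | rad ξ ≤ R}
      ≤ ENNReal.ofReal (R ^ 3) * volume (Metric.closedBall (0 : E3) 1) := by
  have hsub : {ξ : E3 | rad ξ ≤ R} ⊆ Metric.closedBall 0 R := by
    intro ξ hξ
    rw [mem_closedBall_zero_iff]
    refine le_trans ?_ (show rad ξ ≤ R from hξ)
    unfold rad
    nlinarith [Real.pi_gt_three, norm_nonneg ξ]
  refine (measure_mono hsub).trans_eq ?_
  rw [Measure.addHaar_closedBall' volume (0 : E3) hR]
  simp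

lemma toLp_indicator_add_compl (f : L2) {s : Set E3} (hs : MeasurableSet s) :
    ((Lp.memLp f).indicator hs).toLp _ + ((Lp.memLp f).indicator hs.compl).toLp _ = f := by
  apply Lp.ext
  filter_upwards [Lp.coeFn_add (((Lp.memLp f).indicator hs).toLp _)
    (((Lp.memLp f).indicator hs.compl).toLp _), ((Lp.memLp f).indicator hs).coeFn_toLp,
    ((Lp.memLp f).indicator hs.compl).coeFn_toLp] with x e1 e2 e3
  rw [e1, Pi.add_apply, e2, e3]
  exact Set.indicator_self_add_compl_apply s (f : E3 → ℂ) x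

/-- Splitting `f` at height `l` into an integrable part, whose Fourier transform is bounded, and a
square integrable part. -/
lemma lintegral_fourier_low_le_of_height {m : ℝ} (hm₁ : 1 ≤ m) (hm₂ : m < 2) (f : L2)
    (hM : ∫⁻ x, ‖f x‖ₑ ^ m < ⊤) {R l : ℝ} (hR : 0 < R) (hl : 0 < l) :
    ∫⁻ ξ in {ξ | rad ξ ≤ R}, ‖(𝓕 f : L2) ξ‖ₑ ^ 2
      ≤ 2 * ((ENNReal.ofReal (l ^ (1 - m)) * ∫⁻ x, ‖f x‖ₑ ^ m) ^ 2
          * (ENNReal.ofReal (R ^ 3) * volume (Metric.closedBall (0 : E3) 1)))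
        + 2 * (ENNReal.ofReal (l ^ (2 - m)) * ∫⁻ x, ‖f x‖ₑ ^ m) := by
  set M := ∫⁻ x, ‖f x‖ₑ ^ m
  set s : Set E3 := {x | l < ‖f x‖} with hs_def
  have hs : MeasurableSet s :=
    measurableSet_lt measurable_const (Lp.stronglyMeasurable f).norm.measurable
  set f₁ : L2 := ((Lp.memLp f).indicator hs).toLp _ with hf₁
  set f₂ : L2 := ((Lp.memLp f).indicator hs.compl).toLp _ with hf₂
  have c₁ : (f₁ : E3 → ℂ) =ᵐ[volume] s.indicator f := ((Lp.memLp f).indicator hs).coeFn_toLp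
  have c₂ : (f₂ : E3 → ℂ) =ᵐ[volume] sᶜ.indicator f :=
    ((Lp.memLp f).indicator hs.compl).coeFn_toLp
  have hpow : ∀ x, ‖f x‖ₑ ^ m = ENNReal.ofReal (‖f x‖ ^ m) := fun x => by
    rw [← ofReal_norm, ENNReal.ofReal_rpow_of_nonneg (norm_nonneg _) (by linarith)]
  have n₁ : ∫⁻ x, ‖f₁ x‖ₑ ≤ ENNReal.ofReal (l ^ (1 - m)) * M := by
    rw [← lintegral_const_mul' _ _ ENNReal.ofReal_ne_top]
    refine lintegral_mono_ae ?_
    filter_upwards [c₁] with x e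
    rw [e]
    by_cases hx : x ∈ s
    · have hx' : l < ‖f x‖ := hx
      have h0 : 0 < ‖f x‖ := hl.trans hx'
      rw [Set.indicator_of_mem hx, hpow, ← ofReal_norm, ← ENNReal.ofReal_mul (by positivity)]
      refine ENNReal.ofReal_le_ofReal ?_
      calc ‖f x‖ = ‖f x‖ ^ (1 - m) * ‖f x‖ ^ m := by
            rw [← Real.rpow_add h0]; simp
        _ ≤ l ^ (1 - m) * ‖f x‖ ^ m := by
            gcongr ?_ * _
            exact Real.rpow_le_rpow_of_nonpos hl hx'.le (by linarith)
    · simp [Set.indicator_of_notMem hx]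
  have n₂ : ∫⁻ x, ‖f₂ x‖ₑ ^ 2 ≤ ENNReal.ofReal (l ^ (2 - m)) * M := by
    rw [← lintegral_const_mul' _ _ ENNReal.ofReal_ne_top]
    refine lintegral_mono_ae ?_
    filter_upwards [c₂] with x e
    rw [e]
    by_cases hx : x ∈ sᶜ
    · have hx' : ‖f x‖ ≤ l := not_lt.1 hx
      rw [Set.indicator_of_mem hx, hpow, ← ofReal_norm, ← ENNReal.ofReal_mul (by positivity),
        ← ENNReal.ofReal_pow (norm_nonneg _)]
      refine ENNReal.ofReal_le_ofReal ?_
      rcases (norm_nonneg (f x)).eq_or_lt with h0 | h0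
      · rw [← h0, zero_pow two_ne_zero]; positivity
      · calc ‖f x‖ ^ 2 = ‖f x‖ ^ (2 - m) * ‖f x‖ ^ m := by
              rw [← Real.rpow_add h0]; simp
          _ ≤ l ^ (2 - m) * ‖f x‖ ^ m := by
              gcongr ?_ * _
              exact Real.rpow_le_rpow h0.le hx' (by linarith)
    · simp [Set.indicator_of_notMem hx]
  have i₁ : Integrable f₁ := ⟨(Lp.stronglyMeasurable f₁).aestronglyMeasurable,
    n₁.trans_lt (ENNReal.mul_lt_top ENNReal.ofReal_lt_top hM)⟩
  have hsum : (𝓕 f : L2) = 𝓕 f₁ + 𝓕 f₂ := by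
    rw [← FourierTransform.fourier_add, hf₁, hf₂, toLp_indicator_add_compl f hs]
  have hpt : ∀ᵐ ξ, ‖(𝓕 f : L2) ξ‖ₑ ^ 2
      ≤ 2 * (ENNReal.ofReal (l ^ (1 - m)) * M) ^ 2 + 2 * ‖(𝓕 f₂ : L2) ξ‖ₑ ^ 2 := by
    rw [hsum]
    filter_upwards [Lp.coeFn_add (𝓕 f₁ : L2) (𝓕 f₂ : L2), enorm_fourier_le_of_integrable i₁]
      with ξ e h
    rw [e, Pi.add_apply]
    calc ‖(𝓕 f₁ : L2) ξ + (𝓕 f₂ : L2) ξ‖ₑ ^ 2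
        ≤ (‖(𝓕 f₁ : L2) ξ‖ₑ + ‖(𝓕 f₂ : L2) ξ‖ₑ) ^ 2 := by gcongr; exact enorm_add_le _ _
      _ ≤ 2 * ‖(𝓕 f₁ : L2) ξ‖ₑ ^ 2 + 2 * ‖(𝓕 f₂ : L2) ξ‖ₑ ^ 2 := by
          have := ENNReal.rpow_add_le_mul_rpow_add_rpow ‖(𝓕 f₁ : L2) ξ‖ₑ ‖(𝓕 f₂ : L2) ξ‖ₑ
            (p := 2) (by norm_num)
          norm_num at this
          rwa [mul_add] at this
      _ ≤ _ := by
          have := h.trans n₁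
          gcongr
  calc ∫⁻ ξ in {ξ | rad ξ ≤ R}, ‖(𝓕 f : L2) ξ‖ₑ ^ 2
      ≤ ∫⁻ ξ in {ξ | rad ξ ≤ R}, (2 * (ENNReal.ofReal (l ^ (1 - m)) * M) ^ 2
          + 2 * ‖(𝓕 f₂ : L2) ξ‖ₑ ^ 2) := lintegral_mono_ae (ae_restrict_of_ae hpt)
    _ = 2 * (ENNReal.ofReal (l ^ (1 - m)) * M) ^ 2 * volume {ξ : E3 | rad ξ ≤ R}
          + 2 * ∫⁻ ξ in {ξ | rad ξ ≤ R}, ‖(𝓕 f₂ : L2) ξ‖ₑ ^ 2 := by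
        rw [lintegral_add_left measurable_const, setLIntegral_const,
          lintegral_const_mul' _ _ (by norm_num)]
    _ ≤ 2 * (ENNReal.ofReal (l ^ (1 - m)) * M) ^ 2
          * (ENNReal.ofReal (R ^ 3) * volume (Metric.closedBall (0 : E3) 1))
          + 2 * (ENNReal.ofReal (l ^ (2 - m)) * M) := by
        gcongr
        · exact volume_rad_le hR.le
        · refine (setLIntegral_le_lintegral _ _).trans ?_
          rw [lintegral_fourier_sq]
          exact n₂
    _ = _ := by rw [mul_assoc]

/-- The constant of the Bernstein inequality. -/
def bernsteinConst : ℝ := 2 * (volume (Metric.closedBall (0 : E3) 1)).toReal + 2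

lemma bernsteinConst_pos : 0 < bernsteinConst := by unfold bernsteinConst; positivity

/-- Bernstein's inequality: the `L²` mass of `𝓕 f` at frequencies at most `R` is bounded by
`R^{6/m - 3} ‖f‖_{L^m}²`. The height of the truncation is chosen so that both parts contribute
equally. -/
lemma lintegral_fourier_low_le {m : ℝ} (hm₁ : 1 ≤ m) (hm₂ : m < 2) (f : L2)
    (hN : eLpNorm f (ENNReal.ofReal m) volume < ⊤) {R : ℝ} (hR : 0 < R) :
    ∫⁻ ξ in {ξ | rad ξ ≤ R}, ‖(𝓕 f : L2) ξ‖ₑ ^ 2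
      ≤ ENNReal.ofReal (bernsteinConst * R ^ (6 / m - 3))
        * eLpNorm f (ENNReal.ofReal m) volume ^ 2 := by
  have hm0 : 0 < m := by linarith
  have hp0 : ENNReal.ofReal m ≠ 0 := by simpa using hm0
  have hN' : eLpNorm f (ENNReal.ofReal m) volume = (∫⁻ x, ‖f x‖ₑ ^ m) ^ (1 / m) := by
    rw [eLpNorm_eq_lintegral_rpow_enorm_toReal hp0 ENNReal.ofReal_ne_top,
      ENNReal.toReal_ofReal hm0.le]
  by_cases hzero : eLpNorm f (ENNReal.ofReal m) volume = 0
  · have h0 : f = 0 := by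
      rw [eLpNorm_eq_zero_iff (Lp.stronglyMeasurable f).aestronglyMeasurable hp0] at hzero
      exact (Lp.eq_zero_iff_ae_eq_zero).2 hzero
    have h1 : ∫⁻ ξ, ‖(𝓕 f : L2) ξ‖ₑ ^ 2 = 0 := by
      rw [lintegral_fourier_sq, h0, lintegral_eq_zero_iff' (by fun_prop)]
      exact Eventually.of_forall fun x => by simp
    exact (setLIntegral_le_lintegral _ _).trans (h1.le.trans bot_le)
  rw [hN'] at hN hzero ⊢
  have hM : ∫⁻ x, ‖f x‖ₑ ^ m < ⊤ := by
    by_contra h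
    rw [not_lt_top_iff.1 h, ENNReal.top_rpow_of_pos (by positivity)] at hN
    exact lt_irrefl _ hN
  have hM0 : ∫⁻ x, ‖f x‖ₑ ^ m ≠ 0 := by
    intro h
    rw [h, ENNReal.zero_rpow_of_pos (by positivity)] at hzero
    exact hzero rfl
  set M := (∫⁻ x, ‖f x‖ₑ ^ m).toReal with hMdef
  have hMof : ∫⁻ x, ‖f x‖ₑ ^ m = ENNReal.ofReal M := (ENNReal.ofReal_toReal hM.ne).symm
  have hMpos : 0 < M := ENNReal.toReal_pos hM0 hM.ne
  have hMR : 0 < M * R ^ 3 := by positivity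
  have key := lintegral_fourier_low_le_of_height hm₁ hm₂ f hM hR
    (Real.rpow_pos_of_pos hMR (1 / m))
  refine key.trans (le_of_eq ?_)
  rw [hMof, ← ENNReal.ofReal_toReal (measure_closedBall_lt_top (μ := volume) (x := (0 : E3))
    (r := 1)).ne, ENNReal.ofReal_rpow_of_pos hMpos, ← ENNReal.ofReal_pow (by positivity),
    ← ENNReal.ofReal_mul (by positivity), ← ENNReal.ofReal_mul (by positivity),
    ← ENNReal.ofReal_mul (by positivity), ← ENNReal.ofReal_pow (by positivity),
    ← ENNReal.ofReal_mul (by positivity),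
    ← ENNReal.ofReal_mul (mul_nonneg bernsteinConst_pos.le (by positivity))]
  rw [bernsteinConst]
  have hW : 0 ≤ (volume (Metric.closedBall (0 : E3) 1)).toReal := ENNReal.toReal_nonneg
  generalize (volume (Metric.closedBall (0 : E3) 1)).toReal = W at hW ⊢
  rw [show (2 : ℝ≥0∞) = ENNReal.ofReal 2 by simp, ← ENNReal.ofReal_mul (by norm_num),
    ← ENNReal.ofReal_mul (by norm_num), ← ENNReal.ofReal_add (by positivity) (by positivity)]
  congr 1
  have hR3 : R ^ 3 = R ^ (3 : ℝ) := by norm_cast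
  have e1 : ((M * R ^ 3) ^ (1 / m)) ^ (1 - m) = M ^ (1 / m - 1) * R ^ (3 / m - 3) := by
    rw [← Real.rpow_mul hMR.le, hR3, Real.mul_rpow hMpos.le (by positivity),
      ← Real.rpow_mul hR.le]
    congr 2 <;> field_simp
  have e2 : ((M * R ^ 3) ^ (1 / m)) ^ (2 - m) = M ^ (2 / m - 1) * R ^ (6 / m - 3) := by
    rw [← Real.rpow_mul hMR.le, hR3, Real.mul_rpow hMpos.le (by positivity),
      ← Real.rpow_mul hR.le]
    congr 2 <;> field_simp
    ring
  have e3 : M ^ (1 / m - 1) * M = M ^ (1 / m) := by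
    rw [← Real.rpow_add_one hMpos.ne']; congr 1; ring
  have e4 : M ^ (2 / m - 1) * M = (M ^ (1 / m)) ^ 2 := by
    rw [← Real.rpow_add_one hMpos.ne', ← Real.rpow_natCast, ← Real.rpow_mul hMpos.le]
    congr 1; push_cast; ring
  have e5 : (R ^ (3 / m - 3)) ^ 2 * R ^ 3 = R ^ (6 / m - 3) := by
    rw [hR3, ← Real.rpow_natCast, ← Real.rpow_mul hR.le, ← Real.rpow_add hR]
    congr 1; push_cast; ring
  rw [e1, e2]
  calc _ = 2 * ((M ^ (1 / m - 1) * M) ^ 2 * ((R ^ (3 / m - 3)) ^ 2 * R ^ 3) * W)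
        + 2 * (R ^ (6 / m - 3) * (M ^ (2 / m - 1) * M)) := by ring
    _ = _ := by rw [e3, e4, e5]; ring

/-! ### Dyadic estimates for weighted integrals -/

section Dyadic

/-- The measure `μ` of frequencies at most `R` is bounded by `R^g K`. -/
structure HasLowMass (μ : Measure E3) (g : ℝ) (K : ℝ≥0∞) : Prop where
  ae_rad_pos : ∀ᵐ ξ ∂μ, 0 < rad ξ
  measure_le : ∀ R : ℝ, 0 < R → μ {ξ | rad ξ ≤ R} ≤ ENNReal.ofReal (R ^ g) * K

/-- Domination of an integral by a geometric series over dyadic balls. -/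
lemma lintegral_le_of_dyadic {μ : Measure E3} {g : ℝ} {K : ℝ≥0∞} (hμ : HasLowMass μ g K)
    {f : E3 → ℝ≥0∞} {ρ c : ℕ → ℝ} (hρ : ∀ j, 0 < ρ j) (hc : ∀ j, 0 ≤ c j)
    (hf : ∀ ξ, 0 < rad ξ → f ξ ≠ 0 → ∃ j, rad ξ ≤ ρ j ∧ f ξ ≤ ENNReal.ofReal (c j))
    {A q : ℝ} (hA : 0 ≤ A) (hq : 0 ≤ q) (hq1 : q < 1) (hcA : ∀ j, c j * ρ j ^ g ≤ A * q ^ j) :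
    ∫⁻ ξ, f ξ ∂μ ≤ ENNReal.ofReal (A * (1 - q)⁻¹) * K := by
  have hpt : ∀ᵐ ξ ∂μ, f ξ
      ≤ ∑' j, {ξ | rad ξ ≤ ρ j}.indicator (fun _ => ENNReal.ofReal (c j)) ξ := by
    filter_upwards [hμ.ae_rad_pos] with ξ hpos
    by_cases h0 : f ξ = 0
    · rw [h0]; exact bot_le
    · obtain ⟨j, hj, hfj⟩ := hf ξ hpos h0
      refine hfj.trans (le_trans (le_of_eq ?_) (ENNReal.le_tsum j))
      rw [Set.indicator_of_mem (s := {ξ | rad ξ ≤ ρ j}) hj]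
  calc ∫⁻ ξ, f ξ ∂μ
      ≤ ∫⁻ ξ, ∑' j, {ξ | rad ξ ≤ ρ j}.indicator (fun _ => ENNReal.ofReal (c j)) ξ ∂μ :=
        lintegral_mono_ae hpt
    _ = ∑' j, ENNReal.ofReal (c j) * μ {ξ | rad ξ ≤ ρ j} := by
        rw [lintegral_tsum fun j =>
          (measurable_const.indicator (measurableSet_rad_le (ρ j))).aemeasurable]
        congr 1
        ext j
        rw [lintegral_indicator_const (measurableSet_rad_le (ρ j))]
    _ ≤ ∑' j, ENNReal.ofReal A * K * ENNReal.ofReal q ^ j := by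
        refine ENNReal.tsum_le_tsum fun j => ?_
        calc ENNReal.ofReal (c j) * μ {ξ | rad ξ ≤ ρ j}
            ≤ ENNReal.ofReal (c j) * (ENNReal.ofReal (ρ j ^ g) * K) := by
              gcongr; exact hμ.measure_le _ (hρ j)
          _ = ENNReal.ofReal (c j * ρ j ^ g) * K := by
              rw [← mul_assoc, ENNReal.ofReal_mul (hc j)]
          _ ≤ ENNReal.ofReal (A * q ^ j) * K := by
              gcongr ENNReal.ofReal ?_ * _
              exact hcA j
          _ = _ := by rw [ENNReal.ofReal_mul hA, ENNReal.ofReal_pow hq]; ring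
    _ = _ := by
        rw [ENNReal.tsum_mul_left, ENNReal.tsum_geometric, ENNReal.ofReal_mul hA,
          ENNReal.ofReal_inv_of_pos (by linarith), ENNReal.ofReal_sub _ hq, ENNReal.ofReal_one]
        ring

/-- Integration of `|ξ|^σ` over a ball, in the integrable range `σ + g > 0`. -/
lemma exists_lintegral_low_le {g σ : ℝ} (hσ : 0 < σ + g) :
    ∃ C : ℝ, 0 < C ∧ ∀ (μ : Measure E3) (K : ℝ≥0∞), HasLowMass μ g K → ∀ R : ℝ, 0 < R →
      ∫⁻ ξ in {ξ | rad ξ ≤ R}, ENNReal.ofReal (rad ξ ^ σ) ∂μ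
        ≤ ENNReal.ofReal (C * R ^ (σ + g)) * K := by
  set q : ℝ := (1 / 2) ^ (σ + g) with hq
  have hq0 : 0 < q := Real.rpow_pos_of_pos (by norm_num) _
  have hq1 : q < 1 := Real.rpow_lt_one (by norm_num) (by norm_num) hσ
  set D : ℝ := 1 + (1 / 2) ^ σ with hD
  have hD0 : 0 < D := by positivity
  have h1q : 0 < 1 - q := by linarith
  refine ⟨D * (1 - q)⁻¹, by positivity, fun μ K hμ R hR => ?_⟩
  rw [← lintegral_indicator (measurableSet_rad_le R)]
  set ρ : ℕ → ℝ := fun j => R * (1 / 2) ^ j with hρ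
  have hρ0 : ∀ j, 0 < ρ j := fun j => by positivity
  refine (lintegral_le_of_dyadic hμ (ρ := ρ) (c := fun j => D * ρ j ^ σ) (A := D * R ^ (σ + g))
    (q := q) hρ0 (fun j => by have := hρ0 j; positivity) ?_ (by positivity) hq0.le hq1 ?_).trans_eq
    ?_
  · intro ξ hpos hne
    have hξ : rad ξ ≤ R := by
      by_contra h
      exact hne (Set.indicator_of_notMem (s := {ξ | rad ξ ≤ R}) h _)
    rw [Set.indicator_of_mem (s := {ξ | rad ξ ≤ R}) hξ]
    -- the dyadic shell `ρ j / 2 < rad ξ ≤ ρ j`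
    obtain ⟨j, hj1, hj2⟩ := exists_nat_pow_near_of_lt_one (x := rad ξ / R) (y := 1 / 2)
      (by positivity) ((div_le_one hR).2 hξ) (by norm_num) (by norm_num)
    refine ⟨j, ?_, ENNReal.ofReal_le_ofReal ?_⟩
    · rw [div_le_iff₀ hR] at hj2
      linarith
    · rw [lt_div_iff₀ hR, pow_succ] at hj1
      rw [div_le_iff₀ hR] at hj2
      have l1 : 1 / 2 * ρ j ≤ rad ξ := by simp only [hρ]; linarith
      have l2 : rad ξ ≤ ρ j := by simp only [hρ]; linarith
      have p1 : 0 ≤ (1 / 2 : ℝ) ^ σ * ρ j ^ σ := by have := hρ0 j; positivity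
      have p2 : 0 ≤ ρ j ^ σ := by have := hρ0 j; positivity
      rw [hD, add_mul, one_mul]
      rcases le_total 0 σ with h | h
      · have := Real.rpow_le_rpow hpos.le l2 h
        linarith
      · have := Real.rpow_le_rpow_of_nonpos (by have := hρ0 j; positivity) l1 h
        rw [Real.mul_rpow (by norm_num) (hρ0 j).le] at this
        linarith
  · intro j
    simp only [hρ]
    rw [mul_assoc, ← Real.rpow_add (by positivity), Real.mul_rpow hR.le (by positivity), hq,
      ← Real.rpow_natCast, ← Real.rpow_natCast, ← Real.rpow_mul (by norm_num),
      ← Real.rpow_mul (by norm_num), mul_comm (j : ℝ), mul_assoc]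
  · congr 2; ring

/-- Integration of a fixed integrable power outside a ball. -/
lemma lintegral_high_le {g : ℝ} {μ : Measure E3} {K : ℝ≥0∞} (hμ : HasLowMass μ g K)
    (hg : 0 ≤ g) {R : ℝ} (hR : 0 < R) :
    ∫⁻ ξ in {ξ | R ≤ rad ξ}, ENNReal.ofReal (rad ξ ^ (-(g + 1))) ∂μ
      ≤ ENNReal.ofReal (2 ^ (g + 1) * R⁻¹) * K := by
  have hms : MeasurableSet {ξ | R ≤ rad ξ} := measurableSet_le measurable_const measurable_rad
  rw [← lintegral_indicator hms]
  set ρ : ℕ → ℝ := fun j => R * 2 ^ (j + 1) with hρ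
  have hρ0 : ∀ j, 0 < ρ j := fun j => by positivity
  refine (lintegral_le_of_dyadic hμ (ρ := ρ) (c := fun j => (R * 2 ^ j) ^ (-(g + 1)))
    (A := 2 ^ g * R⁻¹) (q := 1 / 2) hρ0 (fun j => by positivity) ?_ (by positivity) (by norm_num)
    (by norm_num) ?_).trans_eq ?_
  · intro ξ hpos hne
    have hξ : R ≤ rad ξ := by
      by_contra h
      exact hne (Set.indicator_of_notMem (s := {ξ | R ≤ rad ξ}) h _)
    rw [Set.indicator_of_mem (s := {ξ | R ≤ rad ξ}) hξ]
    obtain ⟨j, hj1, hj2⟩ := exists_nat_pow_near (x := rad ξ / R) (y := 2)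
      ((one_le_div hR).2 hξ) (by norm_num)
    rw [div_lt_iff₀ hR] at hj2
    rw [le_div_iff₀ hR] at hj1
    refine ⟨j, by simp only [hρ]; linarith, ENNReal.ofReal_le_ofReal ?_⟩
    exact Real.rpow_le_rpow_of_nonpos (by positivity) (by linarith) (by linarith)
  · intro j
    refine le_of_eq ?_
    simp only [hρ]
    have e1 : R * 2 ^ (j + 1) = (R * 2 ^ j) * 2 := by ring
    have hx : 0 < R * 2 ^ j := by positivity
    rw [e1, Real.mul_rpow hx.le (by norm_num), ← mul_assoc, ← Real.rpow_add hx]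
    have e2 : -(g + 1) + g = -1 := by ring
    rw [e2, Real.rpow_neg_one, mul_inv, one_div, inv_pow]
    ring
  · congr 2
    rw [Real.rpow_add_one (by norm_num)]
    norm_num
    ring

/-- Exponentials dominate powers. -/
lemma exists_rpow_le_mul_exp (α : ℝ) {κ p : ℝ} (hκ : 0 < κ) (hp : 0 < p) :
    ∃ C : ℝ, 0 < C ∧ ∀ x : ℝ, 1 ≤ x → x ^ α ≤ C * Real.exp (κ * x ^ p) := by
  obtain ⟨n, hn⟩ := exists_nat_ge (α / p)
  refine ⟨n.factorial / κ ^ n, by positivity, fun x hx => ?_⟩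
  have hx0 : 0 < x := by linarith
  have hxp : 1 ≤ x ^ p := Real.one_le_rpow hx hp.le
  have h1 : x ^ α ≤ (x ^ p) ^ n := by
    rw [← Real.rpow_natCast, ← Real.rpow_mul hx0.le]
    refine Real.rpow_le_rpow_of_exponent_le hx ?_
    rw [div_le_iff₀ hp] at hn
    linarith
  have h2 := Real.pow_div_factorial_le_exp (κ * x ^ p) (by positivity) n
  rw [mul_pow, div_le_iff₀ (by positivity)] at h2
  rw [div_mul_eq_mul_div, le_div_iff₀ (by positivity)]
  calc x ^ α * κ ^ n ≤ (x ^ p) ^ n * κ ^ n := by gcongr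
    _ ≤ _ := by linarith

/-- The part `|ξ| ≥ T^{-1/p}` of the integral of `|ξ|^σ exp (-κ |ξ|^p T)`. -/
lemma exists_lintegral_exp_high_le {g : ℝ} (hg : 0 ≤ g) (σ : ℝ) {κ p : ℝ} (hκ : 0 < κ)
    (hp : 0 < p) :
    ∃ C : ℝ, 0 < C ∧ ∀ (μ : Measure E3) (K : ℝ≥0∞), HasLowMass μ g K → ∀ T : ℝ, 0 < T →
      ∫⁻ ξ in {ξ | T ^ (-(1 / p)) ≤ rad ξ},
          ENNReal.ofReal (rad ξ ^ σ * Real.exp (-κ * rad ξ ^ p * T)) ∂μ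
        ≤ ENNReal.ofReal (C * T ^ (-((σ + g) / p))) * K := by
  obtain ⟨C, hC, H⟩ := exists_rpow_le_mul_exp (σ + g + 1) hκ hp
  refine ⟨C * 2 ^ (g + 1), by positivity, fun μ K hμ T hT => ?_⟩
  set R := T ^ (-(1 / p)) with hRdef
  have hR : 0 < R := Real.rpow_pos_of_pos hT _
  have hRp : R ^ p = T⁻¹ := by
    rw [hRdef, ← Real.rpow_mul hT.le, ← Real.rpow_neg_one]
    congr 1
    field_simp
  have hms : MeasurableSet {ξ | R ≤ rad ξ} := measurableSet_le measurable_const measurable_rad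
  calc ∫⁻ ξ in {ξ | R ≤ rad ξ}, ENNReal.ofReal (rad ξ ^ σ * Real.exp (-κ * rad ξ ^ p * T)) ∂μ
      ≤ ∫⁻ ξ in {ξ | R ≤ rad ξ}, ENNReal.ofReal (C * R ^ (σ + g + 1))
          * ENNReal.ofReal (rad ξ ^ (-(g + 1))) ∂μ := by
        refine setLIntegral_mono' hms fun ξ hξ => ?_
        have hξ' : R ≤ rad ξ := hξ
        have hr : 0 < rad ξ := hR.trans_le hξ'
        rw [← ENNReal.ofReal_mul (by positivity)]
        refine ENNReal.ofReal_le_ofReal ?_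
        have h1 := H (rad ξ / R) ((one_le_div hR).2 hξ')
        rw [Real.div_rpow hr.le hR.le, Real.div_rpow hr.le hR.le, hRp, div_inv_eq_mul,
          div_le_iff₀ (by positivity)] at h1
        have e1 : rad ξ ^ σ = rad ξ ^ (σ + g + 1) * rad ξ ^ (-(g + 1)) := by
          rw [← Real.rpow_add hr]; congr 1; ring
        have e2 : Real.exp (-κ * rad ξ ^ p * T) = (Real.exp (κ * (rad ξ ^ p * T)))⁻¹ := by
          rw [← Real.exp_neg]; congr 1; ring
        rw [e1, e2, ← div_eq_mul_inv, div_le_iff₀ (Real.exp_pos _)]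
        have h2 := mul_le_mul_of_nonneg_right h1
          (show 0 ≤ rad ξ ^ (-(g + 1)) by positivity)
        linarith
    _ = ENNReal.ofReal (C * R ^ (σ + g + 1))
          * ∫⁻ ξ in {ξ | R ≤ rad ξ}, ENNReal.ofReal (rad ξ ^ (-(g + 1))) ∂μ :=
        lintegral_const_mul' _ _ ENNReal.ofReal_ne_top
    _ ≤ ENNReal.ofReal (C * R ^ (σ + g + 1)) * (ENNReal.ofReal (2 ^ (g + 1) * R⁻¹) * K) := by
        gcongr
        exact lintegral_high_le hμ hg hR
    _ = _ := by
        rw [← mul_assoc, ← ENNReal.ofReal_mul (by positivity)]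
        congr 2
        have e : T ^ (-((σ + g) / p)) = R ^ (σ + g) := by
          rw [hRdef, ← Real.rpow_mul hT.le]; congr 1; ring
        rw [e, Real.rpow_add_one hR.ne']
        field_simp

/-- The basic low-frequency estimate: the integral of `|ξ|^σ exp (-κ |ξ|^p T)` decays as
`T^{-(σ + g)/p}`. -/
lemma exists_lintegral_exp_le {g : ℝ} (hg : 0 ≤ g) {σ : ℝ} (hσ : 0 < σ + g) {κ p : ℝ} (hκ : 0 < κ)
    (hp : 0 < p) :
    ∃ C : ℝ, 0 < C ∧ ∀ (μ : Measure E3) (K : ℝ≥0∞), HasLowMass μ g K → ∀ T : ℝ, 0 < T →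
      ∫⁻ ξ, ENNReal.ofReal (rad ξ ^ σ * Real.exp (-κ * rad ξ ^ p * T)) ∂μ
        ≤ ENNReal.ofReal (C * T ^ (-((σ + g) / p))) * K := by
  obtain ⟨C₁, hC₁, H₁⟩ := exists_lintegral_exp_high_le hg σ hκ hp
  obtain ⟨C₂, hC₂, H₂⟩ := exists_lintegral_low_le hσ
  refine ⟨C₁ + C₂, by positivity, fun μ K hμ T hT => ?_⟩
  set R := T ^ (-(1 / p)) with hRdef
  have hR : 0 < R := Real.rpow_pos_of_pos hT _
  have e : R ^ (σ + g) = T ^ (-((σ + g) / p)) := by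
    rw [hRdef, ← Real.rpow_mul hT.le]; congr 1; ring
  have hcov : (Set.univ : Set E3) ⊆ {ξ | R ≤ rad ξ} ∪ {ξ | rad ξ ≤ R} :=
    fun ξ _ => le_total R (rad ξ)
  calc ∫⁻ ξ, ENNReal.ofReal (rad ξ ^ σ * Real.exp (-κ * rad ξ ^ p * T)) ∂μ
      ≤ ∫⁻ ξ in {ξ | R ≤ rad ξ} ∪ {ξ | rad ξ ≤ R},
          ENNReal.ofReal (rad ξ ^ σ * Real.exp (-κ * rad ξ ^ p * T)) ∂μ := by
        rw [← setLIntegral_univ]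
        exact lintegral_mono_set hcov
    _ ≤ _ := lintegral_union_le _ _ _
    _ ≤ ENNReal.ofReal (C₁ * T ^ (-((σ + g) / p))) * K
          + ENNReal.ofReal (C₂ * T ^ (-((σ + g) / p))) * K := by
        refine add_le_add (H₁ μ K hμ T hT) ?_
        rw [← e]
        refine le_trans (lintegral_mono fun ξ => ENNReal.ofReal_le_ofReal ?_) (H₂ μ K hμ R hR)
        have h1 : Real.exp (-κ * rad ξ ^ p * T) ≤ 1 := by
          rw [Real.exp_le_one_iff]
          have := Real.rpow_nonneg (rad_nonneg ξ) p
          have : 0 ≤ κ * rad ξ ^ p * T := by positivity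
          linarith
        exact mul_le_of_le_one_right (Real.rpow_nonneg (rad_nonneg ξ) _) h1
    _ = _ := by
        rw [← add_mul, ← ENNReal.ofReal_add (by positivity) (by positivity)]
        congr 2; ring

end Dyadic

/-! ### The data on the Fourier side -/

lemma measurable_specDensity (f : Fin 3 → L2) : Measurable (specDensity f) := by
  unfold specDensity
  exact Finset.measurable_fun_sum _ fun j _ =>
    ((Lp.stronglyMeasurable (𝓕 (f j) : L2)).norm.measurable.pow_const 2)

lemma ofReal_norm_sq (z : ℂ) : ENNReal.ofReal (‖z‖ ^ 2) = ‖z‖ₑ ^ 2 := by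
  rw [ENNReal.ofReal_pow (norm_nonneg _), ofReal_norm]

lemma ofReal_specDensity (f : Fin 3 → L2) (ξ : E3) :
    ENNReal.ofReal (specDensity f ξ) = ∑ j, ‖(𝓕 (f j) : L2) ξ‖ₑ ^ 2 := by
  rw [specDensity, ENNReal.ofReal_sum_of_nonneg fun _ _ => by positivity]
  simp only [ofReal_norm_sq]

lemma measurable_enorm_fourier_sq (f : L2) : Measurable fun ξ => ‖(𝓕 f : L2) ξ‖ₑ ^ 2 :=
  (Lp.stronglyMeasurable (𝓕 f : L2)).enorm.pow_const 2

/-- The spectral measure `∑ⱼ (|𝓕 u₀ⱼ|² + |𝓕 u₁ⱼ|²) dξ` of the data. -/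
def dataMeasure (u₀ u₁ : Fin 3 → L2) : Measure E3 :=
  volume.withDensity fun ξ => ENNReal.ofReal (specDensity u₀ ξ + specDensity u₁ ξ)

lemma lintegral_dataMeasure (u₀ u₁ : Fin 3 → L2) {w : E3 → ℝ} (hw : Measurable w)
    (hw0 : ∀ ξ, 0 ≤ w ξ) {S : Set E3} (hS : MeasurableSet S) :
    ∫⁻ ξ in S, ENNReal.ofReal (w ξ) ∂(dataMeasure u₀ u₁)
      = ∫⁻ ξ in S, ENNReal.ofReal (w ξ * (specDensity u₀ ξ + specDensity u₁ ξ)) := by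
  have hm : Measurable fun ξ => ENNReal.ofReal (specDensity u₀ ξ + specDensity u₁ ξ) :=
    ((measurable_specDensity u₀).add (measurable_specDensity u₁)).ennreal_ofReal
  rw [dataMeasure, restrict_withDensity hS,
    lintegral_withDensity_eq_lintegral_mul _ hm hw.ennreal_ofReal]
  refine lintegral_congr fun ξ => ?_
  rw [Pi.mul_apply, ENNReal.ofReal_mul (hw0 ξ), mul_comm]

lemma sum_sq_add_sum_sq_le {x y z : Fin 3 → ℝ≥0∞} (h : ∀ j, x j + y j ≤ z j) :
    ∑ j, x j ^ 2 + ∑ j, y j ^ 2 ≤ (∑ j, z j) ^ 2 := by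
  have h1 : ∀ p q : ℝ≥0∞, p ^ 2 + q ^ 2 ≤ (p + q) ^ 2 := fun p q => by
    rw [show (p + q) ^ 2 = p ^ 2 + q ^ 2 + 2 * (p * q) by ring]
    exact le_self_add
  calc ∑ j, x j ^ 2 + ∑ j, y j ^ 2 = ∑ j, (x j ^ 2 + y j ^ 2) := Finset.sum_add_distrib.symm
    _ ≤ ∑ j, z j ^ 2 := Finset.sum_le_sum fun j _ => (h1 _ _).trans (by gcongr; exact h j)
    _ ≤ (∑ j, z j) ^ 2 := by
        simp only [Fin.sum_univ_three]
        exact (add_le_add_left (h1 _ _) _).trans (h1 _ _)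

/-- The total norm of the data. -/
def totalNorm (m s : ℝ) (u₀ u₁ : Fin 3 → L2) : ℝ≥0∞ := ∑ j, dataNorm m s (u₀ j) (u₁ j)

lemma eLpNorm_add_eLpNorm_le_dataNorm (m s : ℝ) (f g : L2) :
    eLpNorm f (ENNReal.ofReal m) volume + eLpNorm g (ENNReal.ofReal m) volume
      ≤ dataNorm m s f g := by
  rw [dataNorm, add_right_comm (sobolevNorm (s + 1) f)]
  gcongr
  exact le_add_self

lemma sobolevNorm_add_sobolevNorm_le_dataNorm (m s : ℝ) (f g : L2) :
    sobolevNorm (s + 1) f + sobolevNorm s g ≤ dataNorm m s f g := by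
  rw [dataNorm]
  refine le_trans ?_ le_self_add
  gcongr
  exact le_self_add

lemma hasLowMass_dataMeasure {m s : ℝ} (hm₁ : 1 ≤ m) (hm₂ : m < 2) {u₀ u₁ : Fin 3 → L2}
    (hD : totalNorm m s u₀ u₁ ≠ ⊤) :
    HasLowMass (dataMeasure u₀ u₁) (6 / m - 3)
      (ENNReal.ofReal bernsteinConst * totalNorm m s u₀ u₁ ^ 2) := by
  have hfin : ∀ j, dataNorm m s (u₀ j) (u₁ j) < ⊤ := fun j =>
    (Finset.single_le_sum (f := fun j => dataNorm m s (u₀ j) (u₁ j)) (fun _ _ => bot_le)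
      (Finset.mem_univ j)).trans_lt hD.lt_top
  have hf₀ : ∀ j, eLpNorm (u₀ j) (ENNReal.ofReal m) volume < ⊤ := fun j =>
    (le_self_add.trans (eLpNorm_add_eLpNorm_le_dataNorm m s _ _)).trans_lt (hfin j)
  have hf₁ : ∀ j, eLpNorm (u₁ j) (ENNReal.ofReal m) volume < ⊤ := fun j =>
    (le_add_self.trans (eLpNorm_add_eLpNorm_le_dataNorm m s _ _)).trans_lt (hfin j)
  refine ⟨(withDensity_absolutelyContinuous _ _).ae_le ae_rad_pos, fun R hR => ?_⟩
  rw [dataMeasure, withDensity_apply _ (measurableSet_rad_le R)]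
  have e : ∀ ξ, ENNReal.ofReal (specDensity u₀ ξ + specDensity u₁ ξ)
      = ∑ j, ‖(𝓕 (u₀ j) : L2) ξ‖ₑ ^ 2 + ∑ j, ‖(𝓕 (u₁ j) : L2) ξ‖ₑ ^ 2 := fun ξ => by
    rw [ENNReal.ofReal_add (specDensity_nonneg _ _) (specDensity_nonneg _ _),
      ofReal_specDensity, ofReal_specDensity]
  simp only [e]
  rw [lintegral_add_left (Finset.measurable_fun_sum _ fun j _ => measurable_enorm_fourier_sq _),
    lintegral_finsetSum _ fun j _ => measurable_enorm_fourier_sq _,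
    lintegral_finsetSum _ fun j _ => measurable_enorm_fourier_sq _]
  calc _ ≤ ∑ j, ENNReal.ofReal (bernsteinConst * R ^ (6 / m - 3))
            * eLpNorm (u₀ j) (ENNReal.ofReal m) volume ^ 2
          + ∑ j, ENNReal.ofReal (bernsteinConst * R ^ (6 / m - 3))
            * eLpNorm (u₁ j) (ENNReal.ofReal m) volume ^ 2 := by
        gcongr with j _ j _
        · exact lintegral_fourier_low_le hm₁ hm₂ _ (hf₀ j) hR
        · exact lintegral_fourier_low_le hm₁ hm₂ _ (hf₁ j) hR
    _ = ENNReal.ofReal (bernsteinConst * R ^ (6 / m - 3))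
          * (∑ j, eLpNorm (u₀ j) (ENNReal.ofReal m) volume ^ 2
          + ∑ j, eLpNorm (u₁ j) (ENNReal.ofReal m) volume ^ 2) := by
        rw [mul_add, Finset.mul_sum, Finset.mul_sum]
    _ ≤ ENNReal.ofReal (bernsteinConst * R ^ (6 / m - 3)) * totalNorm m s u₀ u₁ ^ 2 := by
        gcongr
        exact sum_sq_add_sum_sq_le fun j => eLpNorm_add_eLpNorm_le_dataNorm m s _ _
    _ = _ := by
        rw [ENNReal.ofReal_mul bernsteinConst_pos.le]
        ring

lemma sobolevNorm_sq (σ : ℝ) (f : L2) : sobolevNorm σ f ^ 2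
    = ∫⁻ ξ, ENNReal.ofReal ((1 + rad ξ ^ 2) ^ σ) * ‖(𝓕 f : L2) ξ‖ₑ ^ 2 := by
  rw [sobolevNorm, ← ENNReal.rpow_natCast, ← ENNReal.rpow_mul]
  norm_num
  rfl

lemma rieszNorm_sq (σ : ℝ) (f : L2) : rieszNorm σ f ^ 2
    = ∫⁻ ξ, ENNReal.ofReal (rad ξ ^ (2 * σ)) * ‖(𝓕 f : L2) ξ‖ₑ ^ 2 := by
  rw [rieszNorm, ← ENNReal.rpow_natCast, ← ENNReal.rpow_mul]
  norm_num
  rfl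

lemma enorm_sq_eq_lintegral_fourier (f : L2) : ‖f‖ₑ ^ 2 = ∫⁻ ξ, ‖(𝓕 f : L2) ξ‖ₑ ^ 2 := by
  rw [lintegral_fourier_sq, enorm_sq_eq_lintegral]

/-- The high-frequency density `|ξ|^{2s+2} ∑ⱼ |𝓕 u₀ⱼ|² + |ξ|^{2s} ∑ⱼ |𝓕 u₁ⱼ|²`. -/
def highDensity (s : ℝ) (u₀ u₁ : Fin 3 → L2) (ξ : E3) : ℝ :=
  rad ξ ^ (2 * (s + 1)) * specDensity u₀ ξ + rad ξ ^ (2 * s) * specDensity u₁ ξ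

lemma highDensity_nonneg (s : ℝ) (u₀ u₁ : Fin 3 → L2) (ξ : E3) : 0 ≤ highDensity s u₀ u₁ ξ := by
  have := rad_nonneg ξ
  have := specDensity_nonneg u₀ ξ
  have := specDensity_nonneg u₁ ξ
  unfold highDensity
  positivity

lemma rad_rpow_le (ξ : E3) {σ : ℝ} (hσ : 0 ≤ σ) : rad ξ ^ (2 * σ) ≤ (1 + rad ξ ^ 2) ^ σ := by
  rw [Real.rpow_mul (rad_nonneg ξ), Real.rpow_two]
  gcongr
  linarith

lemma lintegral_rad_specDensity_le {σ : ℝ} (hσ : 0 ≤ σ) (f : Fin 3 → L2) :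
    ∫⁻ ξ, ENNReal.ofReal (rad ξ ^ (2 * σ) * specDensity f ξ) ≤ ∑ j, sobolevNorm σ (f j) ^ 2 := by
  have hm : ∀ j, Measurable fun ξ => ENNReal.ofReal ((1 + rad ξ ^ 2) ^ σ)
      * ‖(𝓕 (f j) : L2) ξ‖ₑ ^ 2 := fun j =>
    (by fun_prop : Measurable fun ξ => (1 + rad ξ ^ 2) ^ σ).ennreal_ofReal.mul
      (measurable_enorm_fourier_sq _)
  simp only [sobolevNorm_sq]
  rw [← lintegral_finsetSum _ fun j _ => hm j]
  refine lintegral_mono fun ξ => ?_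
  rw [ENNReal.ofReal_mul (Real.rpow_nonneg (rad_nonneg ξ) _), ofReal_specDensity, Finset.mul_sum]
  gcongr
  exact rad_rpow_le ξ hσ

lemma lintegral_highDensity_le {m s : ℝ} (hs : 0 ≤ s) (u₀ u₁ : Fin 3 → L2) :
    ∫⁻ ξ, ENNReal.ofReal (highDensity s u₀ u₁ ξ) ≤ totalNorm m s u₀ u₁ ^ 2 := by
  have h1 : ∀ ξ, ENNReal.ofReal (highDensity s u₀ u₁ ξ)
      = ENNReal.ofReal (rad ξ ^ (2 * (s + 1)) * specDensity u₀ ξ)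
        + ENNReal.ofReal (rad ξ ^ (2 * s) * specDensity u₁ ξ) := fun ξ =>
    ENNReal.ofReal_add (mul_nonneg (Real.rpow_nonneg (rad_nonneg ξ) _) (specDensity_nonneg _ _))
      (mul_nonneg (Real.rpow_nonneg (rad_nonneg ξ) _) (specDensity_nonneg _ _))
  have hm : Measurable fun ξ => ENNReal.ofReal (rad ξ ^ (2 * (s + 1)) * specDensity u₀ ξ) :=
    ((by fun_prop : Measurable fun ξ => rad ξ ^ (2 * (s + 1))).mul
      (measurable_specDensity u₀)).ennreal_ofReal
  simp only [h1]
  rw [lintegral_add_left hm]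
  exact (add_le_add (lintegral_rad_specDensity_le (by linarith) u₀)
    (lintegral_rad_specDensity_le hs u₁)).trans
    (sum_sq_add_sum_sq_le fun j => sobolevNorm_add_sobolevNorm_le_dataNorm m s _ _)

/-! ### Pointwise decay at high and low frequencies -/

lemma one_le_damp {θ : ℝ} (h0 : 0 ≤ θ) {ξ : E3} (h : 1 ≤ rad ξ) : 1 ≤ damp θ ξ :=
  Real.one_le_rpow h (by linarith)

lemma one_half_le_rate {θ : ℝ} (h0 : 0 ≤ θ) (h1 : θ ≤ 1) {ξ : E3} (h : 1 ≤ rad ξ) :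
    1 / 2 ≤ rate θ ξ := by
  have d1 := one_le_damp h0 h
  have d2 : damp θ ξ ≤ rad ξ ^ 2 := by
    rw [← Real.rpow_two]
    exact Real.rpow_le_rpow_of_exponent_le h (by linarith)
  rw [rate, le_div_iff₀ (by positivity)]
  nlinarith [sq_nonneg (rad ξ)]

/-- The exponent `p` such that `rate θ ξ` behaves as `|ξ|^p` at low frequencies. -/
def lowExp (θ : ℝ) : ℝ := max (2 * θ) (2 - 2 * θ)

/-- The exponent `q` such that `|ξ|² + |ξ|^{4θ}` behaves as `|ξ|^q` at low frequencies. -/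
def lowOrder (θ : ℝ) : ℝ := min 2 (4 * θ)

lemma lowExp_pos (θ : ℝ) : 0 < lowExp θ := by
  rcases le_total θ (1 / 2) with h | h
  · exact lt_max_of_lt_right (by linarith)
  · exact lt_max_of_lt_left (by linarith)

lemma lowOrder_nonneg {θ : ℝ} (h0 : 0 ≤ θ) : 0 ≤ lowOrder θ := le_min (by norm_num) (by linarith)

lemma rpow_lowExp_le {θ : ℝ} {ξ : E3} (h : 0 < rad ξ) (h' : rad ξ ≤ 1) :
    rad ξ ^ lowExp θ ≤ 2 * rate θ ξ := by
  have hd := damp_pos θ h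
  rw [rate, mul_div_assoc', le_div_iff₀ (by positivity)]
  rcases le_total θ (1 / 2) with hθ | hθ
  · have e1 : rad ξ ≤ damp θ ξ := by
      conv_lhs => rw [← Real.rpow_one (rad ξ)]
      exact Real.rpow_le_rpow_of_exponent_ge h h' (by linarith)
    have e2 : rad ξ ^ lowExp θ * damp θ ξ = rad ξ ^ 2 := by
      rw [lowExp, max_eq_right (by linarith), damp, ← Real.rpow_add h, ← Real.rpow_two]
      congr 1; ring
    have e3 : rad ξ ^ 2 ≤ damp θ ξ ^ 2 := by gcongr
    have e4 : 0 ≤ rad ξ ^ lowExp θ := by positivity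
    calc rad ξ ^ lowExp θ * (rad ξ ^ 2 + damp θ ξ ^ 2)
        ≤ rad ξ ^ lowExp θ * (damp θ ξ ^ 2 + damp θ ξ ^ 2) := by gcongr
      _ = 2 * (rad ξ ^ lowExp θ * damp θ ξ * damp θ ξ) := by ring
      _ = _ := by rw [e2]; ring
  · have e1 : damp θ ξ ≤ rad ξ := by
      conv_rhs => rw [← Real.rpow_one (rad ξ)]
      exact Real.rpow_le_rpow_of_exponent_ge h h' (by linarith)
    rw [lowExp, max_eq_left (by linarith)]
    change damp θ ξ * _ ≤ _
    have e3 : damp θ ξ ^ 2 ≤ rad ξ ^ 2 := by gcongr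
    nlinarith

lemma inv_le_rpow_lowOrder {θ : ℝ} {ξ : E3} (h : 0 < rad ξ) :
    (rad ξ ^ 2 + damp θ ξ ^ 2)⁻¹ ≤ rad ξ ^ (-lowOrder θ) := by
  have hd := damp_pos θ h
  rw [Real.rpow_neg h.le]
  refine inv_anti₀ (by positivity) ?_
  rcases le_total (2 : ℝ) (4 * θ) with hθ | hθ
  · rw [lowOrder, min_eq_left hθ, Real.rpow_two]
    nlinarith
  · have e : damp θ ξ ^ 2 = rad ξ ^ (4 * θ) := by
      rw [damp, ← Real.rpow_two, ← Real.rpow_mul h.le]; congr 1; ring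
    rw [lowOrder, min_eq_right hθ, e]
    nlinarith [sq_nonneg (rad ξ)]

/-- At low frequencies the time may be shifted by one at the cost of a constant. -/
lemma exp_rate_le {θ κ t : ℝ} (hκ : 0 < κ) (ht : 0 ≤ t) {ξ : E3} (h : 0 < rad ξ) (h' : rad ξ ≤ 1) :
    Real.exp (-κ * rate θ ξ * t)
      ≤ Real.exp κ * Real.exp (-(κ / 2) * rad ξ ^ lowExp θ * (1 + t)) := by
  rw [← Real.exp_add, Real.exp_le_exp]
  have h1 := mul_le_mul_of_nonneg_right (rpow_lowExp_le (θ := θ) h h')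
    (show 0 ≤ κ / 2 * t by positivity)
  have h2 : rad ξ ^ lowExp θ ≤ 1 := Real.rpow_le_one h.le h' (lowExp_pos θ).le
  have h3 := mul_le_mul_of_nonneg_left h2 hκ.le
  nlinarith

lemma exp_damp_le {θ t : ℝ} (h0 : 0 ≤ θ) {ξ : E3} (h' : rad ξ ≤ 1) :
    Real.exp (-damp θ ξ * t) ≤ Real.exp 1 * Real.exp (-1 * rad ξ ^ (2 * θ) * (1 + t)) := by
  rw [← Real.exp_add, Real.exp_le_exp]
  have h2 : rad ξ ^ (2 * θ) ≤ 1 := Real.rpow_le_one (rad_nonneg ξ) h' (by linarith)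
  rw [damp]
  linarith

lemma add_div_le_rpow_mul {θ A B : ℝ} (h0 : 0 ≤ θ) (hA : 0 ≤ A) (hB : 0 ≤ B) {ξ : E3}
    (h : 0 < rad ξ) (h' : rad ξ ≤ 1) :
    A + B / (rad ξ ^ 2 + damp θ ξ ^ 2) ≤ rad ξ ^ (-lowOrder θ) * (A + B) := by
  have h1 : 1 ≤ rad ξ ^ (-lowOrder θ) :=
    Real.one_le_rpow_of_pos_of_le_one_of_nonpos h h' (by have := lowOrder_nonneg h0; linarith)
  have h2 := mul_le_mul_of_nonneg_left (inv_le_rpow_lowOrder (θ := θ) h) hB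
  rw [div_eq_mul_inv]
  nlinarith

/-- The `L²`-weight that the low-frequency estimate of the solution produces. -/
def lowWeightZero (κ θ t : ℝ) (ξ : E3) : ℝ :=
  rad ξ ^ (-lowOrder θ) * Real.exp (-(κ / 2) * rad ξ ^ lowExp θ * (1 + t))

lemma low_zero_le {θ κ t A B : ℝ} (h0 : 0 ≤ θ) (hκ : 0 < κ) (ht : 0 ≤ t) (hA : 0 ≤ A)
    (hB : 0 ≤ B) {ξ : E3} (h : 0 < rad ξ) (h' : rad ξ ≤ 1) :
    Real.exp (-κ * rate θ ξ * t) * (A + B / (rad ξ ^ 2 + damp θ ξ ^ 2))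
      ≤ Real.exp κ * (lowWeightZero κ θ t ξ * (A + B)) := by
  have hd := damp_pos θ h
  calc _ ≤ (Real.exp κ * Real.exp (-(κ / 2) * rad ξ ^ lowExp θ * (1 + t)))
        * (rad ξ ^ (-lowOrder θ) * (A + B)) :=
      mul_le_mul (exp_rate_le hκ ht h h') (add_div_le_rpow_mul h0 hA hB h h') (by positivity)
        (by positivity)
    _ = _ := by rw [lowWeightZero]; ring

/-- The `L²`-weight that the low-frequency estimate of the energy of order `s` produces. -/
def lowWeightHigh (κ θ s t : ℝ) (ξ : E3) : ℝ :=
  rad ξ ^ (2 * s) * Real.exp (-1 * rad ξ ^ (2 * θ) * (1 + t))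
    + rad ξ ^ (2 * s + 2 - lowOrder θ) * Real.exp (-(κ / 2) * rad ξ ^ lowExp θ * (1 + t))

lemma low_high_le {θ κ s t A B : ℝ} (h0 : 0 ≤ θ) (hκ : 0 < κ) (ht : 0 ≤ t) (hA : 0 ≤ A)
    (hB : 0 ≤ B) {ξ : E3} (h : 0 < rad ξ) (h' : rad ξ ≤ 1) :
    rad ξ ^ (2 * s) * (Real.exp (-damp θ ξ * t) * B + Real.exp (-κ * rate θ ξ * t)
        * (rad ξ ^ 2 * (A + B / (rad ξ ^ 2 + damp θ ξ ^ 2))))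
      ≤ (Real.exp 1 + Real.exp κ) * (lowWeightHigh κ θ s t ξ * (A + B)) := by
  have h1 := low_zero_le h0 hκ ht hA hB h h'
  have h2 := exp_damp_le (t := t) h0 h'
  rw [lowWeightZero] at h1
  have e : rad ξ ^ (2 * s + 2 - lowOrder θ)
      = rad ξ ^ (2 * s) * rad ξ ^ 2 * rad ξ ^ (-lowOrder θ) := by
    rw [← Real.rpow_two, ← Real.rpow_add h, ← Real.rpow_add h]; congr 1
  rw [lowWeightHigh, e]
  set E₁ := Real.exp (-1 * rad ξ ^ (2 * θ) * (1 + t))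
  set E₂ := Real.exp (-(κ / 2) * rad ξ ^ lowExp θ * (1 + t))
  have e1 : 0 ≤ E₁ := (Real.exp_pos _).le
  have e2 : 0 ≤ E₂ := (Real.exp_pos _).le
  have r1 : 0 ≤ rad ξ ^ (2 * s) := by positivity
  have r2 : 0 ≤ rad ξ ^ (-lowOrder θ) := by positivity
  have x1 : 0 < Real.exp 1 := Real.exp_pos _
  have x2 : 0 < Real.exp κ := Real.exp_pos _
  calc _ = rad ξ ^ (2 * s) * (Real.exp (-damp θ ξ * t) * B + rad ξ ^ 2 *
          (Real.exp (-κ * rate θ ξ * t) * (A + B / (rad ξ ^ 2 + damp θ ξ ^ 2)))) := by ring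
    _ ≤ rad ξ ^ (2 * s) * (Real.exp 1 * E₁ * B + rad ξ ^ 2 *
          (Real.exp κ * (rad ξ ^ (-lowOrder θ) * E₂ * (A + B)))) := by gcongr
    _ ≤ rad ξ ^ (2 * s) * ((Real.exp 1 + Real.exp κ) * (E₁ * (A + B)) + rad ξ ^ 2 *
          ((Real.exp 1 + Real.exp κ) * (rad ξ ^ (-lowOrder θ) * E₂ * (A + B)))) := by
        gcongr ?_ * (?_ + ?_ * (?_ * _))
        · rw [mul_assoc]
          gcongr
          · linarith
          · linarith
        · linarith
    _ = _ := by ring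

lemma high_le {θ κ s t : ℝ} (h0 : 0 ≤ θ) (h1 : θ ≤ 1) (hκ : 0 < κ) (ht : 0 ≤ t)
    (u₀ u₁ : Fin 3 → L2) {ξ : E3} (h : 1 ≤ rad ξ) :
    rad ξ ^ (2 * s) * (Real.exp (-damp θ ξ * t) * specDensity u₁ ξ
        + Real.exp (-κ * rate θ ξ * t) * (rad ξ ^ 2 * (specDensity u₀ ξ
          + specDensity u₁ ξ / (rad ξ ^ 2 + damp θ ξ ^ 2))))
      ≤ 2 * (Real.exp (-min 1 (κ / 2) * t) * highDensity s u₀ u₁ ξ) := by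
  have hA := specDensity_nonneg u₀ ξ
  have hB := specDensity_nonneg u₁ ξ
  have hr : 0 < rad ξ := by linarith
  have d1 := one_le_damp h0 h
  have d2 := one_half_le_rate h0 h1 h
  set E := Real.exp (-min 1 (κ / 2) * t) with hE
  have e0 : 0 < E := Real.exp_pos _
  have e1 : Real.exp (-damp θ ξ * t) ≤ E := by
    rw [hE, Real.exp_le_exp]
    gcongr
    exact (min_le_left _ _).trans d1
  have e2 : Real.exp (-κ * rate θ ξ * t) ≤ E := by
    rw [hE, Real.exp_le_exp, neg_mul]
    gcongr
    exact (min_le_right _ _).trans (by nlinarith)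
  have e3 : rad ξ ^ 2 * (specDensity u₀ ξ + specDensity u₁ ξ / (rad ξ ^ 2 + damp θ ξ ^ 2))
      ≤ rad ξ ^ 2 * specDensity u₀ ξ + specDensity u₁ ξ := by
    have : rad ξ ^ 2 * (specDensity u₁ ξ / (rad ξ ^ 2 + damp θ ξ ^ 2)) ≤ specDensity u₁ ξ := by
      rw [mul_div_assoc', div_le_iff₀ (by positivity)]
      nlinarith [mul_nonneg hB (sq_nonneg (damp θ ξ))]
    linarith
  have e4 : rad ξ ^ (2 * (s + 1)) = rad ξ ^ (2 * s) * rad ξ ^ 2 := by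
    rw [← Real.rpow_two, ← Real.rpow_add hr]; congr 1; ring
  rw [highDensity, e4]
  have r1 : 0 < rad ξ ^ (2 * s) := by positivity
  calc _ ≤ rad ξ ^ (2 * s) * (E * specDensity u₁ ξ
          + E * (rad ξ ^ 2 * specDensity u₀ ξ + specDensity u₁ ξ)) := by gcongr
    _ ≤ rad ξ ^ (2 * s) * (2 * (E * (rad ξ ^ 2 * specDensity u₀ ξ + specDensity u₁ ξ))) := by
        gcongr
        have : 0 ≤ E * (rad ξ ^ 2 * specDensity u₀ ξ) := by positivity
        linarith
    _ = _ := by ring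

/-! ### From frequency densities to norms -/

lemma exists_exp_le_rpow (y : ℝ) {κ : ℝ} (hκ : 0 < κ) :
    ∃ C : ℝ, 0 < C ∧ ∀ t : ℝ, 0 ≤ t → Real.exp (-κ * t) ≤ C * (1 + t) ^ (-y) := by
  obtain ⟨C, hC, H⟩ := exists_rpow_le_mul_exp y hκ one_pos
  refine ⟨C * Real.exp κ, by positivity, fun t ht => ?_⟩
  have h1 := H (1 + t) (by linarith)
  have hT : 0 < 1 + t := by linarith
  rw [Real.rpow_one, mul_add, mul_one, Real.exp_add] at h1
  rw [Real.rpow_neg hT.le, neg_mul, Real.exp_neg, ← div_eq_mul_inv, le_div_iff₀ (by positivity),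
    inv_mul_le_iff₀ (Real.exp_pos _)]
  linarith

lemma rieszNorm_zero (f : L2) : rieszNorm 0 f = ‖f‖ₑ := by
  refine (ENNReal.pow_right_strictMono two_ne_zero).injective ?_
  simp only [rieszNorm_sq, enorm_sq_eq_lintegral_fourier]
  simp

lemma rieszNorm_sq_eq_lintegral_ofReal (σ : ℝ) (f : L2) : rieszNorm σ f ^ 2
    = ∫⁻ ξ, ENNReal.ofReal (rad ξ ^ (2 * σ) * ‖(𝓕 f : L2) ξ‖ ^ 2) := by
  rw [rieszNorm_sq]
  refine lintegral_congr fun ξ => ?_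
  rw [ENNReal.ofReal_mul (Real.rpow_nonneg (rad_nonneg ξ) _), ofReal_norm_sq]

/-- Exponential decay at high frequencies and polynomial decay at low frequencies give polynomial
decay. -/
lemma exists_rieszNorm_le {s : ℝ} (hs : 0 ≤ s) {κ C₁ C₂ : ℝ} (hκ : 0 < κ) (hC₁ : 0 < C₁)
    (hC₂ : 0 < C₂) (x : ℝ) :
    ∃ C : ℝ, 0 < C ∧ ∀ (m σ : ℝ) (u₀ u₁ : Fin 3 → L2) (f : L2) (t : ℝ), 0 ≤ t →
      (∀ᵐ ξ, 1 ≤ rad ξ → rad ξ ^ (2 * σ) * ‖(𝓕 f : L2) ξ‖ ^ 2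
        ≤ C₁ * (Real.exp (-κ * t) * highDensity s u₀ u₁ ξ)) →
      ∫⁻ ξ in {ξ | rad ξ ≤ 1}, ENNReal.ofReal (rad ξ ^ (2 * σ) * ‖(𝓕 f : L2) ξ‖ ^ 2)
        ≤ ENNReal.ofReal (C₂ * (1 + t) ^ (-(2 * x))) * totalNorm m s u₀ u₁ ^ 2 →
      rieszNorm σ f ≤ ENNReal.ofReal (C * (1 + t) ^ (-x)) * totalNorm m s u₀ u₁ := by
  obtain ⟨C₃, hC₃, H⟩ := exists_exp_le_rpow (2 * x) hκ
  refine ⟨√(C₁ * C₃ + C₂), by positivity, fun m σ u₀ u₁ f t ht hhigh hlow => ?_⟩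
  have hT : 0 < 1 + t := by linarith
  rw [← ENNReal.pow_le_pow_left_iff two_ne_zero, rieszNorm_sq_eq_lintegral_ofReal,
    ← lintegral_add_compl _ (measurableSet_rad_le 1), mul_pow, ← ENNReal.ofReal_pow (by positivity),
    mul_pow, Real.sq_sqrt (by positivity), ← Real.rpow_natCast, ← Real.rpow_mul hT.le]
  have h1 : ∫⁻ ξ in {ξ | rad ξ ≤ 1}ᶜ, ENNReal.ofReal (rad ξ ^ (2 * σ) * ‖(𝓕 f : L2) ξ‖ ^ 2)
      ≤ ENNReal.ofReal (C₁ * C₃ * (1 + t) ^ (-(2 * x))) * totalNorm m s u₀ u₁ ^ 2 := by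
    calc _ ≤ ∫⁻ ξ in {ξ | rad ξ ≤ 1}ᶜ, ENNReal.ofReal (C₁ * C₃ * (1 + t) ^ (-(2 * x)))
            * ENNReal.ofReal (highDensity s u₀ u₁ ξ) := by
          refine setLIntegral_mono_ae' (measurableSet_rad_le 1).compl ?_
          filter_upwards [hhigh] with ξ hξ hmem
          rw [← ENNReal.ofReal_mul (by positivity)]
          have hξ1 : 1 ≤ rad ξ := (lt_of_not_ge (show ¬rad ξ ≤ 1 from hmem)).le
          refine ENNReal.ofReal_le_ofReal ((hξ hξ1).trans ?_)
          have h2 := highDensity_nonneg s u₀ u₁ ξ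
          calc _ ≤ C₁ * (C₃ * (1 + t) ^ (-(2 * x)) * highDensity s u₀ u₁ ξ) := by
                gcongr; exact H t ht
            _ = _ := by ring
      _ = ENNReal.ofReal (C₁ * C₃ * (1 + t) ^ (-(2 * x)))
            * ∫⁻ ξ in {ξ | rad ξ ≤ 1}ᶜ, ENNReal.ofReal (highDensity s u₀ u₁ ξ) :=
          lintegral_const_mul' _ _ ENNReal.ofReal_ne_top
      _ ≤ _ := by
          gcongr
          exact (setLIntegral_le_lintegral _ _).trans (lintegral_highDensity_le hs u₀ u₁)
  refine (add_le_add hlow h1).trans_eq ?_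
  have e : -x * ((2 : ℕ) : ℝ) = -(2 * x) := by push_cast; ring
  rw [← add_mul, ← ENNReal.ofReal_add (by positivity) (by positivity), e]
  congr 2; ring

/-- Low-frequency part: a weighted bound by the density of the data and a bound for the weight. -/
lemma lintegral_low_le_of_weight {m s C₁ C₂ y T : ℝ} (hm₁ : 1 ≤ m) (hm₂ : m < 2) (hC₁ : 0 ≤ C₁)
    {u₀ u₁ : Fin 3 → L2} (hD : totalNorm m s u₀ u₁ ≠ ⊤) {w Φ : E3 → ℝ} (hw : Measurable w)
    (hw0 : ∀ ξ, 0 ≤ w ξ) {S : Set E3} (hS : MeasurableSet S)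
    (hΦ : ∀ᵐ ξ, ξ ∈ S → Φ ξ ≤ C₁ * (w ξ * (specDensity u₀ ξ + specDensity u₁ ξ)))
    (hint : ∀ K, HasLowMass (dataMeasure u₀ u₁) (6 / m - 3) K →
      ∫⁻ ξ in S, ENNReal.ofReal (w ξ) ∂(dataMeasure u₀ u₁)
        ≤ ENNReal.ofReal (C₂ * T ^ y) * K) :
    ∫⁻ ξ in S, ENNReal.ofReal (Φ ξ)
      ≤ ENNReal.ofReal (C₁ * C₂ * bernsteinConst * T ^ y) * totalNorm m s u₀ u₁ ^ 2 := by
  have h1 := hint _ (hasLowMass_dataMeasure hm₁ hm₂ hD)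
  rw [lintegral_dataMeasure u₀ u₁ hw hw0 hS] at h1
  calc _ ≤ ∫⁻ ξ in S, ENNReal.ofReal C₁
          * ENNReal.ofReal (w ξ * (specDensity u₀ ξ + specDensity u₁ ξ)) := by
        refine setLIntegral_mono_ae' hS ?_
        filter_upwards [hΦ] with ξ hξ hmem
        rw [← ENNReal.ofReal_mul hC₁]
        exact ENNReal.ofReal_le_ofReal (hξ hmem)
    _ = ENNReal.ofReal C₁
          * ∫⁻ ξ in S, ENNReal.ofReal (w ξ * (specDensity u₀ ξ + specDensity u₁ ξ)) :=
        lintegral_const_mul' _ _ ENNReal.ofReal_ne_top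
    _ ≤ ENNReal.ofReal C₁ * (ENNReal.ofReal (C₂ * T ^ y)
          * (ENNReal.ofReal bernsteinConst * totalNorm m s u₀ u₁ ^ 2)) := by gcongr
    _ = _ := by
        rw [show C₁ * C₂ * bernsteinConst * T ^ y = C₁ * ((C₂ * T ^ y) * bernsteinConst) by ring,
          ENNReal.ofReal_mul hC₁, ENNReal.ofReal_mul' bernsteinConst_pos.le]
        ring

/-! ### Decay of the energy of order `s` -/

lemma lowWeightZero_nonneg (κ θ t : ℝ) (ξ : E3) : 0 ≤ lowWeightZero κ θ t ξ := by
  have := rad_nonneg ξ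
  unfold lowWeightZero; positivity

lemma lowWeightHigh_nonneg (κ θ s t : ℝ) (ξ : E3) : 0 ≤ lowWeightHigh κ θ s t ξ := by
  have := rad_nonneg ξ
  unfold lowWeightHigh; positivity

@[fun_prop]
lemma measurable_lowWeightZero (κ θ t : ℝ) : Measurable (lowWeightZero κ θ t) := by
  unfold lowWeightZero; fun_prop

@[fun_prop]
lemma measurable_lowWeightHigh (κ θ s t : ℝ) : Measurable (lowWeightHigh κ θ s t) := by
  unfold lowWeightHigh; fun_prop

/-- The contribution of the velocity: `|ξ|^{2s} exp (-|ξ|^{2θ} T)` on the unit ball. -/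
lemma exists_lintegral_damp_le {g s θ y : ℝ} (hg : 0 < g) (hs : 0 ≤ s) (h0 : 0 ≤ θ)
    (hy : θ ≠ 0 → y ≤ (2 * s + g) / (2 * θ)) :
    ∃ C : ℝ, 0 < C ∧ ∀ (μ : Measure E3) (K : ℝ≥0∞), HasLowMass μ g K → ∀ t : ℝ, 0 ≤ t →
      ∫⁻ ξ in {ξ | rad ξ ≤ 1},
          ENNReal.ofReal (rad ξ ^ (2 * s) * Real.exp (-1 * rad ξ ^ (2 * θ) * (1 + t))) ∂μ
        ≤ ENNReal.ofReal (C * (1 + t) ^ (-y)) * K := by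
  rcases h0.eq_or_lt with h | h
  · -- for `θ = 0` the damping does not degenerate at low frequencies
    obtain ⟨C, hC, H⟩ := exists_exp_le_rpow y one_pos
    refine ⟨C, hC, fun μ K hμ t ht => ?_⟩
    have hT : 0 < 1 + t := by linarith
    calc _ ≤ ∫⁻ ξ in {ξ | rad ξ ≤ 1}, ENNReal.ofReal (C * (1 + t) ^ (-y)) ∂μ := by
          refine setLIntegral_mono' (measurableSet_rad_le 1) fun ξ hξ => ?_
          refine ENNReal.ofReal_le_ofReal (le_trans ?_ (H t ht))
          have h1 : rad ξ ^ (2 * s) ≤ 1 := Real.rpow_le_one (rad_nonneg ξ) hξ (by linarith)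
          have h2 : Real.exp (-1 * rad ξ ^ (2 * θ) * (1 + t)) ≤ Real.exp (-1 * t) := by
            rw [← h, mul_zero, Real.rpow_zero, Real.exp_le_exp]
            linarith
          exact (mul_le_of_le_one_left (Real.exp_pos _).le h1).trans h2
      _ = ENNReal.ofReal (C * (1 + t) ^ (-y)) * μ {ξ | rad ξ ≤ 1} := setLIntegral_const _ _
      _ ≤ _ := by
          gcongr
          simpa using hμ.measure_le 1 one_pos
  · obtain ⟨C, hC, H⟩ := exists_lintegral_exp_le hg.le (σ := 2 * s) (by linarith) one_pos
      (show 0 < 2 * θ by linarith)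
    refine ⟨C, hC, fun μ K hμ t ht => ?_⟩
    refine (setLIntegral_le_lintegral _ _).trans ((H μ K hμ (1 + t) (by linarith)).trans ?_)
    gcongr
    · linarith
    · exact hy h.ne'

lemma exists_lintegral_lowWeightHigh_le {g κ s θ y : ℝ} (hg : 0 < g) (hκ : 0 < κ) (hs : 0 ≤ s)
    (h0 : 0 ≤ θ) (hy₁ : y ≤ (2 * s + 2 - lowOrder θ + g) / lowExp θ)
    (hy₂ : θ ≠ 0 → y ≤ (2 * s + g) / (2 * θ)) :
    ∃ C : ℝ, 0 < C ∧ ∀ (μ : Measure E3) (K : ℝ≥0∞), HasLowMass μ g K → ∀ t : ℝ, 0 ≤ t →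
      ∫⁻ ξ in {ξ | rad ξ ≤ 1}, ENNReal.ofReal (lowWeightHigh κ θ s t ξ) ∂μ
        ≤ ENNReal.ofReal (C * (1 + t) ^ (-y)) * K := by
  obtain ⟨C₁, hC₁, H₁⟩ := exists_lintegral_damp_le hg hs h0 hy₂
  have hq : lowOrder θ ≤ 2 := min_le_left _ _
  obtain ⟨C₂, hC₂, H₂⟩ := exists_lintegral_exp_le hg.le (σ := 2 * s + 2 - lowOrder θ)
    (by linarith) (half_pos hκ) (lowExp_pos θ)
  refine ⟨C₁ + C₂, by positivity, fun μ K hμ t ht => ?_⟩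
  have hT : 0 < 1 + t := by linarith
  have e : ∀ ξ, ENNReal.ofReal (lowWeightHigh κ θ s t ξ)
      = ENNReal.ofReal (rad ξ ^ (2 * s) * Real.exp (-1 * rad ξ ^ (2 * θ) * (1 + t)))
        + ENNReal.ofReal (rad ξ ^ (2 * s + 2 - lowOrder θ)
          * Real.exp (-(κ / 2) * rad ξ ^ lowExp θ * (1 + t))) := fun ξ => by
    have := rad_nonneg ξ
    rw [lowWeightHigh, ENNReal.ofReal_add (by positivity) (by positivity)]
  simp only [e]
  rw [lintegral_add_left (by fun_prop), add_mul, ENNReal.ofReal_add (by positivity)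
    (by positivity), add_mul]
  refine add_le_add (H₁ μ K hμ t ht) ((setLIntegral_le_lintegral _ _).trans
    ((H₂ μ K hμ (1 + t) hT).trans ?_))
  gcongr
  linarith

/-- Decay of the energy of order `s` with the exponent `x`, which is limited by the diffusive
profile, of order `|ξ|^{lowExp θ}`, and by the damping of the velocity, of order `|ξ|^{2θ}`. -/
theorem exists_energy_decay {a b θ m s x : ℝ} (ha : a ≠ 0) (hb : b ≠ 0) (h0 : 0 ≤ θ) (h1 : θ ≤ 1)
    (hm₁ : 1 ≤ m) (hm₂ : m < 2) (hs : 0 ≤ s)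
    (hx₁ : 2 * x ≤ (2 * s + 2 - lowOrder θ + (6 / m - 3)) / lowExp θ)
    (hx₂ : θ ≠ 0 → 2 * x ≤ (2 * s + (6 / m - 3)) / (2 * θ)) :
    ∃ C : ℝ, 0 < C ∧ ∀ (u₀ u₁ : Fin 3 → L2) (u v : ℝ → Fin 3 → L2),
      totalNorm m s u₀ u₁ ≠ ⊤ → IsEnergySolution a b θ u₀ u₁ u v → ∀ t, 0 ≤ t → ∀ k,
      rieszNorm (s + 1) (u t k) ≤ ENNReal.ofReal (C * (1 + t) ^ (-x)) * totalNorm m s u₀ u₁ ∧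
      rieszNorm s (v t k) ≤ ENNReal.ofReal (C * (1 + t) ^ (-x)) * totalNorm m s u₀ u₁ := by
  have hg : 0 < 6 / m - 3 := by
    rw [sub_pos, lt_div_iff₀ (by linarith)]; linarith
  obtain ⟨C, κ, hC, hκ, H⟩ := exists_fourier_le ha hb h0 h1
  obtain ⟨C₁, hC₁, H₁⟩ := exists_lintegral_lowWeightHigh_le hg hκ hs h0 hx₁ hx₂
  have hb0 := bernsteinConst_pos
  obtain ⟨C₂, hC₂, H₂⟩ := exists_rieszNorm_le hs (κ := min 1 (κ / 2)) (C₁ := 2 * C)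
    (C₂ := C * (Real.exp 1 + Real.exp κ) * C₁ * bernsteinConst) (by positivity) (by positivity)
    (by positivity) x
  refine ⟨C₂, hC₂, fun u₀ u₁ u v hD hsol t ht k => ?_⟩
  have main : ∀ (f : L2) (σ : ℝ), (∀ᵐ ξ, rad ξ ^ (2 * σ) * ‖(𝓕 f : L2) ξ‖ ^ 2
      ≤ rad ξ ^ (2 * s) * (‖(𝓕 (v t k) : L2) ξ‖ ^ 2 + rad ξ ^ 2 * ‖(𝓕 (u t k) : L2) ξ‖ ^ 2)) →
      rieszNorm σ f ≤ ENNReal.ofReal (C₂ * (1 + t) ^ (-x)) * totalNorm m s u₀ u₁ := by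
    intro f σ hf
    have hpt : ∀ᵐ ξ, rad ξ ^ (2 * σ) * ‖(𝓕 f : L2) ξ‖ ^ 2
        ≤ C * (rad ξ ^ (2 * s) * (Real.exp (-damp θ ξ * t) * specDensity u₁ ξ
        + Real.exp (-κ * rate θ ξ * t) * (rad ξ ^ 2 *
          (specDensity u₀ ξ + specDensity u₁ ξ / (rad ξ ^ 2 + damp θ ξ ^ 2))))) := by
      filter_upwards [hf, H u₀ u₁ u v hsol t ht k] with ξ h2 h3
      refine h2.trans ((mul_le_mul_of_nonneg_left h3.2
        (Real.rpow_nonneg (rad_nonneg ξ) _)).trans_eq ?_)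
      ring
    refine H₂ m σ u₀ u₁ f t ht ?_ (lintegral_low_le_of_weight hm₁ hm₂ (by positivity) hD
      (measurable_lowWeightHigh κ θ s t) (lowWeightHigh_nonneg κ θ s t) (measurableSet_rad_le 1)
      ?_ fun K hK => H₁ _ K hK t ht)
    · filter_upwards [hpt] with ξ h2 h3
      refine h2.trans ((mul_le_mul_of_nonneg_left (high_le h0 h1 hκ ht u₀ u₁ h3) hC.le).trans_eq ?_)
      ring
    · filter_upwards [hpt, ae_rad_pos] with ξ h2 hpos h3
      refine h2.trans ((mul_le_mul_of_nonneg_left (low_high_le h0 hκ ht (specDensity_nonneg u₀ ξ)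
        (specDensity_nonneg u₁ ξ) hpos h3) hC.le).trans_eq ?_)
      ring
  constructor
  · refine main _ _ ?_
    filter_upwards [ae_rad_pos] with ξ hpos
    have e : rad ξ ^ (2 * (s + 1)) = rad ξ ^ (2 * s) * rad ξ ^ 2 := by
      rw [← Real.rpow_two, ← Real.rpow_add hpos]; congr 1; ring
    rw [e, mul_assoc]
    gcongr
    exact le_add_of_nonneg_left (by positivity)
  · refine main _ _ (Eventually.of_forall fun ξ => ?_)
    have := rad_nonneg ξ
    gcongr
    exact le_add_of_nonneg_right (by positivity)

/-! ### The norm of the solution -/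

lemma zero_high_le {θ κ t : ℝ} (h0 : 0 ≤ θ) (h1 : θ ≤ 1) (hκ : 0 < κ) (ht : 0 ≤ t)
    (u₀ u₁ : Fin 3 → L2) {ξ : E3} (h : 1 ≤ rad ξ) :
    Real.exp (-κ * rate θ ξ * t) * (specDensity u₀ ξ
        + specDensity u₁ ξ / (rad ξ ^ 2 + damp θ ξ ^ 2))
      ≤ 2 * (Real.exp (-min 1 (κ / 2) * t) * highDensity 0 u₀ u₁ ξ) := by
  refine le_trans ?_ (high_le h0 h1 hκ ht u₀ u₁ h)
  have hA := specDensity_nonneg u₀ ξ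
  have hB := specDensity_nonneg u₁ ξ
  have h2 : 1 ≤ rad ξ ^ 2 := one_le_pow₀ h
  have hp : 0 ≤ specDensity u₀ ξ + specDensity u₁ ξ / (rad ξ ^ 2 + damp θ ξ ^ 2) := by positivity
  rw [mul_zero, Real.rpow_zero, one_mul]
  refine le_trans ?_ (le_add_of_nonneg_left (by positivity))
  gcongr
  exact le_mul_of_one_le_left hp h2

/-- Decay of the norm of the solution when the data are integrable enough for the profile of the
solution to be square integrable near the frequency zero. -/
theorem exists_norm_decay {a b θ m x : ℝ} (ha : a ≠ 0) (hb : b ≠ 0) (h0 : 0 ≤ θ) (h1 : θ ≤ 1)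
    (hm₁ : 1 ≤ m) (hm₂ : m < 2) (hq : lowOrder θ < 6 / m - 3)
    (hx : 2 * x ≤ (-lowOrder θ + (6 / m - 3)) / lowExp θ) :
    ∃ C : ℝ, 0 < C ∧ ∀ (u₀ u₁ : Fin 3 → L2) (u v : ℝ → Fin 3 → L2),
      totalNorm m 0 u₀ u₁ ≠ ⊤ → IsEnergySolution a b θ u₀ u₁ u v → ∀ t, 0 ≤ t → ∀ k,
      ‖u t k‖ₑ ≤ ENNReal.ofReal (C * (1 + t) ^ (-x)) * totalNorm m 0 u₀ u₁ := by
  have hg : 0 ≤ 6 / m - 3 := (lowOrder_nonneg h0).trans hq.le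
  obtain ⟨C, κ, hC, hκ, H⟩ := exists_fourier_le ha hb h0 h1
  obtain ⟨C₁, hC₁, H₁⟩ := exists_lintegral_exp_le hg (σ := -lowOrder θ)
    (by linarith) (half_pos hκ) (lowExp_pos θ)
  have hb0 := bernsteinConst_pos
  obtain ⟨C₂, hC₂, H₂⟩ := exists_rieszNorm_le le_rfl (κ := min 1 (κ / 2)) (C₁ := 2 * C)
    (C₂ := C * Real.exp κ * C₁ * bernsteinConst) (by positivity) (by positivity)
    (by positivity) x
  refine ⟨C₂, hC₂, fun u₀ u₁ u v hD hsol t ht k => ?_⟩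
  have hT : 0 < 1 + t := by linarith
  rw [← rieszNorm_zero]
  refine H₂ m 0 u₀ u₁ _ t ht ?_ (lintegral_low_le_of_weight hm₁ hm₂ (by positivity) hD
    (measurable_lowWeightZero κ θ t) (lowWeightZero_nonneg κ θ t) (measurableSet_rad_le 1)
    ?_ fun K hK => (setLIntegral_le_lintegral _ _).trans ((H₁ _ K hK (1 + t) hT).trans ?_))
  · filter_upwards [H u₀ u₁ u v hsol t ht k] with ξ h2 h3
    rw [mul_zero, Real.rpow_zero, one_mul]
    refine h2.1.trans ((mul_le_mul_of_nonneg_left (zero_high_le h0 h1 hκ ht u₀ u₁ h3)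
      hC.le).trans_eq ?_)
    ring
  · filter_upwards [H u₀ u₁ u v hsol t ht k, ae_rad_pos] with ξ h2 hpos h3
    rw [mul_zero, Real.rpow_zero, one_mul]
    refine h2.1.trans ((mul_le_mul_of_nonneg_left (low_zero_le h0 hκ ht (specDensity_nonneg u₀ ξ)
      (specDensity_nonneg u₁ ξ) hpos h3) hC.le).trans_eq ?_)
    ring
  · gcongr
    linarith

/-- Integration in time of a bound for the velocity, seen through a bounded operator. -/
lemma IsEnergySolution.norm_map_le {a b θ : ℝ} {u₀ u₁ : Fin 3 → L2} {u v : ℝ → Fin 3 → L2}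
    (h : IsEnergySolution a b θ u₀ u₁ u v) (L : L2 →L[ℝ] L2) (k : Fin 3) {B B' : ℝ → ℝ}
    (hB0 : ‖L (u₀ k)‖ ≤ B 0) (hB : ∀ τ, 0 ≤ τ → HasDerivAt B (B' τ) τ)
    (hv : ∀ τ, 0 ≤ τ → ‖L (v τ k)‖ ≤ B' τ) {t : ℝ} (ht : 0 ≤ t) : ‖L (u t k)‖ ≤ B t := by
  have hd : ∀ τ, 0 ≤ τ → HasDerivWithinAt (fun τ => L (u τ k)) (L (v τ k)) (Set.Ici 0) τ :=
    fun τ hτ => L.hasFDerivAt.comp_hasDerivWithinAt τ (h.hasDeriv τ hτ k)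
  refine image_norm_le_of_norm_deriv_right_le_deriv_boundary' (a := 0) (b := t)
    (f := fun τ => L (u τ k)) (f' := fun τ => L (v τ k)) (B := B) (B' := B')
    (fun τ hτ => ((hd τ hτ.1).continuousWithinAt).mono fun _ hx => hx.1)
    (fun τ hτ => (hd τ hτ.1).mono (Set.Ici_subset_Ici.2 hτ.1)) ?_
    (fun τ hτ => (hB τ hτ.1).continuousAt.continuousWithinAt)
    (fun τ hτ => (hB τ hτ.1).hasDerivWithinAt) (fun τ hτ => hv τ hτ.1) ⟨ht, le_rfl⟩
  rw [h.initial_position]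
  exact hB0

lemma norm_le_of_enorm_le {f : L2} {c : ℝ} {D : ℝ≥0∞} (hc : 0 ≤ c) (hD : D ≠ ⊤)
    (h : ‖f‖ₑ ≤ ENNReal.ofReal c * D) : ‖f‖ ≤ c * D.toReal := by
  have h1 := ENNReal.toReal_mono (ENNReal.mul_ne_top ENNReal.ofReal_ne_top hD) h
  rwa [toReal_enorm, ENNReal.toReal_mul, ENNReal.toReal_ofReal hc] at h1

lemma enorm_le_of_norm_le {f : L2} {c : ℝ} {D : ℝ≥0∞} (hc : 0 ≤ c) (hD : D ≠ ⊤)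
    (h : ‖f‖ ≤ c * D.toReal) : ‖f‖ₑ ≤ ENNReal.ofReal c * D := by
  rw [← ofReal_norm]
  refine (ENNReal.ofReal_le_ofReal h).trans_eq ?_
  rw [ENNReal.ofReal_mul hc, ENNReal.ofReal_toReal hD]

lemma enorm_le_totalNorm (m s : ℝ) (hs : 0 ≤ s) (u₀ u₁ : Fin 3 → L2) (k : Fin 3) :
    ‖u₀ k‖ₑ ≤ totalNorm m s u₀ u₁ := by
  have h1 : ‖u₀ k‖ₑ ≤ sobolevNorm (s + 1) (u₀ k) := by
    rw [← ENNReal.pow_le_pow_left_iff two_ne_zero, enorm_sq_eq_lintegral_fourier, sobolevNorm_sq]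
    refine lintegral_mono fun ξ => le_mul_of_one_le_left' ?_
    rw [ENNReal.one_le_ofReal]
    exact Real.one_le_rpow (by nlinarith [sq_nonneg (rad ξ)]) (by linarith)
  exact (h1.trans (le_self_add.trans (sobolevNorm_add_sobolevNorm_le_dataNorm m s _ _))).trans
    (Finset.single_le_sum (f := fun j => dataNorm m s (u₀ j) (u₁ j)) (fun _ _ => bot_le)
      (Finset.mem_univ k))

/-- Integration in time of the decay of the velocity. -/
theorem exists_norm_le_of_velocity {a b θ m x : ℝ} (ha : a ≠ 0) (hb : b ≠ 0) (h0 : 0 ≤ θ)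
    (h1 : θ ≤ 1) (hm₁ : 1 ≤ m) (hm₂ : m < 2) (hx : x < 1)
    (hx₁ : 2 * x ≤ (2 - lowOrder θ + (6 / m - 3)) / lowExp θ)
    (hx₂ : θ ≠ 0 → 2 * x ≤ (6 / m - 3) / (2 * θ)) :
    ∃ C : ℝ, 0 < C ∧ ∀ (u₀ u₁ : Fin 3 → L2) (u v : ℝ → Fin 3 → L2),
      totalNorm m 0 u₀ u₁ ≠ ⊤ → IsEnergySolution a b θ u₀ u₁ u v → ∀ t, 0 ≤ t → ∀ k,
      ‖u t k‖ₑ ≤ ENNReal.ofReal (C * (1 + t) ^ (1 - x)) * totalNorm m 0 u₀ u₁ := by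
  obtain ⟨C, hC, H⟩ := exists_energy_decay (s := 0) (x := x) ha hb h0 h1 hm₁ hm₂ le_rfl
    (by simpa using hx₁) (by simpa using hx₂)
  have hx0 : 0 < 1 - x := by linarith
  -- `C / (1 - x)` comes from the primitive of `C (1 + τ)^{-x}`, and `1` from the initial position
  refine ⟨1 + C / (1 - x), by positivity, fun u₀ u₁ u v hD hsol t ht k => ?_⟩
  have hT : 0 < 1 + t := by linarith
  set D := totalNorm m 0 u₀ u₁ with hDdef
  refine enorm_le_of_norm_le (by positivity) hD ?_
  have hD0 : 0 ≤ D.toReal := ENNReal.toReal_nonneg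
  refine hsol.norm_map_le (ContinuousLinearMap.id ℝ L2) k
    (B := fun τ => (1 + C / (1 - x)) * (1 + τ) ^ (1 - x) * D.toReal)
    (B' := fun τ => (1 + C / (1 - x)) * (1 * (1 - x) * (1 + τ) ^ (1 - x - 1)) * D.toReal)
    ?_ (fun τ hτ => ?_) (fun τ hτ => ?_) ht
  · have h2 : ‖u₀ k‖ ≤ 1 * D.toReal :=
      norm_le_of_enorm_le zero_le_one hD (by simpa using enorm_le_totalNorm m 0 le_rfl u₀ u₁ k)
    simp only [ContinuousLinearMap.id_apply, add_zero, Real.one_rpow, mul_one]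
    refine h2.trans ?_
    gcongr
    exact le_add_of_nonneg_right (by positivity)
  · exact ((((hasDerivAt_id τ).const_add 1).rpow_const (p := 1 - x)
      (Or.inl (by simp only [id]; linarith))).const_mul _).mul_const _
  · have hτ' : 0 < 1 + τ := by linarith
    have h2 := (H u₀ u₁ u v hD hsol τ hτ k).2
    rw [rieszNorm_zero] at h2
    refine (norm_le_of_enorm_le (by positivity) hD h2).trans ?_
    gcongr ?_ * _
    rw [show 1 - x - 1 = -x by ring, ← mul_assoc]
    gcongr
    rw [add_mul, one_mul, one_mul, div_mul_cancel₀ _ hx0.ne']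
    linarith

lemma enorm_mulOp_cut_sq (R : ℝ) (f : L2) : ‖mulOp (cut R fun _ => 1) (𝓕 f : L2)‖ₑ ^ 2
    = ∫⁻ ξ in {ξ | rad ξ ≤ R}, ENNReal.ofReal (‖(𝓕 f : L2) ξ‖ ^ 2) := by
  rw [enorm_sq_eq_lintegral, ← lintegral_indicator (measurableSet_rad_le R)]
  refine lintegral_congr_ae ?_
  filter_upwards [mulOp_coeFn (bddWeight_cut_one R) (𝓕 f : L2)] with ξ h
  rw [h]
  by_cases hξ : rad ξ ≤ R
  · rw [cut_of_le hξ, Set.indicator_of_mem (s := {ξ | rad ξ ≤ R}) hξ, ofReal_norm_sq]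
    simp
  · rw [cut, Set.indicator_of_notMem (s := {ξ | rad ξ ≤ R}) hξ,
      Set.indicator_of_notMem (s := {ξ | rad ξ ≤ R}) hξ]
    simp

/-- A function whose Fourier transform is dominated by the data at low frequencies. -/
lemma enorm_mulOp_cut_le {m s C R : ℝ} (hm₁ : 1 ≤ m) (hm₂ : m < 2) (hC : 0 ≤ C) (hR : 0 < R)
    {u₀ u₁ : Fin 3 → L2} (hD : totalNorm m s u₀ u₁ ≠ ⊤) {f : L2}
    (hf : ∀ᵐ ξ, rad ξ ≤ R →
      ‖(𝓕 f : L2) ξ‖ ^ 2 ≤ C * (specDensity u₀ ξ + specDensity u₁ ξ)) :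
    ‖mulOp (cut R fun _ => 1) (𝓕 f : L2)‖
      ≤ √(C * bernsteinConst * R ^ (6 / m - 3)) * (totalNorm m s u₀ u₁).toReal := by
  have hb0 := bernsteinConst_pos
  refine norm_le_of_enorm_le (Real.sqrt_nonneg _) hD ?_
  rw [← ENNReal.pow_le_pow_left_iff two_ne_zero, enorm_mulOp_cut_sq, mul_pow,
    ← ENNReal.ofReal_pow (Real.sqrt_nonneg _), Real.sq_sqrt (by positivity)]
  have h1 := lintegral_low_le_of_weight (C₂ := 1) (y := 6 / m - 3) (T := R) hm₁ hm₂ hC hD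
    (w := fun _ => 1) (Φ := fun ξ => ‖(𝓕 f : L2) ξ‖ ^ 2) measurable_const
    (fun _ => zero_le_one) (measurableSet_rad_le R) ?_ fun K hK => ?_
  · simpa using h1
  · filter_upwards [hf] with ξ h2 h3
    rw [one_mul]
    exact h2 h3
  · simpa using hK.measure_le R hR

lemma lowOrder_le_two_mul_lowExp (θ : ℝ) : lowOrder θ ≤ 2 * lowExp θ := by
  have h1 : lowOrder θ ≤ 4 * θ := min_le_right _ _
  have h2 : 2 * θ ≤ lowExp θ := le_max_left _ _
  linarith

/-- Growth of the norm of the solution when its profile may fail to be square integrable near the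
frequency zero. The ball `|ξ| ≤ T^{-1/p}`, on which the damping is not yet visible at the time
`T = 1 + t`, is treated by integration of the velocity in time. -/
theorem exists_norm_growth {a b θ m : ℝ} (ha : a ≠ 0) (hb : b ≠ 0) (h0 : 0 ≤ θ) (h1 : θ ≤ 1)
    (hm₁ : 1 ≤ m) (hm₂ : m < 2) :
    ∃ C : ℝ, 0 < C ∧ ∀ (u₀ u₁ : Fin 3 → L2) (u v : ℝ → Fin 3 → L2),
      totalNorm m 0 u₀ u₁ ≠ ⊤ → IsEnergySolution a b θ u₀ u₁ u v → ∀ t, 0 ≤ t → ∀ k,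
      ‖u t k‖ₑ ≤ ENNReal.ofReal (C * (1 + t) ^ (1 - (6 / m - 3) / (2 * lowExp θ)))
        * totalNorm m 0 u₀ u₁ := by
  have hg : 0 < 6 / m - 3 := by
    rw [sub_pos, lt_div_iff₀ (by linarith)]; linarith
  set g := 6 / m - 3 with hgdef
  set p := lowExp θ with hpdef
  have hp : 0 < p := lowExp_pos θ
  obtain ⟨C, κ, hC, hκ, H⟩ := exists_fourier_le ha hb h0 h1
  obtain ⟨C₁, hC₁, H₁⟩ := exists_lintegral_exp_high_le hg.le (-lowOrder θ) (half_pos hκ) hp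
  have hb0 := bernsteinConst_pos
  obtain ⟨C₂, hC₂, H₂⟩ := exists_rieszNorm_le le_rfl (κ := min 1 (κ / 2)) (C₁ := 2 * C)
    (C₂ := (2 * C + 1) * bernsteinConst + C * Real.exp κ * C₁ * bernsteinConst) (by positivity)
    (by positivity) (by positivity) (-(1 - g / (2 * p)))
  refine ⟨C₂, hC₂, fun u₀ u₁ u v hD hsol t ht k => ?_⟩
  have hT : 1 ≤ 1 + t := by linarith
  have hT0 : 0 < 1 + t := by linarith
  set R := (1 + t) ^ (-(1 / p)) with hRdef
  have hR : 0 < R := Real.rpow_pos_of_pos hT0 _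
  have hR1 : R ≤ 1 := Real.rpow_le_one_of_one_le_of_nonpos hT (by
    have : 0 < 1 / p := by positivity
    linarith)
  have hRg : R ^ g = (1 + t) ^ (-(g / p)) := by
    rw [hRdef, ← Real.rpow_mul hT0.le]; congr 1; ring
  -- the ball of radius `R`
  have hball : ∫⁻ ξ in {ξ | rad ξ ≤ R}, ENNReal.ofReal (‖(𝓕 (u t k) : L2) ξ‖ ^ 2)
      ≤ ENNReal.ofReal ((2 * C + 1) * bernsteinConst * (1 + t) ^ (2 - g / p))
        * totalNorm m 0 u₀ u₁ ^ 2 := by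
    set M := √((2 * C + 1) * bernsteinConst * R ^ g) * (totalNorm m 0 u₀ u₁).toReal with hM
    let L : L2 →L[ℝ] L2 := ((mulOp (cut R fun _ => 1)).restrictScalars ℝ).comp
      ((Lp.fourierTransformₗᵢ E3 ℂ).toContinuousLinearEquiv.toContinuousLinearMap.restrictScalars ℝ)
    have hL : ∀ f, L f = mulOp (cut R fun _ => 1) (𝓕 f : L2) := fun f => rfl
    have h2 : ‖L (u t k)‖ ≤ M * (1 + t) := by
      refine hsol.norm_map_le L k (B := fun τ => M * (1 + τ)) (B' := fun _ => M * 1) ?_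
        (fun τ _ => ((hasDerivAt_id τ).const_add 1).const_mul M) (fun τ hτ => ?_) ht
      · rw [hL, add_zero, mul_one]
        refine enorm_mulOp_cut_le hm₁ hm₂ (by positivity) hR hD (Eventually.of_forall fun ξ _ => ?_)
        have hA : ‖(𝓕 (u₀ k) : L2) ξ‖ ^ 2 ≤ specDensity u₀ ξ :=
          Finset.single_le_sum (f := fun j => ‖(𝓕 (u₀ j) : L2) ξ‖ ^ 2)
            (fun _ _ => by positivity) (Finset.mem_univ k)
        have hA0 := specDensity_nonneg u₀ ξ
        have hB0 := specDensity_nonneg u₁ ξ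
        nlinarith [mul_nonneg hC.le (add_nonneg hA0 hB0)]
      · rw [hL, mul_one]
        refine enorm_mulOp_cut_le hm₁ hm₂ (by positivity) hR hD ?_
        filter_upwards [H u₀ u₁ u v hsol τ hτ k, ae_rad_pos] with ξ h3 hpos h4
        have hA0 := specDensity_nonneg u₀ ξ
        have hB0 := specDensity_nonneg u₁ ξ
        have hd := damp_pos θ hpos
        have hr := rate_nonneg θ ξ
        have e1 : Real.exp (-damp θ ξ * τ) ≤ 1 := by
          rw [Real.exp_le_one_iff]; nlinarith
        have e2 : Real.exp (-κ * rate θ ξ * τ) ≤ 1 := by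
          rw [Real.exp_le_one_iff]
          have : 0 ≤ κ * rate θ ξ * τ := by positivity
          linarith
        have e3 : rad ξ ^ 2 * (specDensity u₀ ξ + specDensity u₁ ξ / (rad ξ ^ 2 + damp θ ξ ^ 2))
            ≤ specDensity u₀ ξ + specDensity u₁ ξ := by
          have f1 : rad ξ ^ 2 ≤ 1 := pow_le_one₀ hpos.le (h4.trans hR1)
          have f2 : rad ξ ^ 2 * (specDensity u₁ ξ / (rad ξ ^ 2 + damp θ ξ ^ 2))
              ≤ specDensity u₁ ξ := by
            rw [mul_div_assoc', div_le_iff₀ (by positivity)]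
            nlinarith [mul_nonneg hB0 (sq_nonneg (damp θ ξ))]
          nlinarith
        calc ‖(𝓕 (v τ k) : L2) ξ‖ ^ 2
            ≤ C * (Real.exp (-damp θ ξ * τ) * specDensity u₁ ξ
              + Real.exp (-κ * rate θ ξ * τ) * (rad ξ ^ 2 *
              (specDensity u₀ ξ + specDensity u₁ ξ / (rad ξ ^ 2 + damp θ ξ ^ 2)))) :=
              (le_add_of_nonneg_right (by positivity)).trans h3.2
          _ ≤ C * (1 * specDensity u₁ ξ + 1 * (specDensity u₀ ξ + specDensity u₁ ξ)) := by gcongr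
          _ ≤ _ := by nlinarith [mul_nonneg hC.le hA0]
    have h3 := enorm_le_of_norm_le (c := √((2 * C + 1) * bernsteinConst * R ^ g) * (1 + t))
      (by positivity) hD (h2.trans_eq (by rw [hM]; ring))
    rw [hL, ← ENNReal.pow_le_pow_left_iff two_ne_zero, enorm_mulOp_cut_sq, mul_pow,
      ← ENNReal.ofReal_pow (by positivity), mul_pow, Real.sq_sqrt (by positivity)] at h3
    refine h3.trans_eq ?_
    rw [hRg, sub_eq_add_neg, Real.rpow_add hT0, Real.rpow_two]
    congr 2; ring
  -- the shell between `R` and `1`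
  have hS : MeasurableSet ({ξ : E3 | R ≤ rad ξ} ∩ {ξ | rad ξ ≤ 1}) :=
    (measurableSet_le measurable_const measurable_rad).inter (measurableSet_rad_le 1)
  have hshell : ∫⁻ ξ in {ξ | R ≤ rad ξ} ∩ {ξ | rad ξ ≤ 1},
        ENNReal.ofReal (‖(𝓕 (u t k) : L2) ξ‖ ^ 2)
      ≤ ENNReal.ofReal (C * Real.exp κ * C₁ * bernsteinConst * (1 + t) ^ (2 - g / p))
        * totalNorm m 0 u₀ u₁ ^ 2 := by
    refine lintegral_low_le_of_weight hm₁ hm₂ (by positivity) hD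
      (measurable_lowWeightZero κ θ t) (lowWeightZero_nonneg κ θ t) hS ?_ fun K hK =>
      (lintegral_mono_set Set.inter_subset_left).trans ((H₁ _ K hK (1 + t) hT0).trans ?_)
    · filter_upwards [H u₀ u₁ u v hsol t ht k, ae_rad_pos] with ξ h2 hpos h3
      refine h2.1.trans ((mul_le_mul_of_nonneg_left (low_zero_le h0 hκ ht
        (specDensity_nonneg u₀ ξ) (specDensity_nonneg u₁ ξ) hpos h3.2) hC.le).trans_eq ?_)
      ring
    · have h2 : lowOrder θ / p ≤ 2 := by
        rw [div_le_iff₀ hp]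
        exact lowOrder_le_two_mul_lowExp θ
      gcongr
      rw [add_div, neg_div]
      linarith
  rw [← rieszNorm_zero]
  have e : 1 - g / (2 * p) = -(-(1 - g / (2 * p))) := by ring
  rw [e]
  refine H₂ m 0 u₀ u₁ _ t ht ?_ ?_
  · filter_upwards [H u₀ u₁ u v hsol t ht k] with ξ h2 h3
    rw [mul_zero, Real.rpow_zero, one_mul]
    refine h2.1.trans ((mul_le_mul_of_nonneg_left (zero_high_le h0 h1 hκ ht u₀ u₁ h3)
      hC.le).trans_eq ?_)
    ring
  · simp only [mul_zero, Real.rpow_zero, one_mul]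
    have hcov : {ξ : E3 | rad ξ ≤ 1} ⊆ {ξ | rad ξ ≤ R} ∪ ({ξ | R ≤ rad ξ} ∩ {ξ | rad ξ ≤ 1}) :=
      fun ξ hξ => (le_total (rad ξ) R).imp id fun h => ⟨h, hξ⟩
    refine (lintegral_mono_set hcov).trans ((lintegral_union_le _ _ _).trans
      ((add_le_add hball hshell).trans_eq ?_))
    have e2 : -(2 * -(1 - g / (2 * p))) = 2 - g / p := by field_simp
    rw [← add_mul, ← ENNReal.ofReal_add (by positivity) (by positivity), e2, ← add_mul]

/-! ### The admissible exponents -/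

lemma lowExp_of_lt {θ : ℝ} (h : θ < 1 / 2) : lowExp θ = 2 - 2 * θ := max_eq_right (by linarith)

lemma lowExp_of_le {θ : ℝ} (h : 1 / 2 ≤ θ) : lowExp θ = 2 * θ := max_eq_left (by linarith)

lemma lowOrder_of_lt {θ : ℝ} (h : θ < 1 / 2) : lowOrder θ = 4 * θ := min_eq_right (by linarith)

lemma lowOrder_of_le {θ : ℝ} (h : 1 / 2 ≤ θ) : lowOrder θ = 2 := min_eq_left (by linarith)

lemma AdmissibleHigh.two_mul_le {θ m s ρ : ℝ} (hθ : θ < 1 / 2) (h0 : 0 ≤ θ) (hm : 0 < m)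
    (h : AdmissibleHigh θ m s ρ) :
    2 * ρ ≤ (2 * s + 2 - lowOrder θ + (6 / m - 3)) / lowExp θ ∧
      (θ ≠ 0 → 2 * ρ ≤ (2 * s + (6 / m - 3)) / (2 * θ)) := by
  refine ⟨?_, fun hne => ?_⟩
  · have h1 := h.1.le
    have h2 : 0 < 1 - θ := by linarith
    rw [lowExp_of_lt hθ, lowOrder_of_lt hθ]
    calc _ ≤ 2 * ((6 - 3 * m + 2 * s * m + 2 * m * (1 - 2 * θ)) / (4 * m * (1 - θ))) := by gcongr
      _ = _ := by
        rw [show 2 - 2 * θ = 2 * (1 - θ) by ring]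
        field_simp
        ring
  · have h1 := (h.2 hne).le
    have h2 : 0 < θ := lt_of_le_of_ne h0 (Ne.symm hne)
    calc _ ≤ 2 * ((6 - 3 * m + 2 * s * m) / (4 * m * θ)) := by gcongr
      _ = _ := by
        field_simp
        ring

lemma AdmissibleZero.two_mul_le {θ m ρ : ℝ} (hθ : θ < 1 / 2) (hm : 0 < m)
    (h : AdmissibleZero θ m ρ) : 2 * ρ ≤ (-lowOrder θ + (6 / m - 3)) / lowExp θ := by
  have h1 := h.1.le
  have h2 : 0 < 1 - θ := by linarith
  rw [lowExp_of_lt hθ, lowOrder_of_lt hθ]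
  calc _ ≤ 2 * ((6 - 5 * m + 2 * m * (1 - 2 * θ)) / (4 * m * (1 - θ))) := by gcongr
    _ = _ := by
      rw [show 2 - 2 * θ = 2 * (1 - θ) by ring]
      field_simp
      ring

lemma AdmissibleHigh.lt_one {θ m ρ : ℝ} (hθ : θ < 1 / 2) (hm : 6 / 5 ≤ m)
    (h : AdmissibleHigh θ m 0 ρ) : ρ < 1 := by
  refine h.1.trans_le ?_
  rw [div_le_one (by nlinarith)]
  nlinarith

lemma decayHigh_pos {θ m s ρ t : ℝ} (ht : 0 ≤ t) : 0 < decayHigh θ m s ρ t := by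
  unfold decayHigh
  split_ifs <;> positivity

lemma decayZero_pos {θ m ρ₀ ρ₁ t : ℝ} (ht : 0 ≤ t) : 0 < decayZero θ m ρ₀ ρ₁ t := by
  unfold decayZero
  split_ifs <;> positivity

theorem exists_norm_le_decayZero {a b θ m ρ₀ ρ₁ : ℝ} (ha : a ≠ 0) (hb : b ≠ 0) (h0 : 0 ≤ θ)
    (h1 : θ ≤ 1) (hm₁ : 1 ≤ m) (hm₂ : m < 2)
    (hρ₀ : θ < 1 / 2 → m < 6 / 5 → AdmissibleZero θ m ρ₀)
    (hρ₁ : θ < 1 / 2 → 6 / 5 ≤ m → AdmissibleHigh θ m 0 ρ₁) :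
    ∃ C : ℝ, 0 < C ∧ ∀ (u₀ u₁ : Fin 3 → L2) (u v : ℝ → Fin 3 → L2),
      totalNorm m 0 u₀ u₁ ≠ ⊤ → IsEnergySolution a b θ u₀ u₁ u v → ∀ t, 0 ≤ t → ∀ k,
      ‖u t k‖ₑ ≤ ENNReal.ofReal (C * decayZero θ m ρ₀ ρ₁ t) * totalNorm m 0 u₀ u₁ := by
  have hm : 0 < m := by linarith
  unfold decayZero
  by_cases hm6 : m < 6 / 5
  · -- here `6 / m - 3 > 2`, which exceeds the order of the singularity of the profile
    have hq : lowOrder θ < 6 / m - 3 := by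
      refine (min_le_left _ _).trans_lt ?_
      rw [lt_sub_iff_add_lt, lt_div_iff₀ hm]
      linarith
    by_cases hθ : θ < 1 / 2
    · simp only [if_pos hθ, if_pos hm6]
      exact exists_norm_decay ha hb h0 h1 hm₁ hm₂ hq ((hρ₀ hθ hm6).two_mul_le hθ hm)
    · simp only [if_neg hθ, if_pos hm6]
      have hθ' := not_lt.1 hθ
      have hθ0 : 0 < θ := by linarith
      refine exists_norm_decay ha hb h0 h1 hm₁ hm₂ hq (le_of_eq ?_)
      rw [lowExp_of_le hθ', lowOrder_of_le hθ']
      field_simp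
      ring
  · by_cases hθ : θ < 1 / 2
    · simp only [if_pos hθ, if_neg hm6]
      have hA := hρ₁ hθ (not_lt.1 hm6)
      have h2 := hA.two_mul_le hθ h0 hm
      exact exists_norm_le_of_velocity ha hb h0 h1 hm₁ hm₂ (hA.lt_one hθ (not_lt.1 hm6))
        (by simpa using h2.1) (by simpa using h2.2)
    · simp only [if_neg hθ, if_neg hm6]
      have hθ' := not_lt.1 hθ
      have hθ0 : 0 < θ := by linarith
      have e : (6 - 3 * m) / (4 * m * θ) = (6 / m - 3) / (2 * lowExp θ) := by
        rw [lowExp_of_le hθ']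
        field_simp
        ring
      rw [e]
      exact exists_norm_growth ha hb h0 h1 hm₁ hm₂

theorem exists_energy_le_decayHigh {a b θ m s ρ : ℝ} (ha : a ≠ 0) (hb : b ≠ 0) (h0 : 0 ≤ θ)
    (h1 : θ ≤ 1) (hm₁ : 1 ≤ m) (hm₂ : m < 2) (hs : 0 ≤ s)
    (hρ : θ < 1 / 2 → AdmissibleHigh θ m s ρ) :
    ∃ C : ℝ, 0 < C ∧ ∀ (u₀ u₁ : Fin 3 → L2) (u v : ℝ → Fin 3 → L2),
      totalNorm m s u₀ u₁ ≠ ⊤ → IsEnergySolution a b θ u₀ u₁ u v → ∀ t, 0 ≤ t → ∀ k,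
      rieszNorm (s + 1) (u t k) ≤ ENNReal.ofReal (C * decayHigh θ m s ρ t) * totalNorm m s u₀ u₁ ∧
      rieszNorm s (v t k) ≤ ENNReal.ofReal (C * decayHigh θ m s ρ t) * totalNorm m s u₀ u₁ := by
  have hm : 0 < m := by linarith
  unfold decayHigh
  by_cases hθ : θ < 1 / 2
  · simp only [if_pos hθ]
    have h2 := (hρ hθ).two_mul_le hθ h0 hm
    exact exists_energy_decay ha hb h0 h1 hm₁ hm₂ hs h2.1 h2.2
  · simp only [if_neg hθ]
    have hθ' := not_lt.1 hθ
    have hθ0 : 0 < θ := by linarith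
    have e : 2 * ((6 - 3 * m + 2 * s * m) / (4 * m * θ)) = (2 * s + (6 / m - 3)) / (2 * θ) := by
      field_simp
      ring
    refine exists_energy_decay ha hb h0 h1 hm₁ hm₂ hs ?_ fun _ => e.le
    rw [e, lowExp_of_le hθ', lowOrder_of_le hθ', add_sub_cancel_right]

lemma totalNorm_zero_le {m s : ℝ} (hs : 0 ≤ s) (u₀ u₁ : Fin 3 → L2) :
    totalNorm m 0 u₀ u₁ ≤ totalNorm m s u₀ u₁ := by
  have h : ∀ (σ τ : ℝ) (f : L2), σ ≤ τ → sobolevNorm σ f ≤ sobolevNorm τ f := fun σ τ f hle => by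
    unfold sobolevNorm
    gcongr
    exact le_add_of_nonneg_right (sq_nonneg _)
  unfold totalNorm dataNorm
  gcongr <;> exact h _ _ _ (by linarith)

end DampedElastic

end

theorem mainTheorem9
    (a b θ m s ρ₀ ρ₁ ρ : ℝ)
    (ha : 0 < a ^ 2) (hab : a ^ 2 < b ^ 2)
    (hθ₀ : 0 ≤ θ) (hθ₁ : θ ≤ 1) (hm₁ : 1 ≤ m) (hm₂ : m < 2) (hs : 0 ≤ s)
    (hρ₀ : θ < 1 / 2 → m < 6 / 5 → DampedElastic.AdmissibleZero θ m ρ₀)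
    (hρ₁ : θ < 1 / 2 → 6 / 5 ≤ m → DampedElastic.AdmissibleHigh θ m 0 ρ₁)
    (hρ : θ < 1 / 2 → DampedElastic.AdmissibleHigh θ m s ρ) :
    ∃ C : ℝ, 0 < C ∧
      ∀ (u₀ u₁ : Fin 3 → DampedElastic.L2) (u v : ℝ → Fin 3 → DampedElastic.L2),
        (∀ k, DampedElastic.dataNorm m s (u₀ k) (u₁ k) < ⊤) →
        DampedElastic.IsEnergySolution a b θ u₀ u₁ u v →
        ∀ t : ℝ, 0 ≤ t → ∀ k : Fin 3,
          (‖u t k‖ₑ ≤ ENNReal.ofReal (C * DampedElastic.decayZero θ m ρ₀ ρ₁ t)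
              * ∑ j : Fin 3, DampedElastic.dataNorm m 0 (u₀ j) (u₁ j)) ∧
          (DampedElastic.rieszNorm (s + 1) (u t k) + DampedElastic.rieszNorm s (v t k)
            ≤ ENNReal.ofReal (C * DampedElastic.decayHigh θ m s ρ t)
              * ∑ j : Fin 3, DampedElastic.dataNorm m s (u₀ j) (u₁ j)) := by
  have ha' : a ≠ 0 := fun h => by simp [h] at ha
  have hb' : b ≠ 0 := fun h => by
    rw [h] at hab
    norm_num at hab
    exact absurd hab (not_lt.2 (sq_nonneg a))
  obtain ⟨C₁, hC₁, H₁⟩ := DampedElastic.exists_norm_le_decayZero (m := m) (ρ₀ := ρ₀) (ρ₁ := ρ₁)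
    ha' hb' hθ₀ hθ₁ hm₁ hm₂ hρ₀ hρ₁
  obtain ⟨C₂, hC₂, H₂⟩ := DampedElastic.exists_energy_le_decayHigh ha' hb' hθ₀ hθ₁ hm₁ hm₂ hs hρ
  refine ⟨C₁ + 2 * C₂, by positivity, fun u₀ u₁ u v hdata hsol t ht k => ?_⟩
  have hD : DampedElastic.totalNorm m s u₀ u₁ ≠ ⊤ :=
    (ENNReal.sum_lt_top.2 fun j _ => hdata j).ne
  have hD0 : DampedElastic.totalNorm m 0 u₀ u₁ ≠ ⊤ :=
    ne_top_of_le_ne_top hD (DampedElastic.totalNorm_zero_le hs u₀ u₁)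
  have p₁ := DampedElastic.decayZero_pos (θ := θ) (m := m) (ρ₀ := ρ₀) (ρ₁ := ρ₁) ht
  have p₂ := DampedElastic.decayHigh_pos (θ := θ) (m := m) (s := s) (ρ := ρ) ht
  constructor
  · refine (H₁ u₀ u₁ u v hD0 hsol t ht k).trans ?_
    rw [DampedElastic.totalNorm]
    gcongr
    linarith
  · obtain ⟨h1, h2⟩ := H₂ u₀ u₁ u v hD hsol t ht k
    refine (add_le_add h1 h2).trans ?_
    rw [← add_mul, ← ENNReal.ofReal_add (by positivity) (by positivity), ← add_mul,
      DampedElastic.totalNorm]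
    gcongr ENNReal.ofReal (?_ * _) * _
    linarith
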